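/- **Setting.** Fix a vocabulary of $V$ tokens and an auto-regressive language model to which all algorithms have black-box sampling access. A multi-designated detector watermarking (MDDW) scheme consists of $\mathsf{Setup}(1^\lambda)\to pp$, $\mathsf{WatKG}(pp)\to(wpk,wsk)$, $\mathsf{DetKG}(pp)\to(dpk,dsk)$, $\mathsf{WatMar}(pp,wsk_i,\{dpk_j\}_{j\in S},p)\to t$ and $\mathsf{Detect}(pp,wpk_i,dsk_{j'},\{dpk_j\}_{j\in S},t)\to\{0,1\}$ for $j'\in S$; all are PPT, except that of $\mathsf{WatMar}$ only polynomial text length is required. In the games below the adversary has oracles for honestly generated key pairs $(wpk_i,wsk_i)$ and $(dpk_j,dsk_j)$ (lazily sampled, one pair per index), for the public keys alone, and for $\mathsf{Detect}$. * *$\delta$-complete* ($\delta=\delta(\lambda,|S|)$ computable in polynomial time): for honest keys and $t\leftarrow\mathsf{WatMar}(pp,wsk_i,\{dpk_j\}_{j\in S},p)$, for all $i,S,p$ of size polynomial in $\lambda$ and all $j'\in S$, the probability that $|t|\ge\delta$ and detector $j'$ rejects $t$ is negligible. * *$k$-sound*: a PPT adversary with these oracles and a watermarking oracle outputs only with negligible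 probability a triple $(i^*,S^*,t^*)$ such that $wsk_{i^*}$ was never asked for, $t^*$ shares no window of $k$ tokens with any text obtained from the watermarking oracle on $(i^*,S^*,\cdot)$, and some $j'\in S^*$ whose $dsk_{j'}$ was never asked for accepts $t^*$. * *Off-the-record for any subset*: there is a PPT simulator $\mathsf{FgeAS}(pp,wpk_i,\{dpk_j\}_{j\in S},\{dsk_j\}_{j\in S_{cor}},p)$ such that no PPT adversary guesses a uniform bit $b$ with probability non-negligibly different from $1/2$, given the key oracles, the $\mathsf{Detect}$ oracle (not on texts already returned by the challenge oracle) and a challenge oracle that on $(i,S,S_{cor},p)$, $S_{cor}\subseteq S$, returns an output of $\mathsf{WatMar}$ if $b=0$ and of $\mathsf{FgeAS}$ if $b=1$; $wsk_i$ and $dsk_j$ with $j\in S\setminus S_{cor}$ may not be asked for, for any challenge. A *watermark* of the scheme is a bit string $w(t)=w(pp,wpk_i,\{dpk_j\}_{j\in S},t)$ that can be extracted from a text in deterministic polynomial time and through which alone the output distribution of $\mathsf{Detect}(pp,wpk_i,dsk,\{dpk_j\}_{j\in S},t)$, for every $dsk$, depends on $t$ (for instance the text itself, written in bits). **Theorem.**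 Let an MDDW scheme be $\delta$-complete, $k$-sound (for some $k=k(\lambda)$) and off-the-record for any subset, and let $w$ be a watermark of it. Let $i(\lambda),S(\lambda),p(\lambda)$ be a provider, a set of $n=n(\lambda)=|S(\lambda)|$ designated detectors and a prompt, computable in polynomial time from $1^\lambda$, and let $t\leftarrow\mathsf{WatMar}$ be generated for them with honest keys. Then the watermark in $t$ has size $\Omega(n)$: 1. there is a negligible $\varepsilon$ such that for all $\lambda$ $$\Pr\big[\,|t|\ge\delta(\lambda,n)\ \text{ and }\ |w(t)|<n/2\,\big]\ \le\ 2^{-\lfloor n/2\rfloor}+\varepsilon(\lambda);$$ 2. if $\Pr[|t|<\delta(\lambda,n)]$ is negligible and the watermarks so generated always have at most $\ell(\lambda)$ bits, then $\ell(\lambda)\ge n(\lambda)/2$ for all sufficiently large $\lambda$. -/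

import Mathlib

open Filter

noncomputable section

namespace Watermarking

/-! ### Data and encodings -/

/-- The data that algorithms handle: finite binary trees. -/
inductive Data where
  | nil : Data
  | cons : Data → Data → Data

namespace Data

/-- The number of nodes of a tree, its length as an input. -/
def size : Data → ℕ
  | nil => 1
  | cons a b => a.size + b.size + 1

def isNil : Data → Bool
  | nil => true
  | cons _ _ => false

def hd : Data → Data
  | nil => nil
  | cons a _ => a

def tl : Data → Data
  | nil => nil
  | cons _ b => b

/-- A list is written as a right comb. -/
def ofList : List Data → Data
  | [] => nil
  | a :: l => cons a (ofList l)

def toList : Data → List Data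
  | nil => []
  | cons a b => a :: b.toList

/-- Numbers are written in unary. -/
def ofNat : ℕ → Data
  | 0 => nil
  | n + 1 => cons nil (ofNat n)

def toNat : Data → ℕ
  | nil => 0
  | cons _ b => b.toNat + 1

def ofBool : Bool → Data
  | false => nil
  | true => cons nil nil

def toBool (d : Data) : Bool := !d.isNil

def ofBits (l : List Bool) : Data := ofList (l.map ofBool)

/-- A finite set of numbers is written as its increasing enumeration. -/
def ofFinset (S : Finset ℕ) : Data := ofList ((S.sort (· ≤ ·)).map ofNat)

def toFinset (d : Data) : Finset ℕ := (d.toList.map toNat).toFinset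

end Data

/-- Token sequences over a vocabulary of `V` tokens (texts and prompts). -/
abbrev Text (V : ℕ) : Type := List (Fin V)

namespace Data

def ofText {V : ℕ} (t : Text V) : Data := ofList (t.map fun x => ofNat x)

/-- Entries that are not tokens are skipped, so every tree may be read as a text. -/
def toText (V : ℕ) (d : Data) : Text V :=
  d.toList.filterMap fun x => if h : x.toNat < V then some ⟨x.toNat, h⟩ else none

/-- The tuple `(a₁, …, aₙ)` as one input. -/
def tuple (l : List Data) : Data := ofList l

end Data

/-- An auto-regressive language model with its decoding method: the distribution of the next
token, given a prompt and the tokens generated so far. -/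
abbrev LanguageModel (V : ℕ) : Type := Text V → Text V → PMF (Fin V)

/-! ### Probabilistic oracle programs and their running time -/

/-- Programs; each one transforms a tree into a tree. -/
inductive Prog where
  | id : Prog
  | nil : Prog
  | hd : Prog
  | tl : Prog
  /-- `x ↦ (p x, q x)` -/
  | pair (p q : Prog) : Prog
  /-- first `p`, then `q` -/
  | comp (p q : Prog) : Prog
  /-- if `c x` is not `nil` then `p x`, else `q x` -/
  | ite (c p q : Prog) : Prog
  /-- while `c x` is not `nil` replace `x` by `p x` -/
  | loop (c p : Prog) : Prog
  /-- toss a fair coin -/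
  | coin : Prog
  /-- let the language model generate one token -/
  | token : Prog
  /-- ask the oracle -/
  | query : Prog

/-- What a program interacts with, in a monad `m` of effects. -/
structure Env (m : Type → Type) where
  coin : m Bool
  token : Data → m Data
  query : Data → m Data

namespace Prog

/-- A while-loop that is cut off after a given number of rounds. The second component of every
result is the number of steps. -/
def iterate {m : Type → Type} [Monad m] (c p : Data → m (Data × ℕ)) :
    ℕ → Data → m (Data × ℕ)
  | 0, x => pure (x, 0)
  | k + 1, x => do
    let r ← c x
    if r.1.isNil then
      pure (x, r.2)
    else
      let y ← p x
      let z ← iterate c p k y.1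
      pure (z.1, r.2 + y.2 + z.2)

/-- Run a program: the output and the number of steps. An elementary operation takes as many steps
as its argument and its result have nodes together, so the step count bounds the size of everything
that is read or written. Loops are cut off after `fuel` rounds; each round takes at least one step,
so if the step count is below `fuel` no loop was cut off and this is the true execution. -/
def run {m : Type → Type} [Monad m] (E : Env m) (fuel : ℕ) : Prog → Data → m (Data × ℕ)
  | id, x => pure (x, x.size + x.size)
  | nil, x => pure (Data.nil, x.size + 1)
  | hd, x => pure (x.hd, x.size + x.hd.size)
  | tl, x => pure (x.tl, x.size + x.tl.size)
  | pair p q, x => do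
    let a ← run E fuel p x
    let b ← run E fuel q x
    pure (Data.cons a.1 b.1, a.2 + b.2 + (Data.cons a.1 b.1).size)
  | comp p q, x => do
    let a ← run E fuel p x
    let b ← run E fuel q a.1
    pure (b.1, a.2 + b.2)
  | ite c p q, x => do
    let r ← run E fuel c x
    let a ← if r.1.isNil then run E fuel q x else run E fuel p x
    pure (a.1, r.2 + a.2)
  | loop c p, x => iterate (run E fuel c) (run E fuel p) fuel x
  | coin, x => do
    let b ← E.coin
    pure (Data.ofBool b, x.size + (Data.ofBool b).size)
  | token, x => do
    let y ← E.token x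
    pure (y, x.size + y.size)
  | query, x => do
    let y ← E.query x
    pure (y, x.size + y.size)

end Prog

def fairCoin : PMF Bool := PMF.uniformOfFintype Bool

/-- One token of the model on (prompt, tokens so far). -/
def sampleToken {V : ℕ} (Model : LanguageModel V) (x : Data) : PMF Data :=
  (Model (x.hd.toText V) (x.tl.toText V)).map fun a => Data.ofNat a

/-- The environment of a stand-alone algorithm: coins and black-box access to the model. -/
def plainEnv {V : ℕ} (Model : LanguageModel V) : Env PMF where
  coin := fairCoin
  token := sampleToken Model
  query := fun _ => PMF.pure Data.nil

/-- Probabilistic polynomial-time algorithms: on every input and for every outcome of the random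
choices, the number of steps is at most a polynomial in the length of the input. -/
structure PPT {V : ℕ} (Model : LanguageModel V) where
  prog : Prog
  bound : Polynomial ℕ
  halts : ∀ x : Data, ∀ r ∈ (prog.run (plainEnv Model) (bound.eval x.size + 1) x).support,
    r.2 ≤ bound.eval x.size

/-- The distribution of the output. -/
def PPT.eval {V : ℕ} {Model : LanguageModel V} (A : PPT Model) (x : Data) : PMF Data :=
  (A.prog.run (plainEnv Model) (A.bound.eval x.size + 1) x).map Prod.fst

/-- The probability of an event. -/
def Pr {α : Type} (μ : PMF α) (P : α → Prop) : ℝ := (μ.toOuterMeasure {a | P a}).toReal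

/-- Negligible functions of the security parameter. -/
def Negligible (f : ℕ → ℝ) : Prop :=
  Asymptotics.SuperpolynomialDecay atTop (fun κ : ℕ => (κ : ℝ)) f

/-! ### Watermarking schemes -/

/-- The algorithms of a multi-designated detector watermarking scheme. Their inputs are
* `setup`: `1^κ`;
* `watKG`, `detKG`: `(1^κ, pp)`; the output is the pair of a public and a secret key;
* `watMar`: `(1^κ, pp, wsk, (j, dpk_j)_{j ∈ S}, prompt)`;
* `detect`: `(1^κ, pp, wpk, dsk, (j, dpk_j)_{j ∈ S}, text)`; the output is a bit.

The watermarking algorithm may be any random procedure with texts of polynomial length; it need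
not have a strict time bound (think of rejection sampling). -/
structure Scheme {V : ℕ} (Model : LanguageModel V) where
  setup : PPT Model
  watKG : PPT Model
  detKG : PPT Model
  watMar : Data → PMF (Text V)
  detect : PPT Model
  watLen : Polynomial ℕ
  watMar_length : ∀ x : Data, ∀ t ∈ (watMar x).support, t.length ≤ watLen.eval x.size

/-- The state of a security game. -/
structure GameState (V : ℕ) where
  /-- the key pairs of the model providers generated so far -/
  wk : ℕ → Option (Data × Data)
  /-- the key pairs of the detectors generated so far -/
  dk : ℕ → Option (Data × Data)
  /-- the model providers whose secret key the adversary asked for -/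
  wkAsked : Finset ℕ
  /-- the detectors whose secret key the adversary asked for -/
  dkAsked : Finset ℕ
  /-- the answers `(i, S, t)` of the watermarking oracle -/
  marked : List (ℕ × Finset ℕ × Text V)
  /-- the answers `(i, S, S_cor, t)` of the challenge oracle -/
  challenged : List (ℕ × Finset ℕ × Finset ℕ × Text V)

def GameState.init (V : ℕ) : GameState V := ⟨fun _ => none, fun _ => none, ∅, ∅, [], []⟩

/-- Random computations that use the state of a game. -/
abbrev Game (V : ℕ) : Type → Type := StateT (GameState V) PMF

/-- Random choices that leave the state alone. -/
def Game.sample {V : ℕ} {α : Type} (μ : PMF α) : Game V α := StateT.lift μ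

/-- The distribution of the result when the game starts with no keys generated. -/
def Game.result {V : ℕ} {α : Type} (g : Game V α) : PMF α :=
  (StateT.run g (GameState.init V)).map Prod.fst

/-- The environment of an adversary with a given oracle. -/
def gameEnv {V : ℕ} (Model : LanguageModel V) (oracle : Data → Game V Data) : Env (Game V) where
  coin := Game.sample fairCoin
  token := fun x => Game.sample (sampleToken Model x)
  query := oracle

namespace Scheme

variable {V : ℕ} {Model : LanguageModel V} (M : Scheme Model) (κ : ℕ) (pp : Data)

/-- The key pair of a model provider, generated when it is needed for the first time. -/
def watKeys (i : ℕ) : Game V (Data × Data) := do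
  let s ← get
  match s.wk i with
  | some k => pure k
  | none =>
    let y ← Game.sample (M.watKG.eval (Data.tuple [Data.ofNat κ, pp]))
    set { s with wk := Function.update s.wk i (some (y.hd, y.tl)) }
    pure (y.hd, y.tl)

/-- The key pair of a detector, generated when it is needed for the first time. -/
def detKeys (j : ℕ) : Game V (Data × Data) := do
  let s ← get
  match s.dk j with
  | some k => pure k
  | none =>
    let y ← Game.sample (M.detKG.eval (Data.tuple [Data.ofNat κ, pp]))
    set { s with dk := Function.update s.dk j (some (y.hd, y.tl)) }
    pure (y.hd, y.tl)

/-- The family `(j, dpk_j)_{j ∈ S}`. -/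
def pubKeys (S : Finset ℕ) : Game V Data := do
  let l ← (S.sort (· ≤ ·)).mapM fun j => do
    let k ← M.detKeys κ pp j
    pure (Data.cons (Data.ofNat j) k.1)
  pure (Data.ofList l)

/-- The family `(j, dsk_j)_{j ∈ S}`. -/
def secKeys (S : Finset ℕ) : Game V Data := do
  let l ← (S.sort (· ≤ ·)).mapM fun j => do
    let k ← M.detKeys κ pp j
    pure (Data.cons (Data.ofNat j) k.2)
  pure (Data.ofList l)

/-- Generate a watermarked text for the detectors in `S`. -/
def mark (i : ℕ) (S : Finset ℕ) (p : Text V) : Game V (Text V) := do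
  let k ← M.watKeys κ pp i
  let D ← M.pubKeys κ pp S
  Game.sample (M.watMar (Data.tuple [Data.ofNat κ, pp, k.2, D, Data.ofText p]))

/-- The verdict distribution of `detect` on given keys. -/
def verdict (wpk dsk D : Data) (t : Text V) : PMF Bool :=
  (M.detect.eval (Data.tuple [Data.ofNat κ, pp, wpk, dsk, D, Data.ofText t])).map Data.toBool

/-- Detector `j` examines a text. -/
def examine (i j : ℕ) (S : Finset ℕ) (t : Text V) : Game V Bool := do
  let k ← M.watKeys κ pp i
  let d ← M.detKeys κ pp j
  let D ← M.pubKeys κ pp S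
  Game.sample (M.verdict κ pp k.1 d.2 D t)

/-- Run a simulator in the place of the model provider: it gets
`(1^κ, pp, wpk_i, (j, dpk_j)_{j ∈ S}, (j, dsk_j)_{j ∈ C}, prompt)`. -/
def forge (F : PPT Model) (i : ℕ) (S C : Finset ℕ) (p : Text V) : Game V (Text V) := do
  let k ← M.watKeys κ pp i
  let D ← M.pubKeys κ pp S
  let K ← M.secKeys κ pp C
  let y ← Game.sample (F.eval (Data.tuple [Data.ofNat κ, pp, k.1, D, K, Data.ofText p]))
  pure (y.toText V)

/-! #### Completeness -/

/-- Generate all keys and a watermarked text, and let detector `j` examine it; the result is the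
text and the verdict. -/
def completenessGame (i j : ℕ) (S : Finset ℕ) (p : Text V) : PMF (Text V × Bool) := do
  let pp ← M.setup.eval (Data.ofNat κ)
  Game.result do
    let t ← M.mark κ pp i S p
    let b ← M.examine κ pp i j S t
    pure (t, b)

/-- `δ`-completeness, where `δ κ n` is the length from which on a text for `n` detectors carries a
watermark: except with negligible probability, watermarked texts of this length are accepted. -/
def Complete (δ : ℕ → ℕ → ℕ) : Prop :=
  ∀ (i j : ℕ → ℕ) (S : ℕ → Finset ℕ) (p : ℕ → Text V) (Q : Polynomial ℕ),
    (∀ κ, i κ ≤ Q.eval κ ∧ S κ ⊆ Finset.range (Q.eval κ) ∧ (p κ).length ≤ Q.eval κ ∧ j κ ∈ S κ) →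
    Negligible fun κ => Pr (M.completenessGame κ (i κ) (j κ) (S κ) (p κ)) fun r =>
      δ κ (S κ).card ≤ r.1.length ∧ r.2 = false

/-! #### Soundness -/

/-- `t` shares no window of `k` tokens with any of the texts in `l`. -/
def NoOverlap (k : ℕ) (t : Text V) (l : List (Text V)) : Prop :=
  ∀ u ∈ l, ¬ ∃ w : Text V, w.length = k ∧ w <:+: t ∧ w <:+: u

/-- The oracles of the soundness game. A query is a pair of a tag and an argument:
`0`: key pair of provider `i`; `1`: key pair of detector `j`; `2`, `3`: the public keys only;
`4`: watermarked text for `(i, S, prompt)`; else: verdict for `(i, j, S, text)`. -/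
def soundOracle (x : Data) : Game V Data :=
  let y := x.tl
  match x.hd.toNat with
  | 0 => do
    let k ← M.watKeys κ pp y.toNat
    modify fun s => { s with wkAsked := insert y.toNat s.wkAsked }
    pure (Data.cons k.1 k.2)
  | 1 => do
    let k ← M.detKeys κ pp y.toNat
    modify fun s => { s with dkAsked := insert y.toNat s.dkAsked }
    pure (Data.cons k.1 k.2)
  | 2 => do
    let k ← M.watKeys κ pp y.toNat
    pure k.1
  | 3 => do
    let k ← M.detKeys κ pp y.toNat
    pure k.1
  | 4 => do
    let i := y.hd.toNat
    let S := y.tl.hd.toFinset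
    let t ← M.mark κ pp i S (y.tl.tl.toText V)
    modify fun s => { s with marked := (i, S, t) :: s.marked }
    pure (Data.ofText t)
  | _ =>
    let i := y.hd.toNat
    let j := y.tl.hd.toNat
    let S := y.tl.tl.hd.toFinset
    if j ∈ S then do
      let b ← M.examine κ pp i j S (y.tl.tl.tl.toText V)
      pure (Data.ofBool b)
    else
      pure Data.nil

open Classical in
/-- The soundness game: whether the adversary wins, and its running time. -/
def soundGame (k : ℕ) (A : Prog) (fuel : ℕ) : PMF (Bool × ℕ) := do
  let pp ← M.setup.eval (Data.ofNat κ)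
  Game.result do
    let r ← A.run (gameEnv Model (M.soundOracle κ pp)) fuel (Data.tuple [Data.ofNat κ, pp])
    let i := r.1.hd.toNat
    let S := r.1.tl.hd.toFinset
    let t := r.1.tl.tl.toText V
    let s ← get
    let texts := (s.marked.filter fun e => e.1 = i ∧ e.2.1 = S).map fun e => e.2.2
    let verdicts ← ((S.sort (· ≤ ·)).filter fun j => j ∉ s.dkAsked).mapM fun j =>
      M.examine κ pp i j S t
    pure (decide (i ∉ s.wkAsked ∧ NoOverlap k t texts ∧ true ∈ verdicts), r.2)

/-- `k`-soundness: adversaries that run in polynomial time win with negligible probability only. -/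
def Sound (k : ℕ → ℕ) : Prop :=
  ∀ (A : Prog) (q : Polynomial ℕ),
    (∀ κ, ∀ r ∈ (M.soundGame κ (k κ) A (q.eval κ + 1)).support, r.2 ≤ q.eval κ) →
    Negligible fun κ => Pr (M.soundGame κ (k κ) A (q.eval κ + 1)) fun r => r.1 = true

/-! #### The off-the-record property for any subset -/

/-- The oracles of the off-the-record game with challenge bit `b`. Tags `0`, `1`, `2`, `3` and `5`
are as in the soundness game; tag `4` is the challenge oracle, with argument
`(i, S, S_cor, prompt)`. Queries that the rules forbid are answered by `nil`. -/
def otrOracle (F : PPT Model) (b : Bool) (x : Data) : Game V Data := do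
  let y := x.tl
  let s ← get
  match x.hd.toNat with
  | 0 =>
    if ∃ e ∈ s.challenged, e.1 = y.toNat then
      pure Data.nil
    else
      let k ← M.watKeys κ pp y.toNat
      modify fun s => { s with wkAsked := insert y.toNat s.wkAsked }
      pure (Data.cons k.1 k.2)
  | 1 =>
    if ∃ e ∈ s.challenged, y.toNat ∈ e.2.1 \ e.2.2.1 then
      pure Data.nil
    else
      let k ← M.detKeys κ pp y.toNat
      modify fun s => { s with dkAsked := insert y.toNat s.dkAsked }
      pure (Data.cons k.1 k.2)
  | 2 =>
    let k ← M.watKeys κ pp y.toNat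
    pure k.1
  | 3 =>
    let k ← M.detKeys κ pp y.toNat
    pure k.1
  | 4 =>
    let i := y.hd.toNat
    let S := y.tl.hd.toFinset
    let C := y.tl.tl.hd.toFinset
    let p := y.tl.tl.tl.toText V
    if C ⊆ S ∧ i ∉ s.wkAsked ∧ Disjoint (S \ C) s.dkAsked then
      let t ← if b then M.forge κ pp F i S C p else M.mark κ pp i S p
      modify fun s => { s with challenged := (i, S, C, t) :: s.challenged }
      pure (Data.ofText t)
    else
      pure Data.nil
  | _ =>
    let i := y.hd.toNat
    let j := y.tl.hd.toNat
    let S := y.tl.tl.hd.toFinset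
    let t := y.tl.tl.tl.toText V
    if j ∈ S ∧ ∀ e ∈ s.challenged, e.2.2.2 ≠ t then
      let v ← M.examine κ pp i j S t
      pure (Data.ofBool v)
    else
      pure Data.nil

/-- The off-the-record game: whether the adversary guesses the challenge bit, and its running
time. -/
def otrGame (F : PPT Model) (A : Prog) (fuel : ℕ) : PMF (Bool × ℕ) := do
  let pp ← M.setup.eval (Data.ofNat κ)
  let b ← fairCoin
  Game.result do
    let r ← A.run (gameEnv Model (M.otrOracle κ pp F b)) fuel (Data.tuple [Data.ofNat κ, pp])
    pure (r.1.toBool == b, r.2)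

/-- Off-the-record for any subset: some polynomial-time simulator, which has the secret keys of the
detectors in `S_cor ⊆ S` only, makes texts that no polynomial-time adversary can tell from
watermarked ones. -/
def OffTheRecordAnySubset : Prop :=
  ∃ F : PPT Model, ∀ (A : Prog) (q : Polynomial ℕ),
    (∀ κ, ∀ r ∈ (M.otrGame κ F A (q.eval κ + 1)).support, r.2 ≤ q.eval κ) →
    Negligible fun κ => |Pr (M.otrGame κ F A (q.eval κ + 1)) (fun r => r.1 = true) - 1 / 2|

/-! #### The watermark in a text -/

/-- The watermark carried by a text: a bit string that can be extracted from the text with the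
public data in deterministic polynomial time, and through which alone the detectors' verdicts depend
on the text. (The text itself, written in bits, is one possible choice.) -/
structure Watermark where
  extract : ℕ → Data → Data → Data → Text V → List Bool
  alg : PPT Model
  alg_spec : ∀ κ pp wpk D t,
    alg.eval (Data.tuple [Data.ofNat κ, pp, wpk, D, Data.ofText t]) =
      PMF.pure (Data.ofBits (extract κ pp wpk D t))
  detect_congr : ∀ κ pp wpk D t t', extract κ pp wpk D t = extract κ pp wpk D t' →
    ∀ dsk, M.verdict κ pp wpk dsk D t = M.verdict κ pp wpk dsk D t'

variable {M} in
/-- Generate keys and a watermarked text; the result is the text and the watermark in it. -/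
def Watermark.generate (W : M.Watermark) (κ i : ℕ) (S : Finset ℕ) (p : Text V) :
    PMF (Text V × List Bool) := do
  let pp ← M.setup.eval (Data.ofNat κ)
  Game.result do
    let t ← M.mark κ pp i S p
    let k ← M.watKeys κ pp i
    let D ← M.pubKeys κ pp S
    pure (t, W.extract κ pp k.1 D t)

end Scheme

/-- A length threshold that can be computed in polynomial time from `1^κ` and `1^n`. -/
def EfficientThreshold {V : ℕ} (Model : LanguageModel V) (δ : ℕ → ℕ → ℕ) : Prop :=
  ∃ A : PPT Model, ∀ κ n,
    A.eval (Data.tuple [Data.ofNat κ, Data.ofNat n]) = PMF.pure (Data.ofNat (δ κ n))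

/-- A model provider, a set of detectors and a prompt for each security parameter `κ` that can be
computed in polynomial time from `1^κ`. -/
def EfficientFamily {V : ℕ} (Model : LanguageModel V) (i : ℕ → ℕ) (S : ℕ → Finset ℕ)
    (p : ℕ → Text V) : Prop :=
  ∃ A : PPT Model, ∀ κ, A.eval (Data.ofNat κ) =
    PMF.pure (Data.tuple [Data.ofNat (i κ), Data.ofFinset (S κ), Data.ofText (p κ)])

end Watermarking

end

/-! Let `C` be a uniformly random subset of `S`, drawn independently of the keys, and let the
simulator `F` of the off-the-record property produce a text from the secret keys of `C` alone. Three
facts together force this text to spell out `C`. A genuine text that is long is accepted by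
everybody in `C`, up to the sum of the completeness errors (`expect_generate_le`). An adversary that
holds the keys of `C` can test "long, watermark shorter than `n/2`, accepted by all of `C`" on its
own, so genuine and simulated texts pass this test with nearly the same probability
(`expect_otrGame`). Finally, running `F` with the keys of `C` is an attack on soundness that never
asks for a watermarked text, so all detectors in `S \ C` reject the simulated text, except with
negligible probability (`expect_soundGame`). Hence the verdicts of the `n` detectors on a simulated
text that passes the test are accept on `C` and reject on `S \ C`. They depend on the text only
through its watermark. For fixed keys and a fixed bit string `u`, the probabilities of the verdict
patterns sum to at most `1` over all `C`, so a random `C` is hit with probability at most `2⁻ⁿ`. A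
union bound over the `2^⌈n/2⌉ - 1` strings with fewer than `n/2` bits gives `2^(-⌊n/2⌋) - 2⁻ⁿ`
(`expect_sum_pattern_le`, `alarm_true_le`). `exists_generate_le` puts the estimates together. Both
adversaries have to be actual programs with a strict polynomial step bound. The first half of the
proof is therefore a calculus of feasible computations: `Meets` compares a step-counted run with a
computation in the game monad, and the rules under `Feasible` build programs from subroutines,
oracle queries and folds over lists. The adversaries are then written monadically (`forger`,
`distinguisher`) and their output distributions are computed exactly. -/

namespace Watermarking

/-! ### Encodings and their sizes -/

namespace Data

@[simp] theorem hd_cons (a b : Data) : (cons a b).hd = a := rfl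
@[simp] theorem tl_cons (a b : Data) : (cons a b).tl = b := rfl
@[simp] theorem hd_nil : nil.hd = nil := rfl
@[simp] theorem tl_nil : nil.tl = nil := rfl
@[simp] theorem isNil_nil : nil.isNil = true := rfl
@[simp] theorem isNil_cons (a b : Data) : (cons a b).isNil = false := rfl
@[simp] theorem size_nil : nil.size = 1 := rfl
@[simp] theorem size_cons (a b : Data) : (cons a b).size = a.size + b.size + 1 := rfl

theorem size_pos (x : Data) : 0 < x.size := by
  cases x <;> simp

theorem size_hd_le (x : Data) : x.hd.size ≤ x.size := by
  cases x <;> simp; omega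

theorem size_tl_le (x : Data) : x.tl.size ≤ x.size := by
  cases x <;> simp; omega

@[simp] theorem toNat_ofNat (n : ℕ) : (ofNat n).toNat = n := by
  induction n with
  | zero => rfl
  | succ n ih => simp [ofNat, toNat, ih]

@[simp] theorem size_ofNat (n : ℕ) : (ofNat n).size = 2 * n + 1 := by
  induction n with
  | zero => rfl
  | succ n ih => simp [ofNat, ih]; omega

theorem two_mul_toNat_lt_size (x : Data) : 2 * x.toNat < x.size := by
  induction x with
  | nil => simp [toNat]
  | cons a b _ ih => have := a.size_pos; simp [toNat]; omega

@[simp] theorem toList_ofList (l : List Data) : (ofList l).toList = l := by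
  induction l with
  | nil => rfl
  | cons a l ih => simp [ofList, toList, ih]

@[simp] theorem ofList_nil : ofList [] = nil := rfl
@[simp] theorem ofList_cons (a : Data) (l : List Data) : ofList (a :: l) = cons a (ofList l) := rfl

@[simp] theorem toFinset_ofFinset (S : Finset ℕ) : (ofFinset S).toFinset = S := by
  simp [toFinset, ofFinset, Function.comp_def]

theorem ofText_eq {V : ℕ} (t : Text V) : ofText t = ofList (t.map fun x => ofNat x.1) := by
  have h : (do let a ← t; pure (a : ℕ)) = t.map fun x : Fin V => x.1 := by
    simp
    exact List.flatMap_pure_eq_map _ t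
  rw [ofText, h, List.map_map]
  rfl

@[simp] theorem toText_ofText {V : ℕ} (t : Text V) : (ofText t).toText V = t := by
  simp [toText, ofText_eq, List.filterMap_map]

@[simp] theorem isNil_ofBool (b : Bool) : (ofBool b).isNil = !b := by cases b <;> rfl
@[simp] theorem toBool_ofBool (b : Bool) : (ofBool b).toBool = b := by cases b <;> rfl

theorem size_ofBool_le (b : Bool) : (ofBool b).size ≤ 3 := by cases b <;> simp [ofBool]

theorem length_toList_lt_size (x : Data) : x.toList.length < x.size := by
  induction x with
  | nil => simp [toList]
  | cons a b _ ih => have := a.size_pos; simp [toList]; omega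

theorem length_toText_lt_size {V : ℕ} (x : Data) : (x.toText V).length < x.size :=
  (List.length_filterMap_le _ _).trans_lt x.length_toList_lt_size

theorem size_ofList_le {l : List Data} {B : ℕ} (h : ∀ a ∈ l, a.size ≤ B) :
    (ofList l).size ≤ l.length * (B + 1) + 1 := by
  induction l with
  | nil => simp
  | cons a l ih =>
    have h1 := h a (by simp)
    have h2 := ih fun b hb => h b (by simp [hb])
    simp only [ofList_cons, size_cons, List.length_cons, Nat.succ_mul]
    omega

theorem size_ofText_le {V : ℕ} (t : Text V) : (ofText t).size ≤ t.length * (2 * V + 2) + 1 := by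
  have := size_ofList_le (l := t.map fun x => ofNat x.1) (B := 2 * V + 1) (by
    intro a ha
    obtain ⟨x, _, rfl⟩ := List.mem_map.1 ha
    have := x.2
    simp)
  simpa [ofText_eq] using this

theorem length_lt_size_ofText {V : ℕ} (t : Text V) : t.length < (ofText t).size := by
  simpa using length_toText_lt_size (V := V) (ofText t)

end Data

theorem PMF.mem_support_do {α β : Type} {p : PMF α} {f : α → PMF β} {b : β} :
    b ∈ (p >>= f).support ↔ ∃ a ∈ p.support, b ∈ (f a).support :=
  PMF.mem_support_bind_iff p f b

theorem PMF.mem_support_pure_do {α : Type} {a b : α} :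
    b ∈ (pure a : PMF α).support ↔ b = a :=
  PMF.mem_support_pure_iff a b

theorem PMF.bind_congr_support {α β : Type} {p : PMF α} {f g : α → PMF β}
    (h : ∀ a ∈ p.support, f a = g a) : p.bind f = p.bind g := by
  ext b
  simp only [PMF.bind_apply]
  refine tsum_congr fun a => ?_
  by_cases ha : p a = 0
  · simp [ha]
  · rw [h a ((PMF.mem_support_iff _ _).2 ha)]

/-! ### Step counts and fuel -/

namespace Prog

section Plain

variable {E : Env PMF}

/-- The final test of the loop condition reads the whole state, so its cost dominates the size of
the result. With no rounds at all nothing is charged, which is why `max` and the guard `0 < k`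
appear. -/
theorem size_le_iterate {c p : Data → PMF (Data × ℕ)}
    (hc : ∀ x, ∀ r ∈ (c x).support, x.size ≤ r.2)
    (hp : ∀ x, ∀ r ∈ (p x).support, r.1.size ≤ r.2) (k : ℕ) (x : Data) (r : Data × ℕ)
    (hr : r ∈ (iterate c p k x).support) :
    r.1.size ≤ max x.size r.2 ∧ (0 < k → x.size ≤ r.2) := by
  induction k generalizing x r with
  | zero =>
    rw [iterate, PMF.mem_support_pure_do] at hr
    simp [hr]
  | succ k ih =>
    rw [iterate, PMF.mem_support_do] at hr
    obtain ⟨a, ha, hr⟩ := hr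
    have h1 := hc x a ha
    split at hr
    · rw [PMF.mem_support_pure_do] at hr
      subst hr
      simp [h1]
    · simp only [PMF.mem_support_do, PMF.mem_support_pure_do] at hr
      obtain ⟨y, hy, z, hz, rfl⟩ := hr
      have h2 := hp x y hy
      have h3 := (ih y.1 z hz).1
      simp only
      omega

theorem run_ite {m : Type → Type} [Monad m] (E : Env m) (fuel : ℕ) (c p q : Prog) (x : Data) :
    (ite c p q).run E fuel x = c.run E fuel x >>= fun r =>
      (if r.1.isNil then q.run E fuel x else p.run E fuel x) >>= fun a =>
        pure (a.1, r.2 + a.2) := by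
  rw [run]
  congr 1
  funext r
  split <;> rfl

theorem size_le_run {fuel : ℕ} (hf : 0 < fuel) (P : Prog) (x : Data) (r : Data × ℕ)
    (hr : r ∈ (P.run E fuel x).support) : x.size ≤ r.2 ∧ r.1.size ≤ r.2 := by
  induction P generalizing x r with
  | id => rw [run, PMF.mem_support_pure_do] at hr; subst hr; simp
  | nil => rw [run, PMF.mem_support_pure_do] at hr; subst hr; simp
  | hd => rw [run, PMF.mem_support_pure_do] at hr; subst hr; simp
  | tl => rw [run, PMF.mem_support_pure_do] at hr; subst hr; simp
  | pair p q ihp ihq =>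
    simp only [run, PMF.mem_support_do, PMF.mem_support_pure_do] at hr
    obtain ⟨a, ha, b, hb, rfl⟩ := hr
    have := ihp x a ha
    have := ihq x b hb
    simp only [Data.size_cons]; omega
  | comp p q ihp ihq =>
    simp only [run, PMF.mem_support_do, PMF.mem_support_pure_do] at hr
    obtain ⟨a, ha, b, hb, rfl⟩ := hr
    have := ihp x a ha
    have := ihq a.1 b hb
    simp only; omega
  | ite c p q ihc ihp ihq =>
    simp only [run_ite, PMF.mem_support_do, PMF.mem_support_pure_do] at hr
    obtain ⟨a, ha, b, hb, rfl⟩ := hr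
    have := ihc x a ha
    split at hb
    · have := ihq x b hb; simp only; omega
    · have := ihp x b hb; simp only; omega
  | loop c p ihc ihp =>
    have := size_le_iterate (fun x r h => (ihc x r h).1) (fun x r h => (ihp x r h).2) fuel x r hr
    have := this.2 hf
    omega
  | coin | token | query =>
    simp only [run, PMF.mem_support_do, PMF.mem_support_pure_do] at hr
    obtain ⟨b, hb, rfl⟩ := hr
    simp

/-- Two budgets are tracked: `k` limits the rounds of this loop, and `f` is the fuel of the loops
nested in `c` and `p`. Every partial run extends to a complete one, because supports are nonempty,
so the bounds on the total count pass to all of its parts. -/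
theorem iterate_fuel {c p c' p' : Data → PMF (Data × ℕ)} {f : ℕ}
    (hcs : ∀ x, ∀ r ∈ (c x).support, x.size ≤ r.2)
    (hc : ∀ x, (∀ r ∈ (c x).support, r.2 < f) → c' x = c x)
    (hp : ∀ x, (∀ r ∈ (p x).support, r.2 < f) → p' x = p x)
    (k k' : ℕ) (hk : k ≤ k') (x : Data) (h1 : ∀ r ∈ (iterate c p k x).support, r.2 < k)
    (h2 : ∀ r ∈ (iterate c p k x).support, r.2 < f) :
    iterate c' p' k' x = iterate c p k x := by
  induction k generalizing k' x with
  | zero =>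
    obtain ⟨r, hr⟩ := (iterate c p 0 x).support_nonempty
    exact absurd (h1 r hr) (by omega)
  | succ k ih =>
    obtain ⟨k', rfl⟩ : ∃ j, k' = j + 1 := ⟨k' - 1, by omega⟩
    have key : ∀ a ∈ (c x).support, a.1.isNil = false → ∀ y ∈ (p x).support,
        ∀ z ∈ (iterate c p k y.1).support,
        (z.1, a.2 + y.2 + z.2) ∈ (iterate c p (k + 1) x).support := by
      intro a ha han y hy z hz
      simp only [iterate, PMF.mem_support_do]
      refine ⟨a, ha, ?_⟩
      simp only [han, Bool.false_eq_true, if_false, PMF.mem_support_do, PMF.mem_support_pure_do]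
      exact ⟨y, hy, z, hz, rfl⟩
    have hcx : c' x = c x := by
      refine hc x fun a ha => ?_
      cases han : a.1.isNil
      · obtain ⟨y, hy⟩ := (p x).support_nonempty
        obtain ⟨z, hz⟩ := (iterate c p k y.1).support_nonempty
        have := h2 _ (key a ha han y hy z hz)
        simp only at this; omega
      · refine h2 (x, a.2) ?_
        simp only [iterate, PMF.mem_support_do]
        refine ⟨a, ha, ?_⟩
        simp only [han, if_true, PMF.mem_support_pure_do]
    rw [iterate, iterate, hcx]
    refine PMF.bind_congr_support fun a ha => ?_
    cases han : a.1.isNil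
    · simp only [Bool.false_eq_true, if_false]
      have hpx : p' x = p x := by
        refine hp x fun y hy => ?_
        obtain ⟨z, hz⟩ := (iterate c p k y.1).support_nonempty
        have := h2 _ (key a ha han y hy z hz)
        simp only at this; omega
      rw [hpx]
      refine PMF.bind_congr_support fun y hy => ?_
      rw [ih k' (by omega) y.1]
      · intro z hz
        -- The test reads a state of positive size, so each round costs at least one step; this pays
        -- for the round that is lost.
        have h3 := h1 _ (key a ha han y hy z hz)
        have h4 := hcs x a ha
        have h5 := x.size_pos
        simp only at h3; omega
      · intro z hz
        have := h2 _ (key a ha han y hy z hz)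
        simp only at this; omega
    · rfl

/-- More fuel does not change a run that stays below its fuel. -/
theorem run_fuel {f f' : ℕ} (hff : f ≤ f') (P : Prog) (x : Data)
    (h : ∀ r ∈ (P.run E f x).support, r.2 < f) : P.run E f' x = P.run E f x := by
  have hf : 0 < f := by
    obtain ⟨r, hr⟩ := (P.run E f x).support_nonempty
    have := h r hr
    omega
  induction P generalizing x with
  | id | nil | hd | tl | coin | token | query => rfl
  | pair p q ihp ihq =>
    simp only [run, PMF.mem_support_do, PMF.mem_support_pure_do] at h
    rw [run, run, ihp, ihq]
    · intro b hb
      obtain ⟨a, ha⟩ := (p.run E f x).support_nonempty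
      have := h _ ⟨a, ha, b, hb, rfl⟩
      simp only at this; omega
    · intro a ha
      obtain ⟨b, hb⟩ := (q.run E f x).support_nonempty
      have := h _ ⟨a, ha, b, hb, rfl⟩
      simp only at this; omega
  | comp p q ihp ihq =>
    simp only [run, PMF.mem_support_do, PMF.mem_support_pure_do] at h
    rw [run, run, ihp]
    · refine PMF.bind_congr_support fun a ha => ?_
      rw [ihq]
      intro b hb
      have := h _ ⟨a, ha, b, hb, rfl⟩
      simp only at this; omega
    · intro a ha
      obtain ⟨b, hb⟩ := (q.run E f a.1).support_nonempty
      have := h _ ⟨a, ha, b, hb, rfl⟩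
      simp only at this; omega
  | ite c p q ihc ihp ihq =>
    simp only [run_ite, PMF.mem_support_do, PMF.mem_support_pure_do] at h
    rw [run_ite, run_ite, ihc]
    · refine PMF.bind_congr_support fun a ha => ?_
      cases han : a.1.isNil
      · simp only [Bool.false_eq_true, if_false]
        rw [ihp]
        intro b hb
        have := h _ ⟨a, ha, b, by simpa [han] using hb, rfl⟩
        simp only at this; omega
      · simp only [if_true]
        rw [ihq]
        intro b hb
        have := h _ ⟨a, ha, b, by simpa [han] using hb, rfl⟩
        simp only at this; omega
    · intro a ha
      obtain ⟨b, hb⟩ :=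
        (if a.1.isNil then q.run E f x else p.run E f x : PMF (Data × ℕ)).support_nonempty
      have := h _ ⟨a, ha, b, hb, rfl⟩
      simp only at this; omega
  | loop c p ihc ihp =>
    exact iterate_fuel (fun x r hr => (size_le_run hf c x r hr).1) ihc ihp f f' hff x h h

end Plain

/-- The program in which queries are answered by `nil`. -/
def strip : Prog → Prog
  | id => id
  | nil => nil
  | hd => hd
  | tl => tl
  | pair p q => pair p.strip q.strip
  | comp p q => comp p.strip q.strip
  | ite c p q => ite c.strip p.strip q.strip
  | loop c p => loop c.strip p.strip
  | coin => coin
  | token => token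
  | query => nil

end Prog

/-! ### Stand-alone algorithms inside a game -/

section Sample

variable {V : ℕ} {α β : Type}

theorem Game.run_sample (μ : PMF α) (s : GameState V) :
    (Game.sample μ : Game V α).run s = μ.bind fun a => PMF.pure (a, s) := rfl

theorem Game.sample_bind (μ : PMF α) (f : α → PMF β) :
    (Game.sample (μ >>= f) : Game V β) = Game.sample μ >>= fun a => Game.sample (f a) := by
  refine StateT.ext fun s => ?_
  change (μ.bind f).bind _ = (μ.bind fun a => PMF.pure (a, s)).bind fun p => (f p.1).bind _
  simp [PMF.bind_bind]

theorem Game.sample_pure (a : α) :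
    (Game.sample (pure a) : Game V α) = pure a := by
  refine StateT.ext fun s => ?_
  exact PMF.pure_bind a _

variable {Model : LanguageModel V} {O : Data → Game V Data}

theorem Prog.iterate_sample (c p : Data → PMF (Data × ℕ)) (k : ℕ) (x : Data) :
    iterate (fun y => (Game.sample (c y) : Game V _)) (fun y => Game.sample (p y)) k x
      = Game.sample (iterate c p k x) := by
  induction k generalizing x with
  | zero => exact (Game.sample_pure _).symm
  | succ k ih =>
    simp only [iterate, Game.sample_bind, ih]
    congr 1
    funext a
    split <;> simp only [Game.sample_bind, Game.sample_pure]

/-- In `plainEnv` a query returns `nil` and costs exactly what the program `nil` costs, so replacing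
queries by `nil` preserves outputs and step counts. The stripped program never reaches the oracle of
the game, so it leaves the state alone. -/
theorem Prog.run_strip (P : Prog) (fuel : ℕ) (x : Data) :
    P.strip.run (gameEnv Model O) fuel x = Game.sample (P.run (plainEnv Model) fuel x) := by
  induction P generalizing x with
  | id | nil | hd | tl => exact (Game.sample_pure _).symm
  | pair p q ihp ihq => simp only [strip, run, ihp, ihq, Game.sample_bind, Game.sample_pure]
  | comp p q ihp ihq => simp only [strip, run, ihp, ihq, Game.sample_bind, Game.sample_pure]
  | ite c p q ihc ihp ihq =>
    simp only [strip, run_ite, ihc, ihp, ihq, Game.sample_bind, Game.sample_pure]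
    congr 1
    funext a
    split <;> rfl
  | loop c p ihc ihp =>
    have hc : c.strip.run (gameEnv Model O) fuel = fun y => Game.sample _ := funext ihc
    have hp : p.strip.run (gameEnv Model O) fuel = fun y => Game.sample _ := funext ihp
    simp only [strip, run, hc, hp]
    exact iterate_sample _ _ _ _
  | coin | token => simp only [strip, run, gameEnv, plainEnv, Game.sample_bind, Game.sample_pure]
  | query =>
    simp only [strip, run, plainEnv]
    exact ((congrArg Game.sample (PMF.pure_bind Data.nil fun y => pure (y, x.size + y.size))).trans
      (Game.sample_pure _)).symm

end Sample

theorem eval_le_eval (q : Polynomial ℕ) {a b : ℕ} (h : a ≤ b) : q.eval a ≤ q.eval b := by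
  rw [Polynomial.eval_eq_sum_range, Polynomial.eval_eq_sum_range]
  gcongr

/-- Fold a random computation over the entries of a list. -/
def Data.foldM {m : Type → Type} [Monad m] (f : Data → Data → m Data) : Data → Data → m Data
  | nil, acc => pure acc
  | cons a l, acc => do
    let b ← f a acc
    foldM f l b

/-! ### Step-counted runs against ideal computations -/

section Meets

variable {V : ℕ}

/-- From states with property `I`, the computation `a` (with a step count) has the effect of `b`,
keeps `I`, and its step counts and the sizes of its results are at most `T`. -/
def Meets (I : GameState V → Prop) (T : ℕ) (a : Game V (Data × ℕ)) (b : Game V Data) : Prop :=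
  ∀ s, I s → (a.run s).map (fun r => (r.1.1, r.2)) = b.run s ∧
    ∀ r ∈ (a.run s).support, r.1.2 ≤ T ∧ r.1.1.size ≤ T ∧ I r.2

/-- The possible results of a computation from states with property `I`. -/
def Game.Yields (I : GameState V → Prop) (b : Game V Data) (y : Data) : Prop :=
  ∃ s s', I s ∧ (y, s') ∈ (b.run s).support

variable {I : GameState V → Prop} {T T₁ : ℕ}

theorem Meets.mono {a : Game V (Data × ℕ)} {b : Game V Data} (h : Meets I T₁ a b) (hT : T₁ ≤ T) :
    Meets I T a b := by
  intro s hs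
  refine ⟨(h s hs).1, fun r hr => ?_⟩
  have := (h s hs).2 r hr
  exact ⟨this.1.trans hT, this.2.1.trans hT, this.2.2⟩

theorem Meets.pure {y : Data} {n : ℕ} (hn : n ≤ T) (hy : y.size ≤ T) :
    Meets I T (Pure.pure (y, n)) (Pure.pure y) := by
  intro s hs
  refine ⟨PMF.pure_map _ _, fun r hr => ?_⟩
  have : r = ((y, n), s) := (PMF.mem_support_pure_iff _ _).1 hr
  subst this
  exact ⟨hn, hy, hs⟩

/-- The continuation is examined only at results that can occur. `Yields` lets later proofs identify
such a result exactly when `b` is deterministic. -/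
theorem Meets.bind {a : Game V (Data × ℕ)} {b : Game V Data} {f : Data × ℕ → Game V (Data × ℕ)}
    {h : Data → Game V Data} (hab : Meets I T₁ a b)
    (hfh : ∀ y n, b.Yields I y → y.size ≤ T₁ → n ≤ T₁ → Meets I T (f (y, n)) (h y)) :
    Meets I T (a >>= f) (b >>= h) := by
  intro s hs
  obtain ⟨h1, h2⟩ := hab s hs
  have h3 : ∀ r ∈ (a.run s).support, Meets I T (f r.1) (h r.1.1) := by
    intro r hr
    obtain ⟨hn, hy, hI⟩ := h2 r hr
    refine hfh r.1.1 r.1.2 ⟨s, r.2, hs, ?_⟩ hy hn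
    rw [← h1, PMF.mem_support_map_iff]
    exact ⟨r, hr, rfl⟩
  rw [StateT.run_bind, StateT.run_bind, ← h1]
  constructor
  · refine (PMF.map_bind _ _ _).trans ((?_ : _ = _).trans (PMF.bind_map _ _ _).symm)
    exact PMF.bind_congr_support fun r hr => (h3 r hr r.2 (h2 r hr).2.2).1
  · intro t ht
    obtain ⟨r, hr, ht⟩ := PMF.mem_support_do.1 ht
    exact (h3 r hr r.2 (h2 r hr).2.2).2 t ht

theorem Meets.of_steps {μ : Game V Data} {f : Data → ℕ}
    (h : ∀ s, I s → ∀ r ∈ (μ.run s).support, f r.1 ≤ T ∧ r.1.size ≤ T ∧ I r.2) :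
    Meets I T (μ >>= fun y => Pure.pure (y, f y)) μ := by
  intro s hs
  rw [StateT.run_bind]
  constructor
  · refine (PMF.map_bind _ _ _).trans ?_
    refine Eq.trans ?_ (PMF.bind_pure _)
    congr 1
    funext r
    exact PMF.pure_map _ _
  · intro t ht
    obtain ⟨r, hr, ht⟩ := PMF.mem_support_do.1 ht
    have : t = ((r.1, f r.1), r.2) := (PMF.mem_support_pure_iff _ _).1 ht
    subst this
    exact h s hs r hr

/-- A fold over a list is a loop on states (remaining list, accumulator, context) whose condition is
the first component. Each round removes at least one node of the list, so `l.size` rounds suffice.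
The accumulator gains at most `β` per round, so `N` bounds all states and `R` bounds the cost of
each test and each body. -/
theorem Meets.iterate {c p : Data → Game V (Data × ℕ)} {f : Data → Data → Game V Data} {x : Data}
    {R N L β : ℕ} (hc : ∀ z, z.size ≤ N → Meets I R (c z) (Pure.pure z.hd))
    (hp : ∀ a l acc, (Data.cons (Data.cons a l) (Data.cons acc x)).size ≤ N →
      Meets I R (p (Data.cons (Data.cons a l) (Data.cons acc x)))
        (f a acc >>= fun b => Pure.pure (Data.cons l (Data.cons b x))))
    (hf : ∀ a acc, a.size ≤ L → ∀ s, I s → ∀ r ∈ ((f a acc).run s).support,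
      r.1.size ≤ acc.size + β)
    (l acc : Data) (k : ℕ) (hL : l.size ≤ L) (hk : l.size ≤ k)
    (hN : l.size + (acc.size + l.size * β) + x.size + 2 ≤ N) :
    Meets I (2 * l.size * R + N) (Prog.iterate c p k (Data.cons l (Data.cons acc x)))
      (Data.foldM f l acc >>= fun b => Pure.pure (Data.cons Data.nil (Data.cons b x))) := by
  induction l generalizing acc k with
  | nil =>
    obtain ⟨k, rfl⟩ : ∃ j, k = j + 1 := ⟨k - 1, by simp at hk; omega⟩
    have hz : (Data.cons Data.nil (Data.cons acc x)).size ≤ N := by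
      simp only [Data.size_cons, Data.size_nil] at hN ⊢; omega
    have key := Meets.bind (T := 2 * Data.nil.size * R + N) (h := fun _ =>
      Pure.pure (Data.cons Data.nil (Data.cons acc x)))
      (f := fun r => if r.1.isNil then Pure.pure (Data.cons Data.nil (Data.cons acc x), r.2) else do
        let y ← p (Data.cons Data.nil (Data.cons acc x))
        let z ← Prog.iterate c p k y.1
        Pure.pure (z.1, r.2 + y.2 + z.2)) (hc _ hz) (by
        rintro y n ⟨s, s', hs, hy⟩ - hn
        obtain rfl : y = Data.nil := (Prod.mk.inj ((PMF.mem_support_pure_iff _ _).1 hy)).1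
        simp only [Data.isNil_nil, if_true]
        exact Meets.pure (by simp; omega) (by omega))
    simpa [Data.foldM, Prog.iterate] using key
  | cons a l _ ih =>
    obtain ⟨k, rfl⟩ : ∃ j, k = j + 1 := ⟨k - 1, by simp at hk; omega⟩
    simp only [Data.size_cons] at hL hk hN
    have ha := a.size_pos
    have hmul : (a.size + l.size + 1) * β = a.size * β + l.size * β + β := by ring
    rw [hmul] at hN
    have hz : (Data.cons (Data.cons a l) (Data.cons acc x)).size ≤ N := by
      simp only [Data.size_cons]; omega
    -- The removed `cons` node contributes `R + R`, which pays for the test and the body of this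
    -- round.
    have hR : 2 * (Data.cons a l).size * R = 2 * a.size * R + 2 * l.size * R + (R + R) := by
      simp only [Data.size_cons]; ring
    -- The ideal side gets a trailing `pure`, so that its binds match those of the program, which
    -- ends by adding up step counts.
    have key := Meets.bind (T := 2 * (Data.cons a l).size * R + N) (h := fun _ =>
      (f a acc >>= fun b => Pure.pure (Data.cons l (Data.cons b x))) >>= fun z =>
        (Data.foldM f l z.tl.hd >>= fun b => Pure.pure (Data.cons Data.nil (Data.cons b x)))
          >>= fun z' => Pure.pure z')
      (f := fun r => if r.1.isNil then Pure.pure (Data.cons (Data.cons a l) (Data.cons acc x), r.2)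
        else p (Data.cons (Data.cons a l) (Data.cons acc x)) >>= fun y =>
        Prog.iterate c p k y.1 >>= fun z =>
        Pure.pure (z.1, r.2 + y.2 + z.2)) (hc _ hz) (by
        rintro y n ⟨s, s', hs, hy⟩ - hn
        obtain rfl : y = Data.cons a l := (Prod.mk.inj ((PMF.mem_support_pure_iff _ _).1 hy)).1
        simp only [Data.isNil_cons, Bool.false_eq_true, if_false]
        refine Meets.bind (hp a l acc hz) ?_
        rintro z m ⟨s₁, s₂, hs₁, hz'⟩ - hm
        obtain ⟨b, hb, hz'⟩ := PMF.mem_support_do.1 hz'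
        obtain rfl : z = Data.cons l (Data.cons b.1 x) :=
          (Prod.mk.inj ((PMF.mem_support_pure_iff _ _).1 hz')).1
        have hbs := hf a acc (by omega) s₁ hs₁ b hb
        refine Meets.bind (ih b.1 k (by omega) (by omega) (by omega)) ?_
        rintro z' m' ⟨s₃, s₄, hs₃, hz₃⟩ hz₄ hm'
        have : R ≤ 2 * a.size * R + R := by omega
        exact Meets.pure (by simp only; omega) (by simp only; omega))
    simpa [Data.foldM, Prog.iterate] using key

end Meets

/-- A family of games in which programs run. -/
structure Setting {V : ℕ} (Model : LanguageModel V) where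
  Idx : Type
  sec : Idx → ℕ
  oracle : Idx → Data → Game V Data
  Inv : Idx → GameState V → Prop

/-! ### A calculus of polynomial-time computations -/

section Feasible

variable {V : ℕ} {Model : LanguageModel V}

/-- A program carries out the computations `g` in polynomial time. -/
def Implements (K : Setting Model) (P : Prog) (q : Polynomial ℕ) (g : K.Idx → Data → Game V Data) :
    Prop :=
  ∀ c x fuel, q.eval (K.sec c + x.size) ≤ fuel →
    Meets (K.Inv c) (q.eval (K.sec c + x.size)) (P.run (gameEnv Model (K.oracle c)) fuel x) (g c x)

/-- The computations `g` can be carried out by a program in polynomial time. -/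
def Feasible (K : Setting Model) (g : K.Idx → Data → Game V Data) : Prop :=
  ∃ P q, Implements K P q g

namespace Feasible

variable {K : Setting Model}

theorem id : Feasible K fun _ x => pure x := by
  refine ⟨Prog.id, 2 * Polynomial.X, fun c x fuel _ => ?_⟩
  refine Meets.pure ?_ ?_ <;> simp <;> omega

theorem nil : Feasible K fun _ _ => pure Data.nil := by
  refine ⟨Prog.nil, Polynomial.X + 1, fun c x fuel _ => ?_⟩
  refine Meets.pure ?_ ?_ <;> simp

theorem comp {g h : K.Idx → Data → Game V Data} (hg : Feasible K g) (hh : Feasible K h) :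
    Feasible K fun c x => g c x >>= fun y => h c y := by
  obtain ⟨P, q, hP⟩ := hg
  obtain ⟨Q, r, hQ⟩ := hh
  refine ⟨Prog.comp P Q, q + r.comp (Polynomial.X + q), fun c x fuel hfuel => ?_⟩
  simp only [Polynomial.eval_add, Polynomial.eval_comp, Polynomial.eval_X] at hfuel ⊢
  refine Meets.bind (hP c x fuel (by omega)) ?_
  intro y n _ hy hn
  have hr := eval_le_eval r (show K.sec c + y.size ≤ K.sec c + x.size + q.eval (K.sec c + x.size) by
    omega)
  have := Meets.bind (T := q.eval (K.sec c + x.size) +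
    r.eval (K.sec c + x.size + q.eval (K.sec c + x.size))) (f := fun b => pure (b.1, n + b.2))
    (h := pure) (hQ c y fuel (by omega)) (fun z m _ hz hm =>
    Meets.pure (by simp only; omega) (by simp only; omega))
  simpa using this

theorem pair {g h : K.Idx → Data → Game V Data} (hg : Feasible K g) (hh : Feasible K h) :
    Feasible K fun c x => g c x >>= fun y => h c x >>= fun z => pure (Data.cons y z) := by
  obtain ⟨P, q, hP⟩ := hg
  obtain ⟨Q, r, hQ⟩ := hh
  refine ⟨Prog.pair P Q, 2 * q + 2 * r + 1, fun c x fuel hfuel => ?_⟩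
  simp only [Polynomial.eval_add, Polynomial.eval_mul, Polynomial.eval_ofNat,
    Polynomial.eval_one] at hfuel ⊢
  refine Meets.bind (hP c x fuel (by omega)) ?_
  intro y n _ hy hn
  refine Meets.bind (hQ c x fuel (by omega)) ?_
  intro z m _ hz hm
  refine Meets.pure ?_ ?_ <;> simp only [Data.size_cons] <;> omega

theorem ite {e : K.Idx → Data → Data} {g h : K.Idx → Data → Game V Data}
    (he : Feasible K fun c x => pure (e c x)) (hg : Feasible K g) (hh : Feasible K h) :
    Feasible K fun c x => if (e c x).isNil then g c x else h c x := by
  obtain ⟨C, p, hC⟩ := he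
  obtain ⟨P, q, hP⟩ := hg
  obtain ⟨Q, r, hQ⟩ := hh
  refine ⟨Prog.ite C Q P, p + q + r, fun c x fuel hfuel => ?_⟩
  simp only [Polynomial.eval_add] at hfuel ⊢
  rw [Prog.run_ite]
  have := Meets.bind (T := p.eval (K.sec c + x.size) + q.eval (K.sec c + x.size) +
    r.eval (K.sec c + x.size)) (h := fun y => (if y.isNil then g c x else h c x) >>= pure)
    (f := fun s => (if s.1.isNil then P.run (gameEnv Model (K.oracle c)) fuel x else
      Q.run (gameEnv Model (K.oracle c)) fuel x) >>= fun a => pure (a.1, s.2 + a.2))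
    (hC c x fuel (by omega)) (by
    intro y n _ hy hn
    refine Meets.bind (T₁ := q.eval (K.sec c + x.size) + r.eval (K.sec c + x.size)) ?_ ?_
    · simp only
      split
      · exact (hP c x fuel (by omega)).mono (by omega)
      · exact (hQ c x fuel (by omega)).mono (by omega)
    · intro z m _ hz hm
      exact Meets.pure (by simp only; omega) (by simp only; omega))
  simpa using this

theorem of_pure {g : K.Idx → Data → Game V Data} {e : K.Idx → Data → Data}
    (he : Feasible K fun c x => pure (e c x)) (hg : Feasible K g) :
    Feasible K fun c x => g c (e c x) := by
  simpa using he.comp hg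

/-- Local variables are kept on a stack: the newest result is the head and the earlier context is
the tail. In the feasibility proofs of the adversaries, paths such as `id.tl.tl.hd` are therefore de
Bruijn indices. -/
theorem bind {g : K.Idx → Data → Game V Data} {h : K.Idx → Data → Data → Game V Data}
    (hg : Feasible K g) (hh : Feasible K fun c z => h c z.tl z.hd) :
    Feasible K fun c x => g c x >>= fun y => h c x y := by
  simpa using (hg.pair id).comp hh

theorem cons {d e : K.Idx → Data → Data} (hd : Feasible K fun c x => pure (d c x))
    (he : Feasible K fun c x => pure (e c x)) :
    Feasible K fun c x => pure (Data.cons (d c x) (e c x)) := by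
  simpa using hd.pair he

theorem hd {e : K.Idx → Data → Data} (he : Feasible K fun c x => pure (e c x)) :
    Feasible K fun c x => pure (e c x).hd := by
  refine of_pure (g := fun _ x => pure x.hd) he ⟨Prog.hd, 2 * Polynomial.X, fun c x fuel _ => ?_⟩
  have := x.size_hd_le
  refine Meets.pure ?_ ?_ <;> simp <;> omega

theorem tl {e : K.Idx → Data → Data} (he : Feasible K fun c x => pure (e c x)) :
    Feasible K fun c x => pure (e c x).tl := by
  refine of_pure (g := fun _ x => pure x.tl) he ⟨Prog.tl, 2 * Polynomial.X, fun c x fuel _ => ?_⟩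
  have := x.size_tl_le
  refine Meets.pure ?_ ?_ <;> simp <;> omega

theorem ofNat (n : ℕ) : Feasible K fun _ _ => pure (Data.ofNat n) := by
  induction n with
  | zero => exact nil
  | succ n ih => exact nil.cons ih

theorem coin : Feasible K fun _ _ =>
    Game.sample fairCoin >>= fun b => pure (Data.ofBool b) := by
  refine ⟨Prog.coin, Polynomial.X + 3, fun c x fuel _ => ?_⟩
  have := Meets.of_steps (I := K.Inv c) (T := (Polynomial.X + 3 : Polynomial ℕ).eval
    (K.sec c + x.size)) (μ := Game.sample fairCoin >>= fun b => pure (Data.ofBool b)) (f := fun y => x.size + y.size) (by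
    intro s hs r hr
    obtain ⟨b, hb, hr⟩ := PMF.mem_support_do.1 hr
    obtain ⟨b', _, hb⟩ := (PMF.mem_support_bind_iff _ _ _).1 hb
    obtain rfl := (PMF.mem_support_pure_iff _ _).1 hb
    obtain rfl := (PMF.mem_support_pure_iff _ _).1 hr
    have := Data.size_ofBool_le b'
    simp only [Polynomial.eval_add, Polynomial.eval_X, Polynomial.eval_ofNat]
    exact ⟨by omega, by omega, hs⟩)
  simpa [Prog.run, gameEnv] using this

/-- `run_strip` moves the algorithm into the game, and `run_fuel` shows that the larger fuel there
does not change its distribution. -/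
theorem call (A : PPT Model) {e : K.Idx → Data → Data} (he : Feasible K fun c x => pure (e c x)) :
    Feasible K fun c x => Game.sample (A.eval (e c x)) := by
  refine of_pure (g := fun _ x => Game.sample (A.eval x)) he
    ⟨A.prog.strip, A.bound + 1, fun c x fuel hfuel => ?_⟩
  simp only [Polynomial.eval_add, Polynomial.eval_one] at hfuel ⊢
  have hb := eval_le_eval A.bound (show x.size ≤ K.sec c + x.size by omega)
  have hrun := Prog.run_fuel (E := plainEnv Model) (show A.bound.eval x.size + 1 ≤ fuel by omega)
    A.prog x (fun r hr => Nat.lt_succ_of_le (A.halts x r hr))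
  rw [Prog.run_strip, hrun]
  intro s hs
  rw [Game.run_sample, Game.run_sample]
  constructor
  · rw [PMF.map_bind, PPT.eval, PMF.bind_map]
    congr 1
    funext r
    exact PMF.pure_map _ _
  · intro r hr
    obtain ⟨r', hr', hr⟩ := (PMF.mem_support_bind_iff _ _ _).1 hr
    obtain rfl := (PMF.mem_support_pure_iff _ _).1 hr
    have h1 := A.halts x r' hr'
    have h2 := (Prog.size_le_run (by omega) A.prog x r' hr').2
    simp only
    exact ⟨by omega, by omega, hs⟩

/-- The tag is fixed, so polynomial answers and preservation of the invariant are needed for this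
kind of query only. -/
theorem query {e : K.Idx → Data → Data} (he : Feasible K fun c x => pure (e c x)) (n : ℕ)
    (hO : ∃ q : Polynomial ℕ, ∀ c x s, K.Inv c s →
      ∀ r ∈ ((K.oracle c (Data.cons (Data.ofNat n) x)).run s).support,
      r.1.size ≤ q.eval (K.sec c + x.size) ∧ K.Inv c r.2) :
    Feasible K fun c x => K.oracle c (Data.cons (Data.ofNat n) (e c x)) := by
  obtain ⟨q, hq⟩ := hO
  obtain ⟨P, p, hP⟩ := ofNat (K := K) n
  refine of_pure (g := fun c x => K.oracle c (Data.cons (Data.ofNat n) x)) he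
    ⟨Prog.comp (Prog.pair P Prog.id) Prog.query,
      4 * p + 6 * Polynomial.X + q + 10, fun c x fuel hfuel => ?_⟩
  set T := (4 * p + 6 * Polynomial.X + q + 10 : Polynomial ℕ).eval (K.sec c + x.size) with hT
  simp only [Polynomial.eval_add, Polynomial.eval_mul, Polynomial.eval_ofNat,
    Polynomial.eval_X] at hT
  have h1 : Meets (K.Inv c) T ((Prog.comp (Prog.pair P Prog.id) Prog.query).run
      (gameEnv Model (K.oracle c)) fuel x)
      ((pure (Data.ofNat n) >>= fun y => pure x >>= fun z => pure (Data.cons y z)) >>= fun y =>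
        K.oracle c y >>= pure) := by
    refine Meets.bind (T₁ := 2 * p.eval (K.sec c + x.size) + 3 * x.size + 1) ?_ ?_
    · refine Meets.bind (hP c x fuel (by omega)) ?_
      intro y k _ hy hk
      refine Meets.bind (Meets.pure (T := 2 * x.size) (by omega) (by omega)) ?_
      rintro z m ⟨s, s', _, hz⟩ _ hm
      obtain rfl : z = x := (Prod.mk.inj ((PMF.mem_support_pure_iff _ _).1 hz)).1
      refine Meets.pure ?_ ?_ <;> simp only [Data.size_cons] <;> omega
    · rintro y k ⟨s, s', _, hy⟩ hys hk
      obtain rfl : y = Data.cons (Data.ofNat n) x :=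
        (Prod.mk.inj ((PMF.mem_support_pure_iff _ _).1 (by
          simp only [LawfulMonad.pure_bind] at hy; exact hy))).1
      refine Meets.bind (T₁ := 2 * p.eval (K.sec c + x.size) + 3 * x.size + 1 +
        q.eval (K.sec c + x.size)) (Meets.of_steps ?_) ?_
      · intro s hs r hr
        have := hq c x s hs r hr
        simp only at hys ⊢
        exact ⟨by omega, by omega, this.2⟩
      · intro z m _ hz hm
        exact Meets.pure (by simp only; omega) (by simp only; omega)
  simpa using h1

/-- A polynomial-time body is not enough: an accumulator that doubles in each round grows
exponentially. The additive `growth` bound, which does not involve the accumulator, excludes this.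
-/
theorem fold {h : K.Idx → Data → Data → Data → Game V Data} {l i : K.Idx → Data → Data}
    (hh : Feasible K fun c z => h c z.tl.tl z.hd z.tl.hd)
    (growth : ∃ q : Polynomial ℕ, ∀ c x a acc s, K.Inv c s →
      ∀ r ∈ ((h c x a acc).run s).support, r.1.size ≤ acc.size + q.eval (K.sec c + x.size + a.size))
    (hl : Feasible K fun c x => pure (l c x)) (hi : Feasible K fun c x => pure (i c x)) :
    Feasible K fun c x => Data.foldM (h c x) (l c x) (i c x) := by
  obtain ⟨q, hq⟩ := growth
  have hstep : Feasible K fun c z => h c z.tl.tl z.hd.hd z.tl.hd >>= fun b =>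
      pure (Data.cons z.hd.tl (Data.cons b z.tl.tl)) := by
    refine bind (h := fun c z b => pure (Data.cons z.hd.tl (Data.cons b z.tl.tl))) ?_
      (id.tl.hd.tl.cons (id.hd.cons id.tl.tl.tl))
    exact of_pure (g := fun c z => h c z.tl.tl z.hd z.tl.hd) (id.hd.hd.cons id.tl) hh
  obtain ⟨C, p, hC⟩ := (id (K := K)).hd
  obtain ⟨P, r, hP⟩ := hstep
  have hinit := hl.cons (hi.cons id)
  have hfin : Feasible K fun _ z => pure z.tl.hd := id.tl.hd
  suffices hloop : Feasible K fun c z =>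
      Data.foldM (h c z.tl.tl) z.hd z.tl.hd >>= fun b =>
        pure (Data.cons Data.nil (Data.cons b z.tl.tl)) by
    simpa using (hinit.comp hloop).comp hfin
  -- An arbitrary input need not be a nested pair, so it is first rebuilt in the shape that
  -- `Meets.iterate` expects. The time bound `u` of this program also bounds the size of the initial
  -- loop state.
  have hnorm : Feasible K fun _ z => pure (Data.cons z.hd (Data.cons z.tl.hd z.tl.tl)) :=
    id.hd.cons (id.tl.hd.cons id.tl.tl)
  obtain ⟨Q, u, hQ⟩ := hnorm
  -- sizes of the loop states, time per round
  let N : Polynomial ℕ := u * (1 + q.comp (Polynomial.X + 2 * u)) + 2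
  let R : Polynomial ℕ := p.comp (Polynomial.X + N) + r.comp (Polynomial.X + N)
  refine ⟨Prog.comp Q (Prog.loop C P), 2 * u * R + N + u, fun c x fuel hfuel => ?_⟩
  set n := K.sec c + x.size with hn
  have eN : N.eval n = u.eval n * (1 + q.eval (n + 2 * u.eval n)) + 2 := by simp [N]
  have eR : R.eval n = p.eval (n + N.eval n) + r.eval (n + N.eval n) := by simp [R]
  have hT : (2 * u * R + N + u).eval n = 2 * u.eval n * R.eval n + N.eval n + u.eval n := by simp
  rw [hT] at hfuel ⊢
  have hun : u.eval (K.sec c + x.size) = u.eval n := rfl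
  set z := Data.cons x.hd (Data.cons x.tl.hd x.tl.tl) with hz
  have key : Meets (K.Inv c) (2 * u.eval n * R.eval n + N.eval n + u.eval n)
      ((Prog.comp Q (Prog.loop C P)).run (gameEnv Model (K.oracle c)) fuel x)
      (pure z >>= fun z => (Data.foldM (h c z.tl.tl) z.hd z.tl.hd >>= fun b =>
        pure (Data.cons Data.nil (Data.cons b z.tl.tl))) >>= pure) := by
    refine Meets.bind (hQ c x fuel (by omega)) ?_
    rintro y k ⟨s, s', _, hy⟩ hys hk
    obtain rfl : y = z := (Prod.mk.inj ((PMF.mem_support_pure_iff _ _).1 hy)).1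
    simp only [hz, Data.size_cons] at hys
    have hl1 : 1 ≤ x.hd.size := x.hd.size_pos
    have hNn : ∀ w : Data, w.size ≤ N.eval n → K.sec c + w.size ≤ n + N.eval n := by
      intro w hw; omega
    have hpR : p.eval (n + N.eval n) ≤ R.eval n := by omega
    have hrR : r.eval (n + N.eval n) ≤ R.eval n := by omega
    have huR : R.eval n ≤ 2 * u.eval n * R.eval n := by
      have : 1 ≤ 2 * u.eval n := by omega
      nlinarith
    refine Meets.bind (T₁ := 2 * x.hd.size * R.eval n + N.eval n)
      (Meets.iterate (R := R.eval n) (N := N.eval n) (L := u.eval n)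
        (β := q.eval (n + 2 * u.eval n)) ?_ ?_ ?_ x.hd x.tl.hd fuel (by omega) (by omega) ?_) ?_
    · intro w hw
      have h1 := eval_le_eval p (hNn w hw)
      exact (hC c w fuel (by omega)).mono (by omega)
    · intro a l acc hw
      have h1 := eval_le_eval r (hNn _ hw)
      exact (hP c _ fuel (by omega)).mono (by omega)
    · intro a acc ha s hs t ht
      refine (hq c x.tl.tl a acc s hs t ht).trans ?_
      have := eval_le_eval q (show K.sec c + x.tl.tl.size + a.size ≤ n + 2 * u.eval n by omega)
      omega
    · have : x.hd.size * q.eval (n + 2 * u.eval n) ≤ u.eval n * q.eval (n + 2 * u.eval n) :=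
        Nat.mul_le_mul_right _ (by omega)
      rw [eN, mul_add, mul_one]
      omega
    · intro w m _ hw hm
      have : 2 * x.hd.size * R.eval n ≤ 2 * u.eval n * R.eval n :=
        Nat.mul_le_mul_right _ (by omega)
      exact Meets.pure (by simp only; omega) (by simp only; omega)
  simpa [hz] using key

end Feasible

end Feasible

open scoped ENNReal

/-! ### Expectations and probabilities -/

section Expect

variable {α β : Type}

/-- The expectation of a nonnegative function. -/
noncomputable def expect (μ : PMF α) (f : α → ℝ≥0∞) : ℝ≥0∞ := ∑' a, μ a * f a

theorem expect_bind (μ : PMF α) (k : α → PMF β) (f : β → ℝ≥0∞) :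
    expect (μ.bind k) f = expect μ fun a => expect (k a) f := by
  simp only [expect, PMF.bind_apply, ← ENNReal.tsum_mul_right, ← ENNReal.tsum_mul_left]
  rw [ENNReal.tsum_comm]
  simp only [mul_assoc]

theorem expect_do (μ : PMF α) (k : α → PMF β) (f : β → ℝ≥0∞) :
    expect (μ >>= k) f = expect μ fun a => expect (k a) f := expect_bind μ k f

theorem expect_pure (a : α) (f : α → ℝ≥0∞) : expect (PMF.pure a) f = f a := by
  rw [expect, tsum_eq_single a]
  · simp
  · intro b hb; simp [PMF.pure_apply, hb]

theorem expect_pure_do (a : α) (f : α → ℝ≥0∞) : expect (pure a) f = f a := expect_pure a f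

theorem expect_map (μ : PMF α) (g : α → β) (f : β → ℝ≥0∞) :
    expect (μ.map g) f = expect μ fun a => f (g a) := by
  simp only [PMF.map, expect_bind, Function.comp_apply, expect_pure]

theorem expect_mono {μ : PMF α} {f g : α → ℝ≥0∞} (h : ∀ a ∈ μ.support, f a ≤ g a) :
    expect μ f ≤ expect μ g := by
  refine ENNReal.tsum_le_tsum fun a => ?_
  by_cases ha : μ a = 0
  · simp [ha]
  · gcongr; exact h a ((PMF.mem_support_iff _ _).2 ha)

theorem expect_congr {μ : PMF α} {f g : α → ℝ≥0∞} (h : ∀ a ∈ μ.support, f a = g a) :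
    expect μ f = expect μ g :=
  le_antisymm (expect_mono fun a ha => (h a ha).le) (expect_mono fun a ha => (h a ha).ge)

theorem expect_add (μ : PMF α) (f g : α → ℝ≥0∞) :
    expect μ (fun a => f a + g a) = expect μ f + expect μ g := by
  simp only [expect, mul_add, ENNReal.tsum_add]

theorem expect_sum {ι : Type} (s : Finset ι) (μ : PMF α) (f : ι → α → ℝ≥0∞) :
    expect μ (fun a => ∑ j ∈ s, f j a) = ∑ j ∈ s, expect μ (f j) := by
  classical
  induction s using Finset.induction_on with
  | empty => simp [expect]
  | insert j s hj ih => simp only [Finset.sum_insert hj, expect_add, ih]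

theorem expect_const (μ : PMF α) (c : ℝ≥0∞) : expect μ (fun _ => c) = c := by
  rw [expect, ENNReal.tsum_mul_right, PMF.tsum_coe, one_mul]

theorem expect_const_mul (μ : PMF α) (c : ℝ≥0∞) (f : α → ℝ≥0∞) :
    expect μ (fun a => c * f a) = c * expect μ f := by
  simp only [expect, ← ENNReal.tsum_mul_left]
  exact tsum_congr fun a => mul_left_comm _ _ _

theorem expect_le_of_le {μ : PMF α} {f : α → ℝ≥0∞} {c : ℝ≥0∞} (h : ∀ a ∈ μ.support, f a ≤ c) :
    expect μ f ≤ c :=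
  (expect_mono h).trans (expect_const μ c).le

theorem expect_fairCoin (f : Bool → ℝ≥0∞) :
    expect fairCoin f = 2⁻¹ * (f true + f false) := by
  simp [expect, fairCoin, mul_add]

open Classical in
theorem Pr_eq_toReal_expect (μ : PMF α) (P : α → Prop) :
    Pr μ P = (expect μ fun a => if P a then 1 else 0).toReal := by
  rw [Pr, PMF.toOuterMeasure_apply]
  congr 1
  refine tsum_congr fun a => ?_
  simp [Set.indicator_apply]

/-- A probability as an extended nonnegative number. -/
theorem ofReal_Pr (μ : PMF α) (P : α → Prop) [DecidablePred P] :
    ENNReal.ofReal (Pr μ P) = expect μ fun a => if P a then 1 else 0 := by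
  classical
  rw [Pr_eq_toReal_expect, ENNReal.ofReal_toReal]
  · refine expect_congr fun a _ => ?_
    split <;> rfl
  · refine ne_top_of_le_ne_top ENNReal.one_ne_top (expect_le_of_le fun a _ => ?_)
    split <;> simp

theorem Pr_nonneg (μ : PMF α) (P : α → Prop) : 0 ≤ Pr μ P := ENNReal.toReal_nonneg

end Expect

theorem PPT.size_le_of_mem_support {V : ℕ} {Model : LanguageModel V} (A : PPT Model) {x y : Data}
    (hy : y ∈ (A.eval x).support) : y.size ≤ A.bound.eval x.size := by
  obtain ⟨r, hr, rfl⟩ := (PMF.mem_support_map_iff _ _ _).1 hy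
  exact (Prog.size_le_run (Nat.succ_pos _) _ _ r hr).2.trans (A.halts x r hr)

theorem PPT.size_le_of_eval_eq_pure {V : ℕ} {Model : LanguageModel V} {A : PPT Model} {x y : Data}
    (h : A.eval x = PMF.pure y) : y.size ≤ A.bound.eval x.size :=
  A.size_le_of_mem_support (by rw [h]; simp)

/-! ### The game monad and invariants of its states -/

namespace Game

variable {V : ℕ} {α β : Type}

theorem run_bind (g : Game V α) (f : α → Game V β) (s : GameState V) :
    (g >>= f).run s = (g.run s).bind fun r => (f r.1).run r.2 := rfl

theorem run_pure (a : α) (s : GameState V) :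
    (pure a : Game V α).run s = PMF.pure (a, s) := rfl

theorem run_get (s : GameState V) :
    (get : Game V (GameState V)).run s = PMF.pure (s, s) := rfl

theorem run_get_bind (f : GameState V → Game V β) (s : GameState V) :
    (get >>= f).run s = (f s).run s :=
  PMF.pure_bind (s, s) _

theorem run_set_bind (s' : GameState V) (f : PUnit → Game V β) (s : GameState V) :
    (set s' >>= f).run s = (f ⟨⟩).run s' :=
  PMF.pure_bind (PUnit.unit, s') _

theorem run_modify_bind (h : GameState V → GameState V) (f : PUnit → Game V β) (s : GameState V) :
    (modify h >>= f).run s = (f ⟨⟩).run (h s) :=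
  PMF.pure_bind (PUnit.unit, h s) _

theorem run_sample_bind (μ : PMF α) (f : α → Game V β) (s : GameState V) :
    (sample μ >>= f).run s = μ.bind fun a => (f a).run s := by
  rw [run_bind, run_sample, PMF.bind_bind]
  simp only [PMF.pure_bind]

theorem run_bind_of_pure {g : Game V α} {a : α} {s s' : GameState V}
    (h : g.run s = PMF.pure (a, s')) (f : α → Game V β) : (g >>= f).run s = (f a).run s' := by
  rw [run_bind, h, PMF.pure_bind]

/-- Started with `I`, the computation keeps `I` and its results satisfy `Q`. -/
def Ensures (I : GameState V → Prop) (g : Game V α) (Q : α → Prop) : Prop :=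
  ∀ s, I s → ∀ r ∈ (g.run s).support, Q r.1 ∧ I r.2

variable {I : GameState V → Prop} {Q Q' : α → Prop}

theorem Ensures.bind {g : Game V α} {f : α → Game V β} {R : β → Prop} (hg : Ensures I g Q)
    (hf : ∀ a, Q a → Ensures I (f a) R) : Ensures I (g >>= f) R := by
  intro s hs r hr
  obtain ⟨a, ha, hr⟩ := PMF.mem_support_do.1 hr
  obtain ⟨h1, h2⟩ := hg s hs a ha
  exact hf a.1 h1 a.2 h2 r hr

theorem Ensures.pure {a : α} (h : Q a) : Ensures I (Pure.pure a) Q := by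
  intro s hs r hr
  obtain rfl := (PMF.mem_support_pure_iff _ _).1 hr
  exact ⟨h, hs⟩

theorem Ensures.sample {μ : PMF α} (h : ∀ a ∈ μ.support, Q a) : Ensures I (Game.sample μ) Q := by
  intro s hs r hr
  obtain ⟨a, ha, hr⟩ := (PMF.mem_support_bind_iff _ _ _).1 hr
  obtain rfl := (PMF.mem_support_pure_iff _ _).1 hr
  exact ⟨h a ha, hs⟩

theorem Ensures.get_bind {f : GameState V → Game V α} (h : ∀ s, I s → Ensures I (f s) Q) :
    Ensures I (get >>= f) Q := by
  intro s hs r hr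
  rw [run_get_bind] at hr
  exact h s hs s hs r hr

theorem Ensures.modify {h : GameState V → GameState V} (hI : ∀ s, I s → I (h s)) :
    Ensures I (modify h : Game V PUnit) fun _ => True := by
  intro s hs r hr
  have hr : r ∈ (PMF.pure (PUnit.unit, h s) : PMF (PUnit × GameState V)).support := hr
  obtain rfl := (PMF.mem_support_pure_iff _ _).1 hr
  exact ⟨trivial, hI s hs⟩

theorem Ensures.mono {g : Game V α} (h : Ensures I g Q) (hQ : ∀ a, Q a → Q' a) :
    Ensures I g Q' := fun s hs r hr => ⟨hQ _ (h s hs r hr).1, (h s hs r hr).2⟩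

theorem Ensures.mapM {γ : Type} {f : γ → Game V α} (l : List γ)
    (h : ∀ a ∈ l, Ensures I (f a) Q) :
    Ensures I (l.mapM f) fun r => r.length = l.length ∧ ∀ b ∈ r, Q b := by
  induction l with
  | nil => exact Ensures.pure (by simp)
  | cons a l ih =>
    rw [List.mapM_cons]
    refine (h a (by simp)).bind fun b hb => (ih fun c hc => h c (by simp [hc])).bind fun r hr => ?_
    refine Ensures.pure ⟨by simp [hr.1], fun c hc => ?_⟩
    rcases List.mem_cons.1 hc with rfl | hc
    · exact hb
    · exact hr.2 c hc

end Game

/-! ### Lazily generated keys -/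

namespace Scheme

variable {V : ℕ} {Model : LanguageModel V} (M : Scheme Model) (κ : ℕ) (pp : Data)

/-- The family `(j, dpk_j)` for the detectors in a list. -/
def pubData (d : ℕ → Data × Data) (l : List ℕ) : Data :=
  Data.ofList (l.map fun j => Data.cons (Data.ofNat j) (d j).1)

/-- The family `(j, dsk_j)` for the detectors in a list. -/
def secData (d : ℕ → Data × Data) (l : List ℕ) : Data :=
  Data.ofList (l.map fun j => Data.cons (Data.ofNat j) (d j).2)

/-- A key pair of a model provider. -/
noncomputable def watSample : PMF (Data × Data) :=
  (M.watKG.eval (Data.tuple [Data.ofNat κ, pp])).map fun y => (y.hd, y.tl)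

/-- Independent key pairs for the detectors in a list. -/
noncomputable def detSample : List ℕ → PMF (ℕ → Data × Data)
  | [] => PMF.pure fun _ => (Data.nil, Data.nil)
  | j :: l => (M.detKG.eval (Data.tuple [Data.ofNat κ, pp])).bind fun y =>
      (detSample l).bind fun d => PMF.pure (Function.update d j (y.hd, y.tl))

/-- The state in which provider `i` and the detectors in `l` have keys. -/
def keyState (i : ℕ) (l : List ℕ) (w : Data × Data) (d : ℕ → Data × Data) : GameState V :=
  { GameState.init V with
    wk := Function.update (fun _ => none) i (some w)
    dk := fun j => if j ∈ l then some (d j) else none }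

variable {κ pp}

theorem run_watKeys_of_some {s : GameState V} {i : ℕ} {k : Data × Data} (h : s.wk i = some k) :
    (M.watKeys κ pp i).run s = PMF.pure (k, s) := by
  rw [watKeys, Game.run_get_bind]
  simp only [h]
  rfl

theorem run_detKeys_of_some {s : GameState V} {j : ℕ} {k : Data × Data} (h : s.dk j = some k) :
    (M.detKeys κ pp j).run s = PMF.pure (k, s) := by
  rw [detKeys, Game.run_get_bind]
  simp only [h]
  rfl

theorem run_watKeys_of_none {s : GameState V} {i : ℕ} (h : s.wk i = none) :
    (M.watKeys κ pp i).run s = (M.watSample κ pp).bind fun k =>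
      PMF.pure (k, { s with wk := Function.update s.wk i (some k) }) := by
  rw [watKeys, Game.run_get_bind]
  simp only [h]
  rw [Game.run_sample_bind, watSample, PMF.bind_map]
  congr 1
  funext y
  exact Game.run_set_bind _ _ _

theorem run_detKeys_of_none {s : GameState V} {j : ℕ} (h : s.dk j = none) :
    (M.detKeys κ pp j).run s = (M.detKG.eval (Data.tuple [Data.ofNat κ, pp])).bind fun y =>
      PMF.pure ((y.hd, y.tl), { s with dk := Function.update s.dk j (some (y.hd, y.tl)) }) := by
  rw [detKeys, Game.run_get_bind]
  simp only [h]
  rw [Game.run_sample_bind]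
  congr 1
  funext y
  exact Game.run_set_bind _ _ _

/-- Folding over detectors whose keys are not yet generated. -/
theorem run_foldlM_detKeys {β : Type} (f : ℕ → Data × Data → β → β) (l : List ℕ) (hl : l.Nodup)
    (s : GameState V) (hs : ∀ j ∈ l, s.dk j = none) (b : β) :
    (l.foldlM (fun b j => do
      let k ← M.detKeys κ pp j
      pure (f j k b)) b : Game V β).run s =
    (M.detSample κ pp l).bind fun d => PMF.pure (l.foldl (fun b j => f j (d j) b) b,
      { s with dk := fun j => if j ∈ l then some (d j) else s.dk j }) := by
  induction l generalizing s b with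
  | nil =>
    simp only [List.foldlM_nil, detSample, PMF.pure_bind, List.foldl_nil, List.not_mem_nil, if_false]
    rfl
  | cons j l ih =>
    obtain ⟨hj, hl⟩ := List.nodup_cons.1 hl
    rw [List.foldlM_cons, bind_assoc, Game.run_bind, M.run_detKeys_of_none (hs j (by simp)),
      detSample, PMF.bind_bind, PMF.bind_bind]
    congr 1
    funext y
    rw [PMF.pure_bind, LawfulMonad.pure_bind, ih hl, PMF.bind_bind]
    · congr 1
      funext d
      rw [PMF.pure_bind]
      -- Since `j` does not recur, entering its key into `d` is invisible to the rest of the fold.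
      have hfold : ∀ (l' : List ℕ), j ∉ l' → ∀ c, l'.foldl (fun b j => f j (d j) b) c =
          l'.foldl (fun b j' => f j' (Function.update d j (y.hd, y.tl) j') b) c := by
        intro l' hl'
        induction l' with
        | nil => intro c; rfl
        | cons a l' ih' =>
          intro c
          simp only [List.mem_cons, not_or] at hl'
          rw [List.foldl_cons, List.foldl_cons, ih' hl'.2, Function.update_of_ne (Ne.symm hl'.1)]
      congr 2
      · rw [List.foldl_cons, hfold l hj, Function.update_self]
      · congr 1
        funext j'
        by_cases h : j' = j
        · subst h; simp [hj]
        · simp [h]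
    · intro j' hj'
      have : j' ≠ j := by rintro rfl; exact hj hj'
      simp only [Function.update_of_ne this]
      exact hs j' (by simp [hj'])

/-- The scheme collects keys with `mapM`, the adversaries with a fold; this brings the former under
`run_foldlM_detKeys`. The accumulator `r` is general for the sake of the induction. -/
theorem mapM_eq_foldlM {m : Type → Type} [Monad m] [LawfulMonad m] {α β γ : Type} (g : α → m γ)
    (f : α → γ → β) (l : List α) (r : List β) :
    (do
      let t ← l.mapM fun a => do
        let k ← g a
        pure (f a k)
      pure (r.reverse ++ t)) = (do
      let t ← l.foldlM (fun r a => do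
        let k ← g a
        pure (f a k :: r)) r
      pure t.reverse) := by
  induction l generalizing r with
  | nil => simp
  | cons a l ih =>
    simp only [List.mapM_cons, List.foldlM_cons, bind_assoc, LawfulMonad.pure_bind]
    congr 1
    funext k
    rw [← ih]
    simp

theorem foldl_cons_eq {α β : Type} (g : α → β) (l : List α) (r : List β) :
    l.foldl (fun r a => g a :: r) r = (l.map g).reverse ++ r := by
  induction l generalizing r with
  | nil => rfl
  | cons a l ih => simp [ih]

theorem run_pubKeys_of_none {S : Finset ℕ} {s : GameState V} (hs : ∀ j ∈ S, s.dk j = none) :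
    (M.pubKeys κ pp S).run s = (M.detSample κ pp (S.sort (· ≤ ·))).bind fun d =>
      PMF.pure (pubData d (S.sort (· ≤ ·)), { s with
        dk := fun j => if j ∈ S.sort (· ≤ ·) then some (d j) else s.dk j }) := by
  have h := mapM_eq_foldlM (m := Game V) (M.detKeys κ pp)
    (fun j k => Data.cons (Data.ofNat j) k.1) (S.sort (· ≤ ·)) []
  simp only [List.reverse_nil, List.nil_append, bind_pure] at h
  rw [pubKeys, h, bind_assoc, Game.run_bind, M.run_foldlM_detKeys
    (fun j k r => Data.cons (Data.ofNat j) k.1 :: r) _ (S.sort_nodup _) s (by simpa using hs),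
    PMF.bind_bind]
  congr 1
  funext d
  rw [PMF.pure_bind, foldl_cons_eq, LawfulMonad.pure_bind, Game.run_pure]
  simp [pubData]

theorem run_mapM_detKeys_of_some {β : Type} (f : ℕ → Data × Data → β) (l : List ℕ)
    {s : GameState V} {d : ℕ → Data × Data} (hs : ∀ j ∈ l, s.dk j = some (d j)) :
    (l.mapM (fun j => do
      let k ← M.detKeys κ pp j
      pure (f j k)) : Game V (List β)).run s = PMF.pure (l.map fun j => f j (d j), s) := by
  induction l with
  | nil => rfl
  | cons j l ih =>
    rw [List.mapM_cons, bind_assoc, Game.run_bind_of_pure (M.run_detKeys_of_some (hs j (by simp))),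
      LawfulMonad.pure_bind, Game.run_bind_of_pure (ih fun j' h => hs j' (by simp [h]))]
    rfl

theorem run_pubKeys_of_some {S : Finset ℕ} {s : GameState V} {d : ℕ → Data × Data}
    (hs : ∀ j ∈ S, s.dk j = some (d j)) :
    (M.pubKeys κ pp S).run s = PMF.pure (pubData d (S.sort (· ≤ ·)), s) := by
  rw [pubKeys, Game.run_bind_of_pure (M.run_mapM_detKeys_of_some
    (fun j k => Data.cons (Data.ofNat j) k.1) _ (by simpa using hs))]
  rfl

theorem run_secKeys_of_some {S : Finset ℕ} {s : GameState V} {d : ℕ → Data × Data}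
    (hs : ∀ j ∈ S, s.dk j = some (d j)) :
    (M.secKeys κ pp S).run s = PMF.pure (secData d (S.sort (· ≤ ·)), s) := by
  rw [secKeys, Game.run_bind_of_pure (M.run_mapM_detKeys_of_some
    (fun j k => Data.cons (Data.ofNat j) k.2) _ (by simpa using hs))]
  rfl

end Scheme

theorem Data.mem_toFinset_lt_size {x : Data} {j : ℕ} (hj : j ∈ x.toFinset) : j < x.size := by
  obtain ⟨y, hy, rfl⟩ := List.mem_map.1 (List.mem_toFinset.1 hj)
  have : ∀ x : Data, ∀ y ∈ x.toList, y.toNat < x.size := by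
    intro x
    induction x with
    | nil => simp [toList]
    | cons a b _ ih =>
      intro y hy
      have := a.two_mul_toNat_lt_size
      rcases List.mem_cons.1 hy with rfl | hy
      · simp; omega
      · have := ih y hy; simp; omega
  exact this x y hy

theorem Data.card_toFinset_le_size (x : Data) : x.toFinset.card ≤ x.size :=
  (List.toFinset_card_le _).trans (by simpa using x.length_toList_lt_size.le)

/-! ### Polynomial bounds for oracle answers -/

namespace Scheme

variable {V : ℕ} {Model : LanguageModel V} (M : Scheme Model) (κ : ℕ) (pp : Data)

/-- A bound for the sizes of keys. -/
noncomputable def keyBound : ℕ :=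
  M.watKG.bound.eval (Data.tuple [Data.ofNat κ, pp]).size +
    M.detKG.bound.eval (Data.tuple [Data.ofNat κ, pp]).size

/-- The keys in a state have size at most `B`. -/
def KeysBounded (B : ℕ) (s : GameState V) : Prop :=
  (∀ i k, s.wk i = some k → k.1.size ≤ B ∧ k.2.size ≤ B) ∧
    ∀ j k, s.dk j = some k → k.1.size ≤ B ∧ k.2.size ≤ B

/-- A polynomial that bounds `keyBound`. -/
noncomputable def keyPoly : Polynomial ℕ :=
  M.watKG.bound.comp (2 * Polynomial.X + 4) + M.detKG.bound.comp (2 * Polynomial.X + 4)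

theorem size_setup_input : (Data.tuple [Data.ofNat κ, pp]).size = 2 * κ + pp.size + 4 := by
  simp [Data.tuple]; omega

theorem keyBound_le {N : ℕ} (h : κ + pp.size ≤ N) : M.keyBound κ pp ≤ M.keyPoly.eval N := by
  have : (Data.tuple [Data.ofNat κ, pp]).size ≤ 2 * N + 4 := by rw [size_setup_input]; omega
  simp only [keyBound, keyPoly, Polynomial.eval_add, Polynomial.eval_comp, Polynomial.eval_mul,
    Polynomial.eval_ofNat, Polynomial.eval_X]
  exact add_le_add (eval_le_eval _ this) (eval_le_eval _ this)

variable {κ pp}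

/-- A stored key is bounded by the invariant, and a fresh one by the running time of key generation.
Without such an invariant the size of an oracle answer would have no bound. -/
theorem ensures_watKeys (i : ℕ) :
    Game.Ensures (KeysBounded (M.keyBound κ pp)) (M.watKeys κ pp i) fun k : Data × Data =>
      k.1.size ≤ M.keyBound κ pp ∧ k.2.size ≤ M.keyBound κ pp := by
  intro s hs r hr
  cases h : s.wk i with
  | some k =>
    rw [M.run_watKeys_of_some h] at hr
    obtain rfl := (PMF.mem_support_pure_iff _ _).1 hr
    exact ⟨hs.1 i k h, hs⟩
  | none =>
    rw [M.run_watKeys_of_none h, watSample, PMF.bind_map] at hr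
    obtain ⟨y, hy, hr⟩ := (PMF.mem_support_bind_iff _ _ _).1 hr
    obtain rfl := (PMF.mem_support_pure_iff _ _).1 hr
    have h1 := M.watKG.size_le_of_mem_support hy
    have h2 : y.hd.size ≤ M.keyBound κ pp ∧ y.tl.size ≤ M.keyBound κ pp :=
      ⟨y.size_hd_le.trans (h1.trans (Nat.le_add_right _ _)),
        y.size_tl_le.trans (h1.trans (Nat.le_add_right _ _))⟩
    refine ⟨h2, fun i' k hk => ?_, hs.2⟩
    by_cases hi : i' = i
    · subst hi
      simp only [Function.update_self, Option.some.injEq] at hk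
      subst hk
      exact h2
    · simp only [Function.update_of_ne hi] at hk
      exact hs.1 i' k hk

theorem ensures_detKeys (j : ℕ) :
    Game.Ensures (KeysBounded (M.keyBound κ pp)) (M.detKeys κ pp j) fun k : Data × Data =>
      k.1.size ≤ M.keyBound κ pp ∧ k.2.size ≤ M.keyBound κ pp := by
  intro s hs r hr
  cases h : s.dk j with
  | some k =>
    rw [M.run_detKeys_of_some h] at hr
    obtain rfl := (PMF.mem_support_pure_iff _ _).1 hr
    exact ⟨hs.2 j k h, hs⟩
  | none =>
    rw [M.run_detKeys_of_none h] at hr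
    obtain ⟨y, hy, hr⟩ := (PMF.mem_support_bind_iff _ _ _).1 hr
    obtain rfl := (PMF.mem_support_pure_iff _ _).1 hr
    have h1 := M.detKG.size_le_of_mem_support hy
    have h2 : y.hd.size ≤ M.keyBound κ pp ∧ y.tl.size ≤ M.keyBound κ pp :=
      ⟨y.size_hd_le.trans (h1.trans (Nat.le_add_left _ _)),
        y.size_tl_le.trans (h1.trans (Nat.le_add_left _ _))⟩
    refine ⟨h2, hs.1, fun i' k hk => ?_⟩
    by_cases hi : i' = j
    · subst hi
      simp only [Function.update_self, Option.some.injEq] at hk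
      subst hk
      exact h2
    · simp only [Function.update_of_ne hi] at hk
      exact hs.2 i' k hk

theorem ensures_keyFamily (f : Data × Data → Data)
    (hf : ∀ k : Data × Data, f k = k.1 ∨ f k = k.2) (S : Finset ℕ) {n : ℕ}
    (hn : S.card ≤ n) (hS : ∀ j ∈ S, j ≤ n) :
    Game.Ensures (KeysBounded (M.keyBound κ pp)) (do
      let l ← (S.sort (· ≤ ·)).mapM fun j => do
        let k ← M.detKeys κ pp j
        pure (Data.cons (Data.ofNat j) (f k))
      pure (Data.ofList l) : Game V Data)
      fun D => D.size ≤ n * (2 * n + M.keyBound κ pp + 3) + 1 := by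
  refine (Game.Ensures.mapM (Q := fun x : Data => x.size ≤ 2 * n + M.keyBound κ pp + 2)
    _ fun j hj => (M.ensures_detKeys j).bind fun k hk => Game.Ensures.pure ?_).bind
    fun l hl => Game.Ensures.pure ?_
  · have := hS j (by simpa using hj)
    rcases hf k with h | h <;> simp only [h, Data.size_cons, Data.size_ofNat] <;> omega
  · refine (Data.size_ofList_le hl.2).trans ?_
    have h1 : l.length ≤ n := by rw [hl.1, Finset.length_sort]; exact hn
    gcongr

theorem ensures_pubKeys (S : Finset ℕ) {n : ℕ} (hn : S.card ≤ n) (hS : ∀ j ∈ S, j ≤ n) :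
    Game.Ensures (KeysBounded (M.keyBound κ pp)) (M.pubKeys κ pp S)
      fun D => D.size ≤ n * (2 * n + M.keyBound κ pp + 3) + 1 :=
  M.ensures_keyFamily (fun k => k.1) (fun _ => Or.inl rfl) S hn hS

theorem ensures_secKeys (S : Finset ℕ) {n : ℕ} (hn : S.card ≤ n) (hS : ∀ j ∈ S, j ≤ n) :
    Game.Ensures (KeysBounded (M.keyBound κ pp)) (M.secKeys κ pp S)
      fun D => D.size ≤ n * (2 * n + M.keyBound κ pp + 3) + 1 :=
  M.ensures_keyFamily (fun k => k.2) (fun _ => Or.inr rfl) S hn hS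

/-- A polynomial that bounds the inputs of watermarking and forging in the challenge oracle. -/
noncomputable def argPoly : Polynomial ℕ :=
  3 * Polynomial.X + M.keyPoly +
    2 * (Polynomial.X * (2 * Polynomial.X + M.keyPoly + 3) + 1) +
    (Polynomial.X * Polynomial.C (2 * V + 2) + 1) + 10

theorem ensures_mark (i : ℕ) (S : Finset ℕ) (p : Text V) {n N : ℕ} (hn : S.card ≤ n)
    (hS : ∀ j ∈ S, j ≤ n) (hp : p.length ≤ n) (hN : κ + pp.size + n ≤ N) :
    Game.Ensures (KeysBounded (M.keyBound κ pp)) (M.mark κ pp i S p)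
      fun t => t.length ≤ M.watLen.eval (M.argPoly.eval N) := by
  have hB := M.keyBound_le κ pp (show κ + pp.size ≤ N by omega)
  refine (M.ensures_watKeys i).bind fun k hk => (M.ensures_pubKeys S hn hS).bind fun D hD =>
    Game.Ensures.sample fun t ht => (M.watMar_length _ t ht).trans (eval_le_eval _ ?_)
  have h1 : n * (2 * n + M.keyBound κ pp + 3) ≤ N * (2 * N + M.keyPoly.eval N + 3) := by
    gcongr <;> omega
  have h2 : p.length * (2 * V + 2) ≤ N * (2 * V + 2) := by gcongr; omega
  have h3 := Data.size_ofText_le p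
  simp only [Data.tuple, Data.ofList_cons, Data.ofList_nil, Data.size_cons, Data.size_nil,
    Data.size_ofNat, argPoly, Polynomial.eval_add, Polynomial.eval_mul, Polynomial.eval_ofNat,
    Polynomial.eval_X, Polynomial.eval_one, Polynomial.eval_C]
  omega

theorem ensures_forge (F : PPT Model) (i : ℕ) (S C : Finset ℕ) (p : Text V) {n N : ℕ}
    (hn : S.card ≤ n) (hS : ∀ j ∈ S, j ≤ n) (hCn : C.card ≤ n) (hC : ∀ j ∈ C, j ≤ n)
    (hp : p.length ≤ n) (hN : κ + pp.size + n ≤ N) :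
    Game.Ensures (KeysBounded (M.keyBound κ pp)) (M.forge κ pp F i S C p)
      fun t => t.length ≤ F.bound.eval (M.argPoly.eval N) := by
  have hB := M.keyBound_le κ pp (show κ + pp.size ≤ N by omega)
  refine (M.ensures_watKeys i).bind fun k hk => (M.ensures_pubKeys S hn hS).bind fun D hD =>
    (M.ensures_secKeys C hCn hC).bind fun K hK =>
    (Game.Ensures.sample (Q := fun y => y.size ≤ F.bound.eval (M.argPoly.eval N)) fun y hy =>
      (F.size_le_of_mem_support hy).trans (eval_le_eval _ ?_)).bind fun y hy =>
      Game.Ensures.pure (y.length_toText_lt_size.le.trans hy)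
  have h1 : n * (2 * n + M.keyBound κ pp + 3) ≤ N * (2 * N + M.keyPoly.eval N + 3) := by
    gcongr <;> omega
  have h2 : p.length * (2 * V + 2) ≤ N * (2 * V + 2) := by gcongr; omega
  have h3 := Data.size_ofText_le p
  simp only [Data.tuple, Data.ofList_cons, Data.ofList_nil, Data.size_cons, Data.size_nil,
    Data.size_ofNat, argPoly, Polynomial.eval_add, Polynomial.eval_mul, Polynomial.eval_ofNat,
    Polynomial.eval_X, Polynomial.eval_one, Polynomial.eval_C]
  omega

/-- The setting of the soundness game. -/
noncomputable abbrev soundSetting : Setting Model where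
  Idx := ℕ × Data
  sec c := c.1 + c.2.size
  oracle c := M.soundOracle c.1 c.2
  Inv c := KeysBounded (M.keyBound c.1 c.2)

/-- The setting of the off-the-record game. -/
noncomputable abbrev otrSetting (F : PPT Model) : Setting Model where
  Idx := ℕ × Data × Bool
  sec c := c.1 + c.2.1.size
  oracle c := M.otrOracle c.1 c.2.1 F c.2.2
  Inv c := KeysBounded (M.keyBound c.1 c.2.1)

/-- Query `n` has answers of polynomial length and keeps the invariant. -/
def _root_.Watermarking.Setting.Tame (K : Setting Model) (n : ℕ) : Prop :=
  ∃ q : Polynomial ℕ, ∀ c x, Game.Ensures (K.Inv c) (K.oracle c (Data.cons (Data.ofNat n) x))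
    fun y => y.size ≤ q.eval (K.sec c + x.size)

theorem soundOracle_secKey (y : Data) :
    M.soundOracle κ pp (Data.cons (Data.ofNat 1) y) = (do
      let k ← M.detKeys κ pp y.toNat
      modify fun s => { s with dkAsked := insert y.toNat s.dkAsked }
      pure (Data.cons k.1 k.2)) := rfl

theorem soundOracle_watPub (y : Data) :
    M.soundOracle κ pp (Data.cons (Data.ofNat 2) y) = (do
      let k ← M.watKeys κ pp y.toNat
      pure k.1) := rfl

theorem soundOracle_detPub (y : Data) :
    M.soundOracle κ pp (Data.cons (Data.ofNat 3) y) = (do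
      let k ← M.detKeys κ pp y.toNat
      pure k.1) := rfl

theorem otrOracle_secKey (F : PPT Model) (b : Bool) (y : Data) :
    M.otrOracle κ pp F b (Data.cons (Data.ofNat 1) y) = (do
      let s ← get
      if ∃ e ∈ s.challenged, y.toNat ∈ e.2.1 \ e.2.2.1 then
        pure Data.nil
      else
        let k ← M.detKeys κ pp y.toNat
        modify fun s => { s with dkAsked := insert y.toNat s.dkAsked }
        pure (Data.cons k.1 k.2)) := rfl

theorem otrOracle_watPub (F : PPT Model) (b : Bool) (y : Data) :
    M.otrOracle κ pp F b (Data.cons (Data.ofNat 2) y) = (do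
      let _ ← get
      let k ← M.watKeys κ pp y.toNat
      pure k.1) := rfl

theorem otrOracle_detPub (F : PPT Model) (b : Bool) (y : Data) :
    M.otrOracle κ pp F b (Data.cons (Data.ofNat 3) y) = (do
      let _ ← get
      let k ← M.detKeys κ pp y.toNat
      pure k.1) := rfl

theorem otrOracle_challenge (F : PPT Model) (b : Bool) (y : Data) :
    M.otrOracle κ pp F b (Data.cons (Data.ofNat 4) y) = (do
      let s ← get
      if y.tl.tl.hd.toFinset ⊆ y.tl.hd.toFinset ∧ y.hd.toNat ∉ s.wkAsked ∧
          Disjoint (y.tl.hd.toFinset \ y.tl.tl.hd.toFinset) s.dkAsked then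
        let t ← (bif b then
          M.forge κ pp F y.hd.toNat y.tl.hd.toFinset y.tl.tl.hd.toFinset (y.tl.tl.tl.toText V)
        else M.mark κ pp y.hd.toNat y.tl.hd.toFinset (y.tl.tl.tl.toText V))
        modify fun s => { s with challenged :=
          (y.hd.toNat, y.tl.hd.toFinset, y.tl.tl.hd.toFinset, t) :: s.challenged }
        pure (Data.ofText t)
      else
        pure Data.nil) := by
  cases b <;> rfl

theorem tame_secKey_sound : M.soundSetting.Tame 1 := by
  refine ⟨2 * M.keyPoly + 1, fun c x => ?_⟩
  have hB := M.keyBound_le c.1 c.2 (show c.1 + c.2.size ≤ c.1 + c.2.size + x.size by omega)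
  rw [show M.soundSetting.oracle c = M.soundOracle c.1 c.2 from rfl, soundOracle_secKey]
  refine (M.ensures_detKeys _).bind fun k hk =>
    (Game.Ensures.modify ?_).bind fun _ _ => Game.Ensures.pure ?_
  · exact fun s hs => hs
  simp only [Data.size_cons, Polynomial.eval_add, Polynomial.eval_mul,
    Polynomial.eval_ofNat, Polynomial.eval_one]
  omega

theorem tame_watPub_sound : M.soundSetting.Tame 2 := by
  refine ⟨M.keyPoly, fun c x => ?_⟩
  have hB := M.keyBound_le c.1 c.2 (show c.1 + c.2.size ≤ c.1 + c.2.size + x.size by omega)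
  rw [show M.soundSetting.oracle c = M.soundOracle c.1 c.2 from rfl, soundOracle_watPub]
  exact (M.ensures_watKeys _).bind fun k hk => Game.Ensures.pure (hk.1.trans hB)

theorem tame_detPub_sound : M.soundSetting.Tame 3 := by
  refine ⟨M.keyPoly, fun c x => ?_⟩
  have hB := M.keyBound_le c.1 c.2 (show c.1 + c.2.size ≤ c.1 + c.2.size + x.size by omega)
  rw [show M.soundSetting.oracle c = M.soundOracle c.1 c.2 from rfl, soundOracle_detPub]
  exact (M.ensures_detKeys _).bind fun k hk => Game.Ensures.pure (hk.1.trans hB)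

variable (F : PPT Model)

theorem tame_secKey_otr : (M.otrSetting F).Tame 1 := by
  refine ⟨2 * M.keyPoly + 1, fun c x => ?_⟩
  have hB := M.keyBound_le c.1 c.2.1 (show c.1 + c.2.1.size ≤ c.1 + c.2.1.size + x.size by omega)
  rw [show (M.otrSetting F).oracle c = M.otrOracle c.1 c.2.1 F c.2.2 from rfl,
    otrOracle_secKey]
  refine Game.Ensures.get_bind fun s hs => ?_
  split
  · refine Game.Ensures.pure ?_
    simp
  · refine (M.ensures_detKeys _).bind fun k hk =>
      (Game.Ensures.modify ?_).bind fun _ _ => Game.Ensures.pure ?_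
    · exact fun s hs => hs
    simp only [Data.size_cons, Polynomial.eval_add, Polynomial.eval_mul,
      Polynomial.eval_ofNat, Polynomial.eval_one]
    omega

theorem tame_watPub_otr : (M.otrSetting F).Tame 2 := by
  refine ⟨M.keyPoly, fun c x => ?_⟩
  have hB := M.keyBound_le c.1 c.2.1 (show c.1 + c.2.1.size ≤ c.1 + c.2.1.size + x.size by omega)
  rw [show (M.otrSetting F).oracle c = M.otrOracle c.1 c.2.1 F c.2.2 from rfl, otrOracle_watPub]
  exact Game.Ensures.get_bind fun _ _ =>
    (M.ensures_watKeys _).bind fun k hk => Game.Ensures.pure (hk.1.trans hB)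

theorem tame_detPub_otr : (M.otrSetting F).Tame 3 := by
  refine ⟨M.keyPoly, fun c x => ?_⟩
  have hB := M.keyBound_le c.1 c.2.1 (show c.1 + c.2.1.size ≤ c.1 + c.2.1.size + x.size by omega)
  rw [show (M.otrSetting F).oracle c = M.otrOracle c.1 c.2.1 F c.2.2 from rfl, otrOracle_detPub]
  exact Game.Ensures.get_bind fun _ _ =>
    (M.ensures_detKeys _).bind fun k hk => Game.Ensures.pure (hk.1.trans hB)

/-- Genuine texts are bounded by `watLen`, forged ones by the running time of `F`; the sum of the
two bounds serves both challenge bits. Watermarking is done by the oracle, so its running time plays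
no role. -/
theorem tame_challenge_otr : (M.otrSetting F).Tame 4 := by
  refine ⟨(M.watLen.comp M.argPoly + F.bound.comp M.argPoly) * Polynomial.C (2 * V + 2) + 1,
    fun c y => ?_⟩
  rw [show (M.otrSetting F).oracle c = M.otrOracle c.1 c.2.1 F c.2.2 from rfl,
    otrOracle_challenge]
  refine Game.Ensures.get_bind fun s hs => ?_
  set N := c.1 + c.2.1.size + y.size with hN
  have e1 : ((M.watLen.comp M.argPoly + F.bound.comp M.argPoly) * Polynomial.C (2 * V + 2) +
      1).eval N = (M.watLen.eval (M.argPoly.eval N) + F.bound.eval (M.argPoly.eval N)) *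
        (2 * V + 2) + 1 := by
    simp [Polynomial.eval_comp]
  have h1 := y.size_tl_le
  have h2 := y.tl.size_tl_le
  have h3 := y.tl.size_hd_le
  have h4 := y.tl.tl.size_tl_le
  have h5 := y.tl.tl.size_hd_le
  split
  · refine Game.Ensures.bind (Q := fun t : Text V => t.length ≤ M.watLen.eval (M.argPoly.eval N) +
      F.bound.eval (M.argPoly.eval N)) ?_ fun t ht =>
      (Game.Ensures.modify ?_).bind fun _ _ => Game.Ensures.pure ?_
    · have hS := y.tl.hd.card_toFinset_le_size
      have hC := y.tl.tl.hd.card_toFinset_le_size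
      have hp := y.tl.tl.tl.length_toText_lt_size (V := V)
      have hS' : ∀ j ∈ y.tl.hd.toFinset, j ≤ y.size := fun j hj => by
        have := Data.mem_toFinset_lt_size hj; omega
      have hC' : ∀ j ∈ y.tl.tl.hd.toFinset, j ≤ y.size := fun j hj => by
        have := Data.mem_toFinset_lt_size hj; omega
      cases c.2.2
      rotate_left
      · exact (M.ensures_forge F _ _ _ _ (n := y.size) (by omega) hS' (by omega) hC' (by omega)
          hN.ge).mono fun t ht => by omega
      · exact (M.ensures_mark _ _ _ (n := y.size) (by omega) hS' (by omega)
          hN.ge).mono fun t ht => by omega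
    · exact fun s hs => hs
    · rw [e1]
      refine (Data.size_ofText_le t).trans ?_
      gcongr
  · refine Game.Ensures.pure ?_
    rw [e1]
    simp

end Scheme

/-! ### The two adversaries -/

variable {V : ℕ} {Model : LanguageModel V}

open Data in
/-- Compute `(i, S, prompt)`, ask for the public keys, and ask for the secret keys of a random
subset `C` of `S`; the result is `((i, S, prompt), wpk, (j, dpk_j)_{j ∈ S}, C, (j, dsk_j)_{j ∈ C})`.
-/
noncomputable def prepare (K : Setting Model) (fam : PPT Model) (c : K.Idx) (x : Data) :
    Game V Data :=
  Game.sample (fam.eval x.hd) >>= fun f =>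
  K.oracle c (cons (ofNat 2) f.hd) >>= fun wpk =>
  Data.foldM (fun j acc =>
    K.oracle c (cons (ofNat 3) j) >>= fun a => pure (cons (cons j a) acc)) f.tl.hd nil >>= fun R =>
  -- `R` is in decreasing order; its reversal `D` has the order of `pubKeys`.
  Data.foldM (fun a acc => pure (cons a acc)) R nil >>= fun D =>
  Data.foldM (fun e acc =>
    (Game.sample fairCoin >>= fun b => pure (ofBool b)) >>= fun b =>
    if b.isNil then pure acc else
      K.oracle c (cons (ofNat 1) e.hd) >>= fun k =>
      pure (cons (cons e.hd acc.hd) (cons (cons e.hd k.tl) acc.tl))) R (cons nil nil) >>= fun T =>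
  pure (cons f (cons wpk (cons D T)))

open Data in
/-- The adversary against soundness: run the simulator with the secret keys of a random subset. -/
noncomputable def forger (K : Setting Model) (fam F : PPT Model) (c : K.Idx) (x : Data) :
    Game V Data :=
  prepare K fam c x >>= fun z =>
  Game.sample (F.eval (tuple [x.hd, x.tl.hd, z.tl.hd, z.tl.tl.hd, z.tl.tl.tl.tl,
    z.hd.tl.tl.hd])) >>= fun y =>
  pure (cons z.hd.hd (cons z.hd.tl.hd y))

open Data in
/-- Test whether a text is long, has a short watermark and is accepted by all detectors in `C`. -/
noncomputable def inspect (thr ext det : PPT Model) (x z t : Data) : Game V Data :=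
  Data.foldM (fun _ acc => pure (cons nil acc)) z.hd.tl.hd nil >>= fun n =>
  Game.sample (thr.eval (tuple [x.hd, n])) >>= fun e =>
  Game.sample (ext.eval (tuple [x.hd, x.tl.hd, z.tl.hd, z.tl.tl.hd, t])) >>= fun w =>
  -- One entry of the unary threshold is removed per token, so nothing remains exactly when the text
  -- is long enough.
  Data.foldM (fun _ acc => pure acc.tl) t e >>= fun long =>
  -- Each bit of the watermark removes two detectors, so something remains exactly when twice the
  -- length is below `|S|`.
  Data.foldM (fun _ acc => pure acc.tl.tl) w z.hd.tl.hd >>= fun short =>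
  (if long.isNil then if short.isNil then pure nil else pure (cons nil nil) else pure nil) >>=
    fun v =>
  Data.foldM (fun e acc =>
    Game.sample (det.eval (tuple [x.hd, x.tl.hd, z.tl.hd, e.tl, z.tl.tl.hd, t])) >>= fun b =>
    if b.isNil then pure nil else pure acc) z.tl.tl.tl.tl v

open Data in
/-- The adversary against the off-the-record property. -/
noncomputable def distinguisher (K : Setting Model) (fam thr ext det : PPT Model) (c : K.Idx)
    (x : Data) : Game V Data :=
  prepare K fam c x >>= fun z =>
  K.oracle c (cons (ofNat 4) (cons z.hd.hd (cons z.hd.tl.hd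
    (cons z.tl.tl.tl.hd z.hd.tl.tl.hd)))) >>= fun t =>
  inspect thr ext det x z t

open Feasible in
theorem feasible_prepare {K : Setting Model} (fam : PPT Model) (h1 : K.Tame 1) (h2 : K.Tame 2)
    (h3 : K.Tame 3) : Feasible K (prepare K fam) := by
  unfold prepare
  refine bind (call fam id.hd) (bind (query id.hd.hd 2 h2) (bind (fold ?_ ?_ id.tl.hd.tl.hd nil)
    (bind (fold ?_ ?_ id.hd nil) (bind (fold ?_ ?_ id.tl.hd (nil.cons nil)) ?_))))
  · exact bind (query id.hd 3 h3) ((id.tl.hd.cons id.hd).cons id.tl.tl.hd)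
  · obtain ⟨q, hq⟩ := h3
    refine ⟨Polynomial.X + q + 2, fun c x a acc s hs r hr => ?_⟩
    obtain ⟨b, hb, hr⟩ := PMF.mem_support_do.1 hr
    obtain rfl := (PMF.mem_support_pure_iff _ _).1 hr
    have h := (hq c a s hs b hb).1
    have h' := eval_le_eval q (show K.sec c + a.size ≤ K.sec c + x.size + a.size by omega)
    simp only [Data.size_cons, Polynomial.eval_add, Polynomial.eval_X, Polynomial.eval_ofNat]
    omega
  · exact id.hd.cons id.tl.hd
  · refine ⟨Polynomial.X + 1, fun c x a acc s hs r hr => ?_⟩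
    obtain rfl := (PMF.mem_support_pure_iff _ _).1 hr
    simp only [Data.size_cons, Polynomial.eval_add, Polynomial.eval_X, Polynomial.eval_one]
    omega
  · refine bind coin (ite id.hd id.tl.tl.hd ?_)
    exact bind (query id.tl.hd.hd 1 h1) ((id.tl.tl.hd.hd.cons id.tl.tl.tl.hd.hd).cons
      ((id.tl.tl.hd.hd.cons id.hd.tl).cons id.tl.tl.tl.hd.tl))
  · obtain ⟨q, hq⟩ := h1
    refine ⟨2 * Polynomial.X + q + 10, fun c x a acc s hs r hr => ?_⟩
    obtain ⟨b, hb, hr⟩ := PMF.mem_support_do.1 hr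
    obtain ⟨b', hb', hb⟩ := PMF.mem_support_do.1 hb
    obtain ⟨b'', hb'', hb'⟩ := (PMF.mem_support_bind_iff _ _ _).1 hb'
    obtain rfl := (PMF.mem_support_pure_iff _ _).1 hb'
    obtain rfl := (PMF.mem_support_pure_iff _ _).1 hb
    simp only [Data.isNil_ofBool] at hr
    cases b''
    · obtain rfl := (PMF.mem_support_pure_iff _ _).1 hr
      simp
    · obtain ⟨k, hk, hr⟩ := PMF.mem_support_do.1 hr
      obtain rfl := (PMF.mem_support_pure_iff _ _).1 hr
      have h := (hq c a.hd s hs k hk).1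
      have ha := a.size_hd_le
      have hk := k.1.size_tl_le
      have h' := eval_le_eval q (show K.sec c + a.hd.size ≤ K.sec c + x.size + a.size by omega)
      -- For an empty accumulator both projections are `nil` and together larger than the
      -- accumulator itself; the additive constant absorbs this.
      cases acc <;>
      simp only [Data.size_cons, Data.hd_cons, Data.tl_cons, Data.hd_nil, Data.tl_nil,
        Data.size_nil, Polynomial.eval_add, Polynomial.eval_mul, Polynomial.eval_X,
        Polynomial.eval_ofNat] <;>
      omega
  · exact id.tl.tl.tl.tl.hd.cons (id.tl.tl.tl.hd.cons (id.tl.hd.cons id.hd))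

open Feasible in
theorem feasible_forger {K : Setting Model} (fam F : PPT Model) (h1 : K.Tame 1) (h2 : K.Tame 2)
    (h3 : K.Tame 3) : Feasible K (forger K fam F) := by
  unfold forger
  refine bind (feasible_prepare fam h1 h2 h3) (bind (call F ?_) ?_)
  · exact id.tl.hd.cons (id.tl.tl.hd.cons (id.hd.tl.hd.cons (id.hd.tl.tl.hd.cons
      (id.hd.tl.tl.tl.tl.cons (id.hd.hd.tl.tl.hd.cons nil)))))
  · exact id.tl.hd.hd.hd.cons (id.tl.hd.hd.tl.hd.cons id.hd)

open Feasible in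
theorem feasible_inspect {K : Setting Model} (thr ext det : PPT Model) :
    Feasible K fun _ y => inspect thr ext det y.tl.tl y.tl.hd y.hd := by
  unfold inspect
  refine bind (fold ?_ ?_ id.tl.hd.hd.tl.hd nil) (bind (call thr ?_) (bind (call ext ?_)
    (bind (fold ?_ ?_ ?_ ?_) (bind (fold ?_ ?_ ?_ ?_) (bind (ite id.tl.hd
      (ite id.hd nil (nil.cons nil)) nil) (fold ?_ ?_ ?_ id.hd))))))
  · exact nil.cons id.tl.hd
  · refine ⟨2, fun c x a acc s hs r hr => ?_⟩
    obtain rfl := (PMF.mem_support_pure_iff _ _).1 hr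
    simp; omega
  · exact id.tl.tl.tl.hd.cons (id.hd.cons nil)
  · exact id.tl.tl.tl.tl.hd.cons (id.tl.tl.tl.tl.tl.hd.cons (id.tl.tl.tl.hd.tl.hd.cons
      (id.tl.tl.tl.hd.tl.tl.hd.cons (id.tl.tl.hd.cons nil))))
  · exact id.tl.hd.tl
  · refine ⟨0, fun c x a acc s hs r hr => ?_⟩
    obtain rfl := (PMF.mem_support_pure_iff _ _).1 hr
    simpa using acc.size_tl_le
  · exact id.tl.tl.tl.hd
  · exact id.tl.hd
  · exact id.tl.hd.tl.tl
  · refine ⟨0, fun c x a acc s hs r hr => ?_⟩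
    obtain rfl := (PMF.mem_support_pure_iff _ _).1 hr
    simpa using acc.tl.size_tl_le.trans acc.size_tl_le
  · exact id.tl.hd
  · exact id.tl.tl.tl.tl.tl.hd.hd.tl.hd
  · refine bind (call det ?_) (ite id.hd nil id.tl.tl.hd)
    exact id.tl.tl.tl.tl.tl.tl.tl.tl.tl.tl.hd.cons (id.tl.tl.tl.tl.tl.tl.tl.tl.tl.tl.tl.hd.cons
      (id.tl.tl.tl.tl.tl.tl.tl.tl.tl.hd.tl.hd.cons (id.hd.tl.cons
      (id.tl.tl.tl.tl.tl.tl.tl.tl.tl.hd.tl.tl.hd.cons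
      (id.tl.tl.tl.tl.tl.tl.tl.tl.hd.cons nil)))))
  · refine ⟨1, fun c x a acc s hs r hr => ?_⟩
    obtain ⟨b, hb, hr⟩ := PMF.mem_support_do.1 hr
    cases h : b.1.isNil <;>
      simp only [h, Bool.false_eq_true, if_true, if_false] at hr <;>
      obtain rfl := (PMF.mem_support_pure_iff _ _).1 hr <;> simp
  · exact id.tl.tl.tl.tl.tl.tl.tl.hd.tl.tl.tl.tl

open Feasible in
theorem feasible_distinguisher {K : Setting Model} (fam thr ext det : PPT Model) (h1 : K.Tame 1)
    (h2 : K.Tame 2) (h3 : K.Tame 3) (h4 : K.Tame 4) :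
    Feasible K (distinguisher K fam thr ext det) := by
  unfold distinguisher
  refine bind (feasible_prepare fam h1 h2 h3) (bind (query ?_ 4 h4) (feasible_inspect thr ext det))
  exact id.hd.hd.hd.cons (id.hd.hd.tl.hd.cons (id.hd.tl.tl.tl.hd.cons id.hd.hd.tl.tl.hd))

/-! ### Evaluation of the folds and the random subset -/

theorem Data.foldM_eq {m : Type → Type} [Monad m] (f : Data → Data → m Data) (l acc : Data) :
    Data.foldM f l acc = l.toList.foldlM (fun acc a => f a acc) acc := by
  induction l generalizing acc with
  | nil => rfl
  | cons a l _ ih => simp only [foldM, toList, List.foldlM_cons, ih]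

theorem Data.foldM_pure {m : Type → Type} [Monad m] [LawfulMonad m] (f : Data → Data → Data)
    (l acc : Data) : Data.foldM (m := m) (fun a acc => pure (f a acc)) l acc =
      pure (l.toList.foldl (fun acc a => f a acc) acc) := by
  rw [foldM_eq, List.foldlM_pure]

theorem Data.foldl_cons (g : Data → Data) (l r : List Data) :
    l.foldl (fun acc a => cons (g a) acc) (ofList r) = ofList ((l.map g).reverse ++ r) := by
  induction l generalizing r with
  | nil => rfl
  | cons a l ih => rw [List.foldl_cons, ← ofList_cons, ih]; simp

theorem Data.foldl_cons_nil (l : List Data) (n : ℕ) :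
    l.foldl (fun acc _ => cons nil acc) (ofNat n) = ofNat (n + l.length) := by
  induction l generalizing n with
  | nil => rfl
  | cons a l ih =>
    rw [List.foldl_cons, show cons nil (ofNat n) = ofNat (n + 1) from rfl, ih, List.length_cons]
    congr 1; omega

theorem Data.isNil_iff (x : Data) : x.isNil = true ↔ x.toList.length = 0 := by
  cases x <;> simp [toList]

theorem Data.length_toList_tl (x : Data) : x.tl.toList.length = x.toList.length - 1 := by
  cases x <;> simp [toList]

theorem Data.isNil_foldl_tl (l : List Data) (x : Data) :
    (l.foldl (fun acc _ => acc.tl) x).isNil = true ↔ x.toList.length ≤ l.length := by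
  induction l generalizing x with
  | nil => simp [isNil_iff]
  | cons a l ih => rw [List.foldl_cons, ih, length_toList_tl, List.length_cons]; omega

theorem Data.isNil_foldl_tl_tl (l : List Data) (x : Data) :
    (l.foldl (fun acc _ => acc.tl.tl) x).isNil = true ↔ x.toList.length ≤ 2 * l.length := by
  induction l generalizing x with
  | nil => simp [isNil_iff]
  | cons a l ih =>
    rw [List.foldl_cons, ih, length_toList_tl, length_toList_tl, List.length_cons]; omega

theorem Data.length_toList_ofNat (n : ℕ) : (ofNat n).toList.length = n := by
  induction n with
  | zero => rfl
  | succ n ih => simp [ofNat, toList, ih]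

/-- A uniformly random sublist. -/
noncomputable def pick : List ℕ → PMF (List ℕ)
  | [] => PMF.pure []
  | j :: l => (pick l).bind fun L => fairCoin.bind fun b => PMF.pure (if b then j :: L else L)

theorem sublist_of_mem_support_pick {l L : List ℕ} (h : L ∈ (pick l).support) : L.Sublist l := by
  induction l generalizing L with
  | nil => rw [pick, PMF.mem_support_pure_iff] at h; simp [h]
  | cons j l ih =>
    obtain ⟨L', hL', h⟩ := (PMF.mem_support_bind_iff _ _ _).1 h
    obtain ⟨b, _, h⟩ := (PMF.mem_support_bind_iff _ _ _).1 h
    obtain rfl := (PMF.mem_support_pure_iff _ _).1 h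
    cases b
    · exact (ih hL').cons _
    · exact (ih hL').cons_cons _

/-- Without repetitions in `l`, each subset arises from exactly one sequence of coins. -/
theorem expect_pick {l : List ℕ} (hl : l.Nodup) (φ : Finset ℕ → ℝ≥0∞) :
    expect (pick l) (fun L => φ L.toFinset) =
      2⁻¹ ^ l.length * ∑ C ∈ l.toFinset.powerset, φ C := by
  induction l generalizing φ with
  | nil => simp [pick, expect_pure]
  | cons j l ih =>
    obtain ⟨hj, hl⟩ := List.nodup_cons.1 hl
    simp only [pick, expect_bind, expect_pure, expect_fairCoin, if_true, Bool.false_eq_true,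
      if_false, List.toFinset_cons]
    rw [expect_const_mul, expect_add, ih hl (fun C => φ (insert j C)), ih hl φ,
      Finset.sum_powerset_insert (by simpa using hj), List.length_cons, pow_succ]
    ring

/-- An oracle that answers key queries honestly as long as there was no challenge. -/
structure Scheme.Serves (M : Scheme Model) (κ : ℕ) (pp : Data) (O : Data → Game V Data) :
    Prop where
  secKey : ∀ y s, s.challenged = [] → (O (Data.cons (Data.ofNat 1) y)).run s =
    (do
      let k ← M.detKeys κ pp y.toNat
      modify fun s => { s with dkAsked := insert y.toNat s.dkAsked }
      pure (Data.cons k.1 k.2) : Game V Data).run s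
  watPub : ∀ y, O (Data.cons (Data.ofNat 2) y) = do
    let k ← M.watKeys κ pp y.toNat
    pure k.1
  detPub : ∀ y, O (Data.cons (Data.ofNat 3) y) = do
    let k ← M.detKeys κ pp y.toNat
    pure k.1

namespace Scheme

variable (M : Scheme Model) {κ : ℕ} {pp : Data}

theorem serves_soundOracle : M.Serves κ pp (M.soundOracle κ pp) :=
  ⟨fun y s _ => by rw [soundOracle_secKey], M.soundOracle_watPub, M.soundOracle_detPub⟩

theorem serves_otrOracle (F : PPT Model) (b : Bool) : M.Serves κ pp (M.otrOracle κ pp F b) := by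
  refine ⟨fun y s hs => ?_, fun y => ?_, fun y => ?_⟩
  · rw [otrOracle_secKey, Game.run_get_bind, if_neg (by simp [hs])]
  · rw [otrOracle_watPub]
    exact StateT.ext fun s => Game.run_get_bind _ _
  · rw [otrOracle_detPub]
    exact StateT.ext fun s => Game.run_get_bind _ _

variable {M}

/-- The list is traversed from its end, so prepending the chosen entries leaves them in increasing
order, as `secKeys` would list them. The left fold over the reversed list is a right fold, matching
the recursion of `pick`. -/
theorem Serves.run_pick {O : Data → Game V Data} (hO : M.Serves κ pp O) (l : List ℕ)
    (d : ℕ → Data × Data) (s : GameState V) (hs : ∀ j ∈ l, s.dk j = some (d j))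
    (hc : s.challenged = []) :
    ((l.map fun j => Data.cons (Data.ofNat j) (d j).1).reverse.foldlM (fun acc e =>
      (Game.sample fairCoin >>= fun b => pure (Data.ofBool b)) >>= fun b =>
      if b.isNil then pure acc else
        O (Data.cons (Data.ofNat 1) e.hd) >>= fun k =>
        pure (Data.cons (Data.cons e.hd acc.hd) (Data.cons (Data.cons e.hd k.tl) acc.tl)))
      (Data.cons Data.nil Data.nil)).run s =
    (pick l).bind fun L => PMF.pure (Data.cons (Data.ofList (L.map Data.ofNat)) (secData d L),
      { s with dkAsked := L.toFinset ∪ s.dkAsked }) := by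
  rw [List.foldlM_reverse]
  induction l with
  | nil =>
    rw [pick, PMF.pure_bind]
    simp only [List.map_nil, List.foldrM_nil, List.toFinset_nil, Finset.empty_union]
    rfl
  | cons j l ih =>
    rw [List.map_cons, List.foldrM_cons, Game.run_bind, ih fun j' h => hs j' (by simp [h]), pick,
      PMF.bind_bind, PMF.bind_bind]
    congr 1
    funext L
    rw [PMF.pure_bind, bind_assoc, Game.run_sample_bind, PMF.bind_bind]
    congr 1
    funext b
    rw [PMF.pure_bind, LawfulMonad.pure_bind]
    cases b
    · rfl
    · simp only [Data.isNil_ofBool, Bool.not_true, Bool.false_eq_true, if_false, if_true]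
      rw [Game.run_bind, hO.secKey _ { s with dkAsked := L.toFinset ∪ s.dkAsked } hc, Data.hd_cons, Data.toNat_ofNat,
        Game.run_bind_of_pure (M.run_detKeys_of_some
          (s := { s with dkAsked := L.toFinset ∪ s.dkAsked }) (hs j (by simp))),
        Game.run_modify_bind,
        Game.run_pure, PMF.pure_bind, Game.run_pure]
      simp [secData, Finset.insert_union]

/-- The run of `prepare` on an honest oracle. -/
theorem Serves.run_prepare {K : Setting Model} {c : K.Idx} (hO : M.Serves κ pp (K.oracle c))
    {fam : PPT Model} {x : Data} {i : ℕ} {S : Finset ℕ} {p : Data}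
    (hfam : fam.eval x.hd = PMF.pure (Data.tuple [Data.ofNat i, Data.ofFinset S, p])) :
    (prepare K fam c x).run (GameState.init V) =
      (M.watSample κ pp).bind fun w => (M.detSample κ pp (S.sort (· ≤ ·))).bind fun d =>
      (pick (S.sort (· ≤ ·))).bind fun L => PMF.pure
        (Data.cons (Data.tuple [Data.ofNat i, Data.ofFinset S, p]) (Data.cons w.1
          (Data.cons (pubData d (S.sort (· ≤ ·)))
            (Data.cons (Data.ofList (L.map Data.ofNat)) (secData d L)))),
        { keyState i (S.sort (· ≤ ·)) w d with dkAsked := L.toFinset }) := by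
  have hfold : ∀ acc : Data, Data.foldM (fun j acc => K.oracle c (Data.cons (Data.ofNat 3) j) >>=
      fun a => pure (Data.cons (Data.cons j a) acc)) (Data.ofFinset S) acc =
      (S.sort (· ≤ ·)).foldlM (fun acc j => M.detKeys κ pp j >>= fun k =>
        pure (Data.cons (Data.cons (Data.ofNat j) k.1) acc)) acc := by
    intro acc
    rw [Data.foldM_eq, Data.ofFinset, Data.toList_ofList, List.foldlM_map]
    simp only [hO.detPub, Data.toNat_ofNat, bind_assoc, LawfulMonad.pure_bind]
  rw [prepare, hfam, Game.run_sample_bind, PMF.pure_bind, Game.run_bind, hO.watPub]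
  simp only [Data.tuple, Data.ofList_cons, Data.hd_cons, Data.tl_cons, Data.toNat_ofNat]
  rw [Game.run_bind, M.run_watKeys_of_none rfl, PMF.bind_bind, PMF.bind_bind]
  congr 1
  funext w
  rw [PMF.pure_bind, Game.run_pure, PMF.pure_bind, hfold, Game.run_bind,
    M.run_foldlM_detKeys (fun j k acc => Data.cons (Data.cons (Data.ofNat j) k.1) acc) _
      (S.sort_nodup _) _ (fun _ _ => rfl), PMF.bind_bind]
  congr 1
  funext d
  rw [PMF.pure_bind, Data.foldM_pure, LawfulMonad.pure_bind]
  have h1 : (S.sort (· ≤ ·)).foldl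
      (fun acc j => Data.cons (Data.cons (Data.ofNat j) (d j).1) acc) Data.nil =
      Data.ofList ((S.sort (· ≤ ·)).map fun j => Data.cons (Data.ofNat j) (d j).1).reverse := by
    have := Data.foldl_cons (fun a => a)
      ((S.sort (· ≤ ·)).map fun j => Data.cons (Data.ofNat j) (d j).1) []
    simpa [List.foldl_map, Function.comp_def] using this
  have h2 := Data.foldl_cons (fun a => a)
      ((S.sort (· ≤ ·)).map fun j => Data.cons (Data.ofNat j) (d j).1).reverse []
  simp only [Data.ofList_nil, List.map_id_fun', _root_.id, List.reverse_reverse,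
    List.append_nil] at h2
  simp only [h1, Data.toList_ofList, h2, Data.foldM_eq]
  rw [Game.run_bind, hO.run_pick _ d _ (fun j hj => by simp only [hj, if_true]) rfl,
    PMF.bind_bind]
  congr 1
  funext L
  rw [PMF.pure_bind]
  simp [pubData, keyState, GameState.init]
  rfl

end Scheme

theorem expect_result {α : Type} (g : Game V α) (f : α → ℝ≥0∞) :
    expect (Game.result g) f = expect (g.run (GameState.init V)) fun r => f r.1 :=
  expect_map _ _ _

theorem expect_bool (μ : PMF Bool) (f : Bool → ℝ≥0∞) :
    expect μ f = μ true * f true + μ false * f false := by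
  rw [expect, tsum_bool, add_comm]

theorem PMF.true_add_false (μ : PMF Bool) : μ true + μ false = 1 := by
  rw [← μ.tsum_coe, tsum_bool, add_comm]

/-! ### Games as averages over honest keys -/

namespace Scheme

variable (M : Scheme Model) (κ : ℕ)

/-- The average over honest keys. -/
noncomputable def avg (S : Finset ℕ)
    (f : Data → Data × Data → (ℕ → Data × Data) → ℝ≥0∞) : ℝ≥0∞ :=
  expect (M.setup.eval (Data.ofNat κ)) fun pp => expect (M.watSample κ pp) fun w =>
    expect (M.detSample κ pp (S.sort (· ≤ ·))) fun d => f pp w d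

/-- The distribution of watermarked texts for given keys. -/
noncomputable def markDist (pp : Data) (w : Data × Data) (d : ℕ → Data × Data) (S : Finset ℕ)
    (p : Text V) : PMF (Text V) :=
  M.watMar (Data.tuple [Data.ofNat κ, pp, w.2, pubData d (S.sort (· ≤ ·)), Data.ofText p])

/-- The distribution of forged texts for given keys. -/
noncomputable def forgeDist (F : PPT Model) (pp : Data) (w : Data × Data) (d : ℕ → Data × Data)
    (S : Finset ℕ) (L : List ℕ) (p : Text V) : PMF (Text V) :=
  (F.eval (Data.tuple [Data.ofNat κ, pp, w.1, pubData d (S.sort (· ≤ ·)), secData d L,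
    Data.ofText p])).map (Data.toText V)

/-- The verdict of detector `j` for given keys. -/
noncomputable def opinion (pp : Data) (w : Data × Data) (d : ℕ → Data × Data) (S : Finset ℕ)
    (t : Text V) (j : ℕ) : PMF Bool :=
  M.verdict κ pp w.1 (d j).2 (pubData d (S.sort (· ≤ ·))) t

variable {M κ} {S : Finset ℕ}

theorem avg_mono {f g : Data → Data × Data → (ℕ → Data × Data) → ℝ≥0∞}
    (h : ∀ pp w d, f pp w d ≤ g pp w d) : M.avg κ S f ≤ M.avg κ S g :=
  expect_mono fun pp _ => expect_mono fun w _ => expect_mono fun d _ => h pp w d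

theorem avg_add (f g : Data → Data × Data → (ℕ → Data × Data) → ℝ≥0∞) :
    M.avg κ S (fun pp w d => f pp w d + g pp w d) = M.avg κ S f + M.avg κ S g := by
  simp only [avg, expect_add]

theorem avg_const (c : ℝ≥0∞) : M.avg κ S (fun _ _ _ => c) = c := by
  simp only [avg, expect_const]

theorem avg_sum {ι : Type} (s : Finset ι)
    (f : ι → Data → Data × Data → (ℕ → Data × Data) → ℝ≥0∞) :
    M.avg κ S (fun pp w d => ∑ j ∈ s, f j pp w d) = ∑ j ∈ s, M.avg κ S (f j) := by
  simp only [avg, expect_sum]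

variable (M) {pp : Data} {i : ℕ} {p : Text V} {w : Data × Data} {d : ℕ → Data × Data}

theorem run_mark_init :
    (M.mark κ pp i S p).run (GameState.init V) = (M.watSample κ pp).bind fun w =>
      (M.detSample κ pp (S.sort (· ≤ ·))).bind fun d => (M.markDist κ pp w d S p).bind fun t =>
        PMF.pure (t, keyState i (S.sort (· ≤ ·)) w d) := by
  rw [mark, Game.run_bind, M.run_watKeys_of_none rfl, PMF.bind_bind]
  congr 1
  funext w
  rw [PMF.pure_bind, Game.run_bind, M.run_pubKeys_of_none fun _ _ => rfl, PMF.bind_bind]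
  congr 1
  funext d
  rw [PMF.pure_bind, Game.run_sample]
  rfl

section Known

variable {s : GameState V} (hw : s.wk i = some w) (hd : ∀ j ∈ S, s.dk j = some (d j))

include hw hd

theorem run_mark :
    (M.mark κ pp i S p).run s = (M.markDist κ pp w d S p).bind fun t => PMF.pure (t, s) := by
  rw [mark, Game.run_bind_of_pure (M.run_watKeys_of_some hw),
    Game.run_bind_of_pure (M.run_pubKeys_of_some hd), Game.run_sample]
  rfl

theorem run_forge (F : PPT Model) {L : List ℕ} (hL : L.Sublist (S.sort (· ≤ ·))) :
    (M.forge κ pp F i S L.toFinset p).run s =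
      (forgeDist κ F pp w d S L p).bind fun t => PMF.pure (t, s) := by
  -- A sublist of an increasing list is increasing, so the simulator in the oracle sees the same key
  -- list as the forger supplies.
  have hLs : L.toFinset.sort (· ≤ ·) = L :=
    (List.toFinset_sort (· ≤ ·) ((S.sort_nodup _).sublist hL)).2
      ((S.pairwise_sort (· ≤ ·)).sublist hL)
  have hLS : ∀ j ∈ L.toFinset, s.dk j = some (d j) := fun j hj =>
    hd j ((Finset.mem_sort _).1 (hL.subset (List.mem_toFinset.1 hj)))
  rw [forge, Game.run_bind_of_pure (M.run_watKeys_of_some hw),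
    Game.run_bind_of_pure (M.run_pubKeys_of_some hd),
    Game.run_bind_of_pure (M.run_secKeys_of_some hLS), Game.run_sample_bind, hLs, forgeDist,
    PMF.bind_map]
  rfl

theorem run_examine {j : ℕ} (hj : j ∈ S) (t : Text V) :
    (M.examine κ pp i j S t).run s =
      (M.opinion κ pp w d S t j).bind fun b => PMF.pure (b, s) := by
  rw [examine, Game.run_bind_of_pure (M.run_watKeys_of_some hw),
    Game.run_bind_of_pure (M.run_detKeys_of_some (hd j hj)),
    Game.run_bind_of_pure (M.run_pubKeys_of_some hd), Game.run_sample]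
  rfl

/-- Once all keys exist, an examination leaves the state alone, so the verdicts are independent and
the probability that nobody accepts is a product. -/
theorem expect_mapM_examine (t : Text V) (l : List ℕ) (hl : ∀ j ∈ l, j ∈ S) :
    expect ((l.mapM fun j => M.examine κ pp i j S t).run s)
      (fun r => if true ∈ r.1 then 0 else 1) =
      (l.map fun j => M.opinion κ pp w d S t j false).prod := by
  induction l with
  | nil => simp [expect_pure_do]
  | cons j l ih =>
    rw [List.mapM_cons, Game.run_bind, M.run_examine hw hd (hl j (by simp)), PMF.bind_bind,
      expect_bind, expect_bool, List.map_cons, List.prod_cons,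
      ← ih fun j' h => hl j' (by simp [h])]
    simp only [PMF.pure_bind, Game.run_bind, Game.run_pure, expect_bind, expect_pure]
    simp [expect_const]

end Known

theorem keyState_wk (l : List ℕ) :
    (keyState i l w d : GameState V).wk i = some w := by
  simp [keyState]

theorem keyState_dk {j : ℕ} (hj : j ∈ S) :
    (keyState i (S.sort (· ≤ ·)) w d : GameState V).dk j = some (d j) := by
  simp [keyState, hj]

theorem expect_generate (W : M.Watermark) (f : Text V × List Bool → ℝ≥0∞) :
    expect (W.generate κ i S p) f = M.avg κ S fun pp w d =>
      expect (M.markDist κ pp w d S p) fun t =>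
        f (t, W.extract κ pp w.1 (pubData d (S.sort (· ≤ ·))) t) := by
  rw [Watermark.generate, expect_do, avg]
  refine expect_congr fun pp _ => ?_
  rw [expect_result, Game.run_bind, run_mark_init]
  simp only [expect_bind, expect_pure]
  refine expect_congr fun w _ => expect_congr fun d _ => expect_congr fun t _ => ?_
  rw [Game.run_bind_of_pure (M.run_watKeys_of_some (keyState_wk _)),
    Game.run_bind_of_pure (M.run_pubKeys_of_some fun j hj => keyState_dk hj), Game.run_pure,
    expect_pure]

theorem expect_completenessGame {j : ℕ} (hj : j ∈ S) (f : Text V × Bool → ℝ≥0∞) :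
    expect (M.completenessGame κ i j S p) f = M.avg κ S fun pp w d =>
      expect (M.markDist κ pp w d S p) fun t =>
        expect (M.opinion κ pp w d S t j) fun b => f (t, b) := by
  rw [completenessGame, expect_do, avg]
  refine expect_congr fun pp _ => ?_
  rw [expect_result, Game.run_bind, run_mark_init]
  simp only [expect_bind, expect_pure]
  refine expect_congr fun w _ => expect_congr fun d _ => expect_congr fun t _ => ?_
  rw [Game.run_bind, M.run_examine (keyState_wk _) (fun j hj => keyState_dk hj) hj]
  simp only [expect_bind, expect_pure, Game.run_pure]

/-- The probability that all detectors in `C` accept. -/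
noncomputable def allAccept (κ : ℕ) (pp : Data) (w : Data × Data) (d : ℕ → Data × Data)
    (S : Finset ℕ) (t : Text V) (C : Finset ℕ) : ℝ≥0∞ :=
  ∏ j ∈ C, M.opinion κ pp w d S t j true

/-- The probability that all detectors in `C` reject. -/
noncomputable def allReject (κ : ℕ) (pp : Data) (w : Data × Data) (d : ℕ → Data × Data)
    (S : Finset ℕ) (t : Text V) (C : Finset ℕ) : ℝ≥0∞ :=
  ∏ j ∈ C, M.opinion κ pp w d S t j false

open Classical in
/-- The event that a text is long and has a short watermark. -/
noncomputable def longShort {M : Scheme Model} (W : M.Watermark) (δ : ℕ → ℕ → ℕ) (κ : ℕ) (pp : Data)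
    (w : Data × Data) (d : ℕ → Data × Data) (S : Finset ℕ) (t : Text V) : ℝ≥0∞ :=
  if δ κ S.card ≤ t.length ∧
    2 * (W.extract κ pp w.1 (pubData d (S.sort (· ≤ ·))) t).length < S.card then 1 else 0

/-- A rejection turns the flag into `nil` for good, so the flag survives exactly if it was set
initially and every independent verdict is positive. -/
theorem expect_foldlM_verdict (wpk D : Data) (t : Text V) (l : List ℕ) (s : GameState V)
    (v : Data) :
    expect (((l.map fun j => Data.cons (Data.ofNat j) (d j).2).foldlM (fun acc e =>
      Game.sample (M.detect.eval (Data.tuple [Data.ofNat κ, pp, wpk, e.tl, D, Data.ofText t]))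
        >>= fun b => if b.isNil then pure Data.nil else pure acc) v).run s)
      (fun r => if r.1.toBool then 1 else 0) =
      (if v.toBool then 1 else 0) *
        (l.map fun j => M.verdict κ pp wpk (d j).2 D t true).prod := by
  induction l generalizing v with
  | nil => simp [expect_pure_do]
  | cons j l ih =>
    rw [List.map_cons, List.foldlM_cons, bind_assoc, Game.run_sample_bind, expect_bind]
    have : ∀ b : Data, ((if b.isNil then pure Data.nil else pure v : Game V Data) >>= fun acc =>
        (l.map fun j => Data.cons (Data.ofNat j) (d j).2).foldlM (fun acc e =>
        Game.sample (M.detect.eval (Data.tuple [Data.ofNat κ, pp, wpk, e.tl, D, Data.ofText t]))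
        >>= fun b => if b.isNil then pure Data.nil else pure acc) acc) =
        (l.map fun j => Data.cons (Data.ofNat j) (d j).2).foldlM (fun acc e =>
        Game.sample (M.detect.eval (Data.tuple [Data.ofNat κ, pp, wpk, e.tl, D, Data.ofText t]))
        >>= fun b => if b.isNil then pure Data.nil else pure acc)
          (if b.toBool then v else Data.nil) := by
      intro b
      cases b <;> simp [Data.toBool]
    simp only [this, ih]
    have hmap := expect_map (M.detect.eval (Data.tuple [Data.ofNat κ, pp, wpk,
      (Data.cons (Data.ofNat j) (d j).2).tl, D, Data.ofText t])) Data.toBool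
      (fun b => (if (if b then v else Data.nil).toBool then 1 else 0) *
        (l.map fun j => M.verdict κ pp wpk (d j).2 D t true).prod)
    rw [← hmap, List.map_cons, List.prod_cons]
    change expect (M.verdict κ pp wpk (d j).2 D t) _ = _
    rw [expect_bool]
    simp only [if_true, Bool.false_eq_true, if_false,
      show Data.nil.toBool = false from rfl, zero_mul, mul_zero, add_zero]
    ring

/-- Threshold and watermark are computed deterministically, so only the verdicts contribute
randomness. -/
theorem expect_inspect {δ : ℕ → ℕ → ℕ} {thr : PPT Model}
    (hthr : ∀ κ n, thr.eval (Data.tuple [Data.ofNat κ, Data.ofNat n]) =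
      PMF.pure (Data.ofNat (δ κ n)))
    (W : M.Watermark) {L : List ℕ} (hL : L.Nodup) (t : Text V) (s : GameState V) (C : Data) :
    expect ((inspect thr W.alg M.detect (Data.tuple [Data.ofNat κ, pp])
      (Data.cons (Data.tuple [Data.ofNat i, Data.ofFinset S, Data.ofText p])
        (Data.cons w.1 (Data.cons (pubData d (S.sort (· ≤ ·))) (Data.cons C (secData d L)))))
      (Data.ofText t)).run s) (fun r => if r.1.toBool then 1 else 0) =
      longShort W δ κ pp w d S t * M.allAccept κ pp w d S t L.toFinset := by
  have hn := Data.foldl_cons_nil (Data.ofFinset S).toList 0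
  rw [show Data.ofNat 0 = Data.nil from rfl, zero_add] at hn
  have hlen : (Data.ofFinset S).toList.length = S.card := by simp [Data.ofFinset]
  have htl : (Data.ofText t).toList.length = t.length := by simp [Data.ofText_eq]
  have hwl : ∀ u, (Data.ofBits u).toList.length = u.length := by simp [Data.ofBits]
  rw [inspect, Data.foldM_pure, LawfulMonad.pure_bind]
  simp only [Data.tuple, Data.ofList_cons, Data.ofList_nil, Data.hd_cons, Data.tl_cons, hn, hlen]
  have h1 := hthr κ S.card
  have h2 := W.alg_spec κ pp w.1 (pubData d (S.sort (· ≤ ·))) t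
  simp only [Data.tuple, Data.ofList_cons, Data.ofList_nil] at h1 h2
  rw [h1, h2, Game.run_sample_bind, PMF.pure_bind, Game.run_sample_bind, PMF.pure_bind,
    Data.foldM_pure, LawfulMonad.pure_bind, Data.foldM_pure, LawfulMonad.pure_bind]
  set u := W.extract κ pp w.1 (pubData d (S.sort (· ≤ ·))) t with hu
  have hl := Data.isNil_foldl_tl (Data.ofText t).toList (Data.ofNat (δ κ S.card))
  have hs := Data.isNil_foldl_tl_tl (Data.ofBits u).toList (Data.ofFinset S)
  rw [Data.length_toList_ofNat, htl] at hl
  rw [hlen, hwl] at hs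
  simp only [hl, hs]
  have hv : (if δ κ S.card ≤ t.length then
      if S.card ≤ 2 * u.length then (pure Data.nil : Game V Data)
        else pure (Data.cons Data.nil Data.nil) else pure Data.nil) =
      pure (Data.ofBool (decide (δ κ S.card ≤ t.length ∧ 2 * u.length < S.card))) := by
    by_cases h1 : δ κ S.card ≤ t.length
    · by_cases h2 : S.card ≤ 2 * u.length
      · simp [h1, h2, Data.ofBool, not_lt.2 h2]
      · simp [h1, h2, Data.ofBool, not_le.1 h2]
    · simp [h1, Data.ofBool]
  rw [hv, LawfulMonad.pure_bind, Data.foldM_eq, secData, Data.toList_ofList]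
  have key := M.expect_foldlM_verdict (κ := κ) (pp := pp) (d := d) w.1
    (pubData d (S.sort (· ≤ ·))) t L s
    (Data.ofBool (decide (δ κ S.card ≤ t.length ∧ 2 * u.length < S.card)))
  simp only [Data.tuple, Data.ofList_cons, Data.ofList_nil] at key
  rw [key, allAccept, List.prod_toFinset _ hL]
  simp [longShort, opinion, hu]

end Scheme

theorem Meets.expect_run {I : GameState V → Prop} {T : ℕ} {a : Game V (Data × ℕ)} {b : Game V Data}
    (h : Meets I T a b) {s : GameState V} (hs : I s) (f : Data × GameState V → ℝ≥0∞) :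
    expect (a.run s) (fun r => f (r.1.1, r.2)) = expect (b.run s) f := by
  rw [← (h s hs).1, expect_map]

/-! ### Success probabilities of the two adversaries -/

namespace Scheme

variable (M : Scheme Model) {κ : ℕ} {pp : Data} {i : ℕ} {p : Text V} {S : Finset ℕ}

/-- The running time, in terms of the security parameter, of an adversary whose running time in
terms of its input is bounded by `q`. -/
noncomputable def gameTime (q : Polynomial ℕ) : Polynomial ℕ :=
  q.comp (3 * Polynomial.X + 2 * M.setup.bound.comp (2 * Polynomial.X + 1) + 4)

theorem le_gameTime (q : Polynomial ℕ) (hpp : pp ∈ (M.setup.eval (Data.ofNat κ)).support) :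
    q.eval (κ + pp.size + (Data.tuple [Data.ofNat κ, pp]).size) ≤ (M.gameTime q).eval κ := by
  have h := M.setup.size_le_of_mem_support hpp
  simp only [Data.size_ofNat] at h
  simp only [gameTime, Polynomial.eval_comp, Polynomial.eval_add, Polynomial.eval_mul,
    Polynomial.eval_X, Polynomial.eval_ofNat, Polynomial.eval_one]
  refine eval_le_eval q ?_
  rw [size_setup_input]
  omega

theorem keysBounded_init (B : ℕ) : KeysBounded B (GameState.init V) := by
  constructor <;> intro i k h <;> cases h

theorem meets_sound {A : Prog} {q : Polynomial ℕ} {g : ℕ × Data → Data → Game V Data}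
    (hA : Implements M.soundSetting A q g) (hpp : pp ∈ (M.setup.eval (Data.ofNat κ)).support) :
    Meets (KeysBounded (M.keyBound κ pp)) ((M.gameTime q).eval κ)
      (A.run (gameEnv Model (M.soundOracle κ pp)) ((M.gameTime q).eval κ + 1)
        (Data.tuple [Data.ofNat κ, pp])) (g (κ, pp) (Data.tuple [Data.ofNat κ, pp])) :=
  (hA (κ, pp) _ _ ((M.le_gameTime q hpp).trans (Nat.le_succ _))).mono (M.le_gameTime q hpp)

theorem meets_otr {F : PPT Model} {A : Prog} {q : Polynomial ℕ}
    {g : ℕ × Data × Bool → Data → Game V Data}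
    (hA : Implements (M.otrSetting F) A q g) (hpp : pp ∈ (M.setup.eval (Data.ofNat κ)).support)
    (b : Bool) :
    Meets (KeysBounded (M.keyBound κ pp)) ((M.gameTime q).eval κ)
      (A.run (gameEnv Model (M.otrOracle κ pp F b)) ((M.gameTime q).eval κ + 1)
        (Data.tuple [Data.ofNat κ, pp])) (g (κ, pp, b) (Data.tuple [Data.ofNat κ, pp])) :=
  (hA (κ, pp, b) _ _ ((M.le_gameTime q hpp).trans (Nat.le_succ _))).mono (M.le_gameTime q hpp)

theorem soundGame_steps {k : ℕ} {A : Prog} {q : Polynomial ℕ} {g : ℕ × Data → Data → Game V Data}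
    (hA : Implements M.soundSetting A q g) (r : Bool × ℕ)
    (hr : r ∈ (M.soundGame κ k A ((M.gameTime q).eval κ + 1)).support) :
    r.2 ≤ (M.gameTime q).eval κ := by
  obtain ⟨pp, hpp, hr⟩ := PMF.mem_support_do.1 hr
  obtain ⟨r', hr', rfl⟩ := (PMF.mem_support_map_iff _ _ _).1 hr
  obtain ⟨a, ha, hr'⟩ := PMF.mem_support_do.1 hr'
  obtain ⟨s, -, hr'⟩ := PMF.mem_support_do.1 hr'
  obtain ⟨v, -, hr'⟩ := PMF.mem_support_do.1 hr'
  rw [(PMF.mem_support_pure_iff _ _).1 hr']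
  exact ((M.meets_sound hA hpp _ (keysBounded_init _)).2 a ha).1

theorem otrGame_steps {F : PPT Model} {A : Prog} {q : Polynomial ℕ}
    {g : ℕ × Data × Bool → Data → Game V Data} (hA : Implements (M.otrSetting F) A q g)
    (r : Bool × ℕ) (hr : r ∈ (M.otrGame κ F A ((M.gameTime q).eval κ + 1)).support) :
    r.2 ≤ (M.gameTime q).eval κ := by
  obtain ⟨pp, hpp, hr⟩ := PMF.mem_support_do.1 hr
  obtain ⟨b, -, hr⟩ := PMF.mem_support_do.1 hr
  obtain ⟨r', hr', rfl⟩ := (PMF.mem_support_map_iff _ _ _).1 hr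
  obtain ⟨a, ha, hr'⟩ := PMF.mem_support_do.1 hr'
  rw [(PMF.mem_support_pure_iff _ _).1 hr']
  exact ((M.meets_otr hA hpp b _ (keysBounded_init _)).2 a ha).1

theorem expect_verdicts {w : Data × Data} {d : ℕ → Data × Data} {s : GameState V}
    (hw : s.wk i = some w) (hd : ∀ j ∈ S, s.dk j = some (d j)) (t : Text V) (C : Finset ℕ) :
    expect ((((S.sort (· ≤ ·)).filter fun j => j ∉ C).mapM fun j =>
      M.examine κ pp i j S t).run s) (fun r => if true ∈ r.1 then 1 else 0) =
      1 - M.allReject κ pp w d S t (S \ C) := by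
  have h := M.expect_mapM_examine hw hd (κ := κ) (pp := pp) t
    ((S.sort (· ≤ ·)).filter fun j => j ∉ C) (fun j hj => by
      simpa using (List.mem_filter.1 hj).1)
  rw [← List.prod_toFinset _ ((S.sort_nodup _).filter _)] at h
  have hS : ((S.sort (· ≤ ·)).filter fun j => j ∉ C).toFinset = S \ C := by
    ext j; simp
  rw [hS] at h
  change _ = M.allReject κ pp w d S t (S \ C) at h
  rw [← h]
  refine ENNReal.eq_sub_of_add_eq ?_ ?_
  · refine ne_top_of_le_ne_top ENNReal.one_ne_top (expect_le_of_le fun a _ => ?_)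
    split <;> simp
  · rw [← expect_add]
    refine (expect_congr fun a _ => ?_).trans (expect_const _ 1)
    split <;> simp

open Classical in
-- The forger never asks for a watermarked text or a provider's secret key, so the overlap condition
-- is void for every `k` and the provider's key remains unasked. The detector keys it asked for are
-- exactly those in `L`, so it wins exactly when somebody in `S \ L` accepts.
theorem expect_soundGame {k : ℕ} {A : Prog} {q : Polynomial ℕ} {fam F : PPT Model}
    (hA : Implements M.soundSetting A q (forger M.soundSetting fam F))
    (hfam : fam.eval (Data.ofNat κ) =
      PMF.pure (Data.tuple [Data.ofNat i, Data.ofFinset S, Data.ofText p])) :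
    expect (M.soundGame κ k A ((M.gameTime q).eval κ + 1)) (fun r => if r.1 = true then 1 else 0) =
      M.avg κ S fun pp w d => expect (pick (S.sort (· ≤ ·))) fun L =>
        expect (forgeDist κ F pp w d S L p) fun t =>
          1 - M.allReject κ pp w d S t (S \ L.toFinset) := by
  rw [soundGame, expect_do, avg]
  refine expect_congr fun pp hpp => ?_
  have hO := M.serves_soundOracle (κ := κ) (pp := pp)
  have hprep := Serves.run_prepare (K := M.soundSetting) (c := (κ, pp)) hO
    (x := Data.tuple [Data.ofNat κ, pp]) hfam
  rw [expect_result, Game.run_bind, expect_bind]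
  simp only [Game.run_bind, Game.run_get, Game.run_pure, expect_bind, expect_pure]
  -- The rest of the game depends only on the adversary's output and the final state, so the program
  -- may be replaced by `forger`.
  refine ((M.meets_sound hA hpp).expect_run (keysBounded_init _) (fun z : Data × GameState V =>
    expect (StateT.run (List.mapM (fun j => M.examine κ pp z.1.hd.toNat j z.1.tl.hd.toFinset
      (z.1.tl.tl.toText V)) ((z.1.tl.hd.toFinset.sort (· ≤ ·)).filter fun j => j ∉ z.2.dkAsked)) z.2)
      fun v => if decide (z.1.hd.toNat ∉ z.2.wkAsked ∧ NoOverlap k (z.1.tl.tl.toText V)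
        ((z.2.marked.filter fun e => e.1 = z.1.hd.toNat ∧ e.2.1 = z.1.tl.hd.toFinset).map
          fun e => e.2.2) ∧ true ∈ v.1) = true then 1 else 0)).trans ?_
  rw [forger, Game.run_bind, hprep]
  simp only [expect_bind, expect_pure]
  refine expect_congr fun w _ => expect_congr fun d _ => expect_congr fun L _ => ?_
  rw [Game.run_sample_bind, expect_bind, forgeDist, expect_map]
  simp only [Game.run_pure, expect_pure, Data.tuple, Data.ofList_cons, Data.ofList_nil,
    Data.hd_cons, Data.tl_cons, Data.toNat_ofNat, Data.toFinset_ofFinset]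
  refine expect_congr fun y _ => ?_
  have hw : (keyState i (S.sort (· ≤ ·)) w d : GameState V).wk i = some w := keyState_wk _
  have hd : ∀ j ∈ S, (keyState i (S.sort (· ≤ ·)) w d : GameState V).dk j = some (d j) :=
    fun j hj => keyState_dk hj
  rw [← M.expect_verdicts (i := i) (s := { keyState i (S.sort (· ≤ ·)) w d with
    dkAsked := L.toFinset }) hw hd]
  refine expect_congr fun v _ => ?_
  simp [keyState, GameState.init, NoOverlap]

/-- The distribution of the challenge text. -/
noncomputable def challengeDist (κ : ℕ) (F : PPT Model) (b : Bool) (pp : Data) (w : Data × Data)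
    (d : ℕ → Data × Data) (S : Finset ℕ) (L : List ℕ) (p : Text V) : PMF (Text V) :=
  bif b then forgeDist κ F pp w d S L p else M.markDist κ pp w d S p

/-- The challenge is admissible because the secret keys asked for so far are exactly those of the
corrupted subset. -/
theorem run_challenge {F : PPT Model} {b : Bool} {w : Data × Data} {d : ℕ → Data × Data}
    {L : List ℕ} (hL : L.Sublist (S.sort (· ≤ ·))) :
    (M.otrOracle κ pp F b (Data.cons (Data.ofNat 4) (Data.cons (Data.ofNat i)
      (Data.cons (Data.ofFinset S) (Data.cons (Data.ofList (L.map Data.ofNat))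
        (Data.ofText p)))))).run
      { keyState i (S.sort (· ≤ ·)) w d with dkAsked := L.toFinset } =
    (M.challengeDist κ F b pp w d S L p).bind fun t => PMF.pure (Data.ofText t,
      { keyState i (S.sort (· ≤ ·)) w d with
        dkAsked := L.toFinset
        challenged := [(i, S, L.toFinset, t)] }) := by
  have hC : (Data.ofList (L.map Data.ofNat)).toFinset = L.toFinset := by
    simp [Data.toFinset, Function.comp_def]
  have hLS : L.toFinset ⊆ S := fun j hj =>
    (Finset.mem_sort _).1 (hL.subset (List.mem_toFinset.1 hj))
  rw [otrOracle_challenge, Game.run_get_bind]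
  simp only [Data.hd_cons, Data.tl_cons, Data.toNat_ofNat, Data.toFinset_ofFinset,
    Data.toText_ofText, hC]
  have hw : (keyState i (S.sort (· ≤ ·)) w d : GameState V).wk i = some w := keyState_wk _
  have hd : ∀ j ∈ S, (keyState i (S.sort (· ≤ ·)) w d : GameState V).dk j = some (d j) :=
    fun j hj => keyState_dk hj
  rw [if_pos ⟨hLS, by simp [keyState, GameState.init], Finset.sdiff_disjoint⟩]
  have key : ((bif b then M.forge κ pp F i S L.toFinset p else M.mark κ pp i S p).run
      { keyState i (S.sort (· ≤ ·)) w d with dkAsked := L.toFinset }) =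
      (M.challengeDist κ F b pp w d S L p).bind fun t => PMF.pure (t,
        { keyState i (S.sort (· ≤ ·)) w d with dkAsked := L.toFinset }) := by
    cases b
    · exact M.run_mark (s := { keyState i (S.sort (· ≤ ·)) w d with dkAsked := L.toFinset }) hw hd
    · exact M.run_forge (s := { keyState i (S.sort (· ≤ ·)) w d with dkAsked := L.toFinset }) hw hd
        F hL
  rw [Game.run_bind, key, PMF.bind_bind]
  congr 1
  funext t
  rw [PMF.pure_bind, Game.run_modify_bind]
  rfl

/-- The probability that the distinguisher outputs `1`. -/
noncomputable def alarm {M : Scheme Model} (W : M.Watermark) (δ : ℕ → ℕ → ℕ) (κ : ℕ) (F : PPT Model)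
    (b : Bool) (S : Finset ℕ) (p : Text V) : ℝ≥0∞ :=
  M.avg κ S fun pp w d => expect (pick (S.sort (· ≤ ·))) fun L =>
    expect (M.challengeDist κ F b pp w d S L p) fun t =>
      longShort W δ κ pp w d S t * M.allAccept κ pp w d S t L.toFinset

theorem expect_distinguisher {fam F thr : PPT Model} {δ : ℕ → ℕ → ℕ}
    (hthr : ∀ κ n, thr.eval (Data.tuple [Data.ofNat κ, Data.ofNat n]) =
      PMF.pure (Data.ofNat (δ κ n))) (W : M.Watermark)
    (hfam : fam.eval (Data.ofNat κ) =
      PMF.pure (Data.tuple [Data.ofNat i, Data.ofFinset S, Data.ofText p])) (b : Bool) :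
    (expect (M.setup.eval (Data.ofNat κ)) fun pp =>
      expect ((distinguisher (M.otrSetting F) fam thr W.alg M.detect (κ, pp, b)
        (Data.tuple [Data.ofNat κ, pp])).run (GameState.init V))
        fun r => if r.1.toBool then 1 else 0) = alarm W δ κ F b S p := by
  rw [alarm, avg]
  refine expect_congr fun pp _ => ?_
  have hO := M.serves_otrOracle (κ := κ) (pp := pp) F b
  have hprep := Serves.run_prepare (K := M.otrSetting F) (c := (κ, pp, b)) hO
    (x := Data.tuple [Data.ofNat κ, pp]) hfam
  rw [distinguisher, Game.run_bind, hprep]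
  simp only [expect_bind, expect_pure]
  refine expect_congr fun w _ => expect_congr fun d _ => expect_congr fun L hL => ?_
  have hL := sublist_of_mem_support_pick hL
  have hch := M.run_challenge (κ := κ) (pp := pp) (i := i) (p := p) (F := F) (b := b) (w := w)
    (d := d) hL
  rw [Game.run_bind]
  simp only [Data.tuple, Data.ofList_cons, Data.ofList_nil, Data.hd_cons, Data.tl_cons]
  rw [hch, PMF.bind_bind, expect_bind]
  refine expect_congr fun t _ => ?_
  rw [PMF.pure_bind]
  exact M.expect_inspect hthr W ((S.sort_nodup _).sublist hL) t _ _

/-- An alarm counts as the guess that the text is forged, so the advantage over `1/2` is half the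
difference of the two alarm probabilities. -/
theorem expect_otrGame {fam F thr : PPT Model} {δ : ℕ → ℕ → ℕ}
    (hthr : ∀ κ n, thr.eval (Data.tuple [Data.ofNat κ, Data.ofNat n]) =
      PMF.pure (Data.ofNat (δ κ n))) (W : M.Watermark)
    (hfam : fam.eval (Data.ofNat κ) =
      PMF.pure (Data.tuple [Data.ofNat i, Data.ofFinset S, Data.ofText p]))
    {A : Prog} {q : Polynomial ℕ}
    (hA : Implements (M.otrSetting F) A q (distinguisher (M.otrSetting F) fam thr W.alg M.detect)) :
    expect (M.otrGame κ F A ((M.gameTime q).eval κ + 1)) (fun r => if r.1 = true then 1 else 0) =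
      2⁻¹ * (alarm W δ κ F true S p + (1 - alarm W δ κ F false S p)) := by
  have hf : 1 - alarm W δ κ F false S p = expect (M.setup.eval (Data.ofNat κ)) fun pp =>
      expect ((distinguisher (M.otrSetting F) fam thr W.alg M.detect (κ, pp, false)
        (Data.tuple [Data.ofNat κ, pp])).run (GameState.init V))
        fun r => if r.1.toBool = false then 1 else 0 := by
    rw [← M.expect_distinguisher hthr W hfam false]
    refine (ENNReal.eq_sub_of_add_eq ?_ ?_).symm
    · refine ne_top_of_le_ne_top ENNReal.one_ne_top
        (expect_le_of_le fun _ _ => expect_le_of_le fun a _ => ?_)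
      split <;> simp
    · rw [← expect_add]
      refine (expect_congr fun pp _ => ?_).trans (expect_const _ 1)
      rw [← expect_add]
      refine (expect_congr fun a _ => ?_).trans (expect_const _ 1)
      cases a.1.toBool <;> simp
  rw [hf, ← M.expect_distinguisher hthr W hfam true, ← expect_add, ← expect_const_mul, otrGame,
    expect_do]
  refine expect_congr fun pp hpp => ?_
  rw [expect_do, expect_fairCoin]
  congr 2
  · rw [expect_result, Game.run_bind, expect_bind]
    simp only [Game.run_pure, expect_pure]
    refine ((M.meets_otr hA hpp true).expect_run (keysBounded_init _)
      (fun z : Data × GameState V => if (z.1.toBool == true) = true then 1 else 0)).trans ?_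
    refine expect_congr fun z _ => ?_
    simp
  · rw [expect_result, Game.run_bind, expect_bind]
    simp only [Game.run_pure, expect_pure]
    refine ((M.meets_otr hA hpp false).expect_run (keysBounded_init _)
      (fun z : Data × GameState V => if (z.1.toBool == false) = true then 1 else 0)).trans ?_
    refine expect_congr fun z _ => ?_
    simp

end Scheme

/-! ### Counting verdict patterns -/

/-- The union bound for independent verdicts: either all of `C` accept or one of them rejects. -/
theorem one_le_prod_add_sum {ι : Type} {a r : ι → ℝ≥0∞} (h : ∀ j, a j + r j = 1)
    (C : Finset ι) : 1 ≤ ∏ j ∈ C, a j + ∑ j ∈ C, r j := by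
  classical
  induction C using Finset.induction_on with
  | empty => simp
  | insert j C hj ih =>
    rw [Finset.prod_insert hj, Finset.sum_insert hj]
    have ha : a j ≤ 1 := (h j) ▸ le_self_add
    calc 1 = a j * 1 + r j := by rw [mul_one, h]
      _ ≤ a j * (∏ j ∈ C, a j + ∑ j ∈ C, r j) + r j := by gcongr
      _ = a j * ∏ j ∈ C, a j + a j * ∑ j ∈ C, r j + r j := by ring
      _ ≤ a j * ∏ j ∈ C, a j + 1 * ∑ j ∈ C, r j + r j := by gcongr
      _ = _ := by ring

/-- Case split on whether everybody outside `C` rejects (probability `r`); the other case is charged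
in full to soundness. -/
theorem mul_le_mul_add_one_sub {x a r : ℝ≥0∞} (hx : x ≤ 1) (ha : a ≤ 1) (hr : r ≤ 1) :
    x * a ≤ x * (a * r) + (1 - r) := by
  have hxa : x * a ≤ 1 := mul_le_one' hx ha
  calc x * a = x * a * (r + (1 - r)) := by rw [add_tsub_cancel_of_le hr, mul_one]
    _ = x * (a * r) + x * a * (1 - r) := by ring
    _ ≤ x * (a * r) + 1 * (1 - r) := by gcongr
    _ = _ := by rw [one_mul]

namespace Scheme

variable {M : Scheme Model} {κ : ℕ} {pp : Data} {w : Data × Data} {d : ℕ → Data × Data}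
  {S : Finset ℕ} {t : Text V}

theorem allAccept_le_one (C : Finset ℕ) : M.allAccept κ pp w d S t C ≤ 1 :=
  Finset.prod_le_one' fun _ _ => PMF.coe_le_one _ _

theorem allReject_le_one (C : Finset ℕ) : M.allReject κ pp w d S t C ≤ 1 :=
  Finset.prod_le_one' fun _ _ => PMF.coe_le_one _ _

theorem longShort_le_one (W : M.Watermark) (δ : ℕ → ℕ → ℕ) :
    longShort W δ κ pp w d S t ≤ 1 := by
  rw [longShort]; split <;> simp

/-- Expand the product over `S` of (accept + reject) `= 1`: the terms are indexed by the set of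
accepting detectors. -/
theorem sum_allAccept_mul_allReject :
    ∑ C ∈ S.powerset, M.allAccept κ pp w d S t C * M.allReject κ pp w d S t (S \ C) = 1 := by
  simp only [allAccept, allReject]
  rw [← Finset.prod_add]
  simp [PMF.true_add_false]

theorem allAccept_congr (W : M.Watermark) {t' : Text V}
    (h : W.extract κ pp w.1 (pubData d (S.sort (· ≤ ·))) t =
      W.extract κ pp w.1 (pubData d (S.sort (· ≤ ·))) t') (C : Finset ℕ) :
    M.allAccept κ pp w d S t C = M.allAccept κ pp w d S t' C := by
  simp only [allAccept, opinion, W.detect_congr _ _ _ _ _ _ h]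

theorem allReject_congr (W : M.Watermark) {t' : Text V}
    (h : W.extract κ pp w.1 (pubData d (S.sort (· ≤ ·))) t =
      W.extract κ pp w.1 (pubData d (S.sort (· ≤ ·))) t') (C : Finset ℕ) :
    M.allReject κ pp w d S t C = M.allReject κ pp w d S t' C := by
  simp only [allReject, opinion, W.detect_congr _ _ _ _ _ _ h]

open Classical in
/-- The probability that the verdicts on a text with watermark `u` are described by `C`. -/
noncomputable def pattern (W : M.Watermark) (κ : ℕ) (pp : Data) (w : Data × Data)
    (d : ℕ → Data × Data) (S : Finset ℕ) (u : List Bool) (C : Finset ℕ) : ℝ≥0∞ :=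
  if h : ∃ t, W.extract κ pp w.1 (pubData d (S.sort (· ≤ ·))) t = u then
    M.allAccept κ pp w d S h.choose C * M.allReject κ pp w d S h.choose (S \ C) else 0

theorem sum_pattern_le (W : M.Watermark) (u : List Bool) :
    ∑ C ∈ S.powerset, pattern W κ pp w d S u C ≤ 1 := by
  by_cases h : ∃ t, W.extract κ pp w.1 (pubData d (S.sort (· ≤ ·))) t = u
  · simp only [pattern, dif_pos h]
    exact sum_allAccept_mul_allReject.le
  · simp [pattern, dif_neg h]

/-- The text chosen in `pattern` is immaterial, since texts with equal watermarks get equal verdict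
distributions. -/
theorem pattern_extract (W : M.Watermark) (t : Text V) (C : Finset ℕ) :
    pattern W κ pp w d S (W.extract κ pp w.1 (pubData d (S.sort (· ≤ ·))) t) C =
      M.allAccept κ pp w d S t C * M.allReject κ pp w d S t (S \ C) := by
  have h : ∃ t', W.extract κ pp w.1 (pubData d (S.sort (· ≤ ·))) t' =
    W.extract κ pp w.1 (pubData d (S.sort (· ≤ ·))) t := ⟨t, rfl⟩
  rw [pattern, dif_pos h, allAccept_congr W h.choose_spec, allReject_congr W h.choose_spec]

/-- The forged text, and with it its watermark, depends on `C`. Passing to the sum over all short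
strings removes this dependence, so that `C` can be averaged for each string separately. -/
theorem longShort_mul_le_sum_pattern (W : M.Watermark) (δ : ℕ → ℕ → ℕ) (C : Finset ℕ) :
    longShort W δ κ pp w d S t *
      (M.allAccept κ pp w d S t C * M.allReject κ pp w d S t (S \ C)) ≤
    ∑ m ∈ Finset.range ((S.card + 1) / 2), ∑ v : Fin m → Bool,
      pattern W κ pp w d S (List.ofFn v) C := by
  rw [longShort]
  split
  · rename_i h
    set u := W.extract κ pp w.1 (pubData d (S.sort (· ≤ ·))) t with hu
    -- A length `m` satisfies `2 m < n` exactly if `m < ⌈n/2⌉ = (n + 1) / 2`.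
    have hm : u.length ∈ Finset.range ((S.card + 1) / 2) := by
      rw [Finset.mem_range]; omega
    rw [one_mul, ← pattern_extract W, ← hu]
    calc pattern W κ pp w d S u C = pattern W κ pp w d S (List.ofFn u.get) C := by
          rw [List.ofFn_get]
      _ ≤ ∑ v : Fin u.length → Bool, pattern W κ pp w d S (List.ofFn v) C :=
          Finset.single_le_sum (f := fun v : Fin u.length → Bool =>
            pattern W κ pp w d S (List.ofFn v) C) (fun _ _ => zero_le) (Finset.mem_univ _)
      _ ≤ _ := Finset.single_le_sum (f := fun m => ∑ v : Fin m → Bool,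
            pattern W κ pp w d S (List.ofFn v) C) (fun _ _ => zero_le) hm
  · simp

/-- A uniformly random `C` matches the verdicts belonging to a fixed string with probability at most
`2⁻ⁿ`, and there are `2^⌈n/2⌉ - 1` strings of length below `⌈n/2⌉`. -/
theorem expect_sum_pattern_le (W : M.Watermark) :
    expect (pick (S.sort (· ≤ ·))) (fun L => ∑ m ∈ Finset.range ((S.card + 1) / 2),
      ∑ v : Fin m → Bool, pattern W κ pp w d S (List.ofFn v) L.toFinset) ≤
      2⁻¹ ^ S.card * ↑(2 ^ ((S.card + 1) / 2) - 1 : ℕ) := by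
  rw [expect_sum]
  simp only [expect_sum]
  have h : ∀ u, expect (pick (S.sort (· ≤ ·))) (fun L => pattern W κ pp w d S u L.toFinset) ≤
      2⁻¹ ^ S.card := by
    intro u
    rw [expect_pick (S.sort_nodup _), Finset.length_sort, Finset.sort_toFinset]
    exact (mul_le_mul_right (sum_pattern_le W u) _).trans_eq (mul_one _)
  refine (Finset.sum_le_sum fun m _ => Finset.sum_le_sum fun v _ => h _).trans_eq ?_
  have hg : ∑ m ∈ Finset.range ((S.card + 1) / 2), 2 ^ m = 2 ^ ((S.card + 1) / 2) - 1 := by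
    rw [Nat.geomSum_eq le_rfl]; simp
  rw [← hg]
  simp only [Finset.sum_const, Finset.card_univ, Fintype.card_fun, Fintype.card_bool,
    Fintype.card_fin, nsmul_eq_mul, ← Finset.sum_mul]
  push_cast
  ring

open Classical in
-- If a forged text raises the alarm, either somebody outside `C` accepts it, and the forger wins
-- the soundness game, or its short watermark encodes `C`.
theorem alarm_true_le {k : ℕ} {A : Prog} {q : Polynomial ℕ} {fam F : PPT Model} {i : ℕ}
    {p : Text V} (hA : Implements M.soundSetting A q (forger M.soundSetting fam F))
    (hfam : fam.eval (Data.ofNat κ) =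
      PMF.pure (Data.tuple [Data.ofNat i, Data.ofFinset S, Data.ofText p]))
    (W : M.Watermark) (δ : ℕ → ℕ → ℕ) :
    alarm W δ κ F true S p ≤ 2⁻¹ ^ S.card * ↑(2 ^ ((S.card + 1) / 2) - 1 : ℕ) +
      expect (M.soundGame κ k A ((M.gameTime q).eval κ + 1))
        (fun r => if r.1 = true then 1 else 0) := by
  rw [M.expect_soundGame hA hfam]
  refine le_trans ?_ (add_le_add (avg_const (M := M) (κ := κ) (S := S) _).le le_rfl)
  rw [← avg_add, alarm]
  refine avg_mono fun pp w d => ?_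
  refine le_trans ?_ (add_le_add_left (expect_sum_pattern_le (κ := κ) (pp := pp) (w := w) (d := d)
    W) _)
  rw [← expect_add]
  refine expect_mono fun L _ => ?_
  rw [← expect_const (forgeDist κ F pp w d S L p) (∑ m ∈ Finset.range ((S.card + 1) / 2),
      ∑ v : Fin m → Bool, pattern W κ pp w d S (List.ofFn v) L.toFinset), ← expect_add]
  refine expect_mono fun t _ => ?_
  exact (mul_le_mul_add_one_sub (longShort_le_one W δ) (allAccept_le_one _)
    (allReject_le_one (S \ L.toFinset))).trans
    (add_le_add_left (longShort_mul_le_sum_pattern W δ _) _)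

theorem alarm_le_one (W : M.Watermark) (δ : ℕ → ℕ → ℕ) (F : PPT Model) (b : Bool) (p : Text V) :
    alarm W δ κ F b S p ≤ 1 := by
  rw [alarm, ← avg_const (M := M) (κ := κ) (S := S) 1]
  exact avg_mono fun pp w d => expect_le_of_le fun L _ => expect_le_of_le fun t _ =>
    mul_le_one' (longShort_le_one W δ) (allAccept_le_one _)

open Classical in
-- A long genuine text with a short watermark raises the alarm unless a detector in `C` rejects it;
-- completeness for all of `S` covers every `C`.
theorem expect_generate_le (W : M.Watermark) (δ : ℕ → ℕ → ℕ) (F : PPT Model) (i : ℕ)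
    (p : Text V) :
    expect (W.generate κ i S p)
      (fun r => if δ κ S.card ≤ r.1.length ∧ 2 * r.2.length < S.card then 1 else 0) ≤
    alarm W δ κ F false S p + ∑ j ∈ S, expect (M.completenessGame κ i j S p)
      (fun r => if δ κ S.card ≤ r.1.length ∧ r.2 = false then 1 else 0) := by
  rw [expect_generate, Finset.sum_congr rfl fun j hj => M.expect_completenessGame hj _,
    ← avg_sum, alarm, ← avg_add]
  refine avg_mono fun pp w d => ?_
  rw [← expect_sum]
  -- Genuine texts do not depend on `C`, so the outer terms may be averaged over `C` as well and the
  -- inequality proved for each `C`.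
  refine le_trans (expect_const (pick (S.sort (· ≤ ·))) _).ge
    (le_trans ?_ (add_le_add le_rfl (expect_const (pick (S.sort (· ≤ ·))) _).le))
  rw [← expect_add]
  refine expect_mono fun L hL => ?_
  rw [challengeDist, cond_false, ← expect_add]
  refine expect_mono fun t _ => ?_
  have hLS : L.toFinset ⊆ S := fun j hj =>
    (Finset.mem_sort _).1 ((sublist_of_mem_support_pick hL).subset (List.mem_toFinset.1 hj))
  change longShort W δ κ pp w d S t ≤ _
  rw [longShort]
  split
  · rename_i h
    rw [one_mul]
    refine (one_le_prod_add_sum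
      (fun j => PMF.true_add_false (M.opinion κ pp w d S t j)) L.toFinset).trans ?_
    refine add_le_add le_rfl ((Finset.sum_le_sum_of_subset hLS).trans_eq ?_)
    refine Finset.sum_congr rfl fun j _ => ?_
    rw [expect_bool]
    simp [h.1]
  · exact zero_le

end Scheme

/-! ### Asymptotics and conclusion -/

theorem Data.lt_size_ofFinset {S : Finset ℕ} {j : ℕ} (hj : j ∈ S) : j < (ofFinset S).size := by
  have h : ∀ l : List ℕ, j ∈ l → j < (ofList (l.map ofNat)).size := by
    intro l
    induction l with
    | nil => simp
    | cons a l ih =>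
      intro h
      rw [List.map_cons, ofList_cons, size_cons]
      rcases List.mem_cons.1 h with rfl | h
      · rw [size_ofNat]; omega
      · have := ih h; omega
  exact h _ ((Finset.mem_sort _).2 hj)

/-- Numbers are written in unary, so the time to write them down bounds their values. -/
theorem EfficientFamily.exists_bound {i : ℕ → ℕ} {S : ℕ → Finset ℕ} {p : ℕ → Text V}
    (h : EfficientFamily Model i S p) : ∃ Q : Polynomial ℕ, ∀ κ, i κ < Q.eval κ ∧
      (∀ j ∈ S κ, j < Q.eval κ) ∧ (p κ).length < Q.eval κ := by
  obtain ⟨A, hA⟩ := h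
  refine ⟨A.bound.comp (2 * Polynomial.X + 1), fun κ => ?_⟩
  have h := A.size_le_of_eval_eq_pure (hA κ)
  have hp := Data.length_lt_size_ofText (p κ)
  simp only [Data.size_ofNat, Data.tuple, Data.ofList_cons, Data.ofList_nil, Data.size_cons] at h
  simp only [Polynomial.eval_comp, Polynomial.eval_add, Polynomial.eval_mul, Polynomial.eval_X,
    Polynomial.eval_ofNat, Polynomial.eval_one]
  refine ⟨by omega, fun j hj => ?_, by omega⟩
  have := Data.lt_size_ofFinset hj
  omega

theorem Negligible.tendsto_zero {f : ℕ → ℝ} (h : Negligible f) : Tendsto f atTop (nhds 0) := by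
  simpa using h 0

namespace Scheme

variable {M : Scheme Model}

/-- The bounds for all detectors in `S κ` at once. -/
theorem Complete.exists_sum_le {δ : ℕ → ℕ → ℕ} (h : M.Complete δ) {i : ℕ → ℕ} {S : ℕ → Finset ℕ}
    {p : ℕ → Text V} {Q : Polynomial ℕ} (hQ : ∀ κ, i κ < Q.eval κ ∧
      (∀ j ∈ S κ, j < Q.eval κ) ∧ (p κ).length < Q.eval κ) :
    ∃ ε : ℕ → ℝ, Negligible ε ∧ ∀ κ, ∑ j ∈ S κ, Pr (M.completenessGame κ (i κ) j (S κ) (p κ))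
      (fun r => δ κ (S κ).card ≤ r.1.length ∧ r.2 = false) ≤ ε κ := by
  -- Completeness needs a detector for every `κ`, so empty sets are filled up; there the sum to be
  -- bounded is empty anyway.
  set S' : ℕ → Finset ℕ := fun κ => if S κ = ∅ then {0} else S κ with hS'
  have hne : ∀ κ, (S' κ).Nonempty := by
    intro κ
    by_cases hκ : S κ = ∅
    · simp [hS', hκ]
    · simpa [hS', hκ] using Finset.nonempty_iff_ne_empty.2 hκ
  set c : ℕ → ℕ → ℝ := fun κ j => Pr (M.completenessGame κ (i κ) j (S' κ) (p κ))
    (fun r => δ κ (S' κ).card ≤ r.1.length ∧ r.2 = false) with hc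
  -- Completeness holds for arbitrary sequences of detectors, in particular for the worst one at
  -- each `κ`; this makes the error uniform over `S κ`.
  choose j hj hmax using fun κ => Finset.exists_max_image (S' κ) (c κ) (hne κ)
  have hcompl : Negligible fun κ => c κ (j κ) := by
    refine h i j S' p Q fun κ => ⟨(hQ κ).1.le, fun a ha => ?_, (hQ κ).2.2.le, hj κ⟩
    rw [Finset.mem_range]
    by_cases hκ : S κ = ∅
    · simp only [hS', hκ, if_true, Finset.mem_singleton] at ha
      have := (hQ κ).1
      omega
    · simp only [hS', hκ, if_false] at ha
      exact (hQ κ).2.1 a ha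
  refine ⟨_, Asymptotics.SuperpolynomialDecay.polynomial_mul hcompl
    (Q.map (Nat.castRingHom ℝ)), fun κ => ?_⟩
  simp only [Polynomial.eval_natCast_map, eq_natCast]
  by_cases hκ : S κ = ∅
  · rw [hκ, Finset.sum_empty]
    exact mul_nonneg (Nat.cast_nonneg _) (Pr_nonneg _ _)
  · have hS : S' κ = S κ := by simp [hS', hκ]
    have hcard : (S κ).card ≤ Q.eval κ := by
      simpa using Finset.card_le_card
        (fun a ha => Finset.mem_range.2 ((hQ κ).2.1 a ha) : S κ ⊆ Finset.range (Q.eval κ))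
    have hle : ∀ a ∈ S κ, Pr (M.completenessGame κ (i κ) a (S κ) (p κ))
        (fun r => δ κ (S κ).card ≤ r.1.length ∧ r.2 = false) ≤ c κ (j κ) := by
      intro a ha
      have := hmax κ a (hS ▸ ha)
      simpa only [hc, hS] using this
    refine (Finset.sum_le_card_nsmul _ _ _ hle).trans ?_
    rw [nsmul_eq_mul]
    exact mul_le_mul_of_nonneg_right (by exact_mod_cast hcard) (Pr_nonneg _ _)

/-- The term `-2⁻ⁿ` is kept because for `n = 1` the bound would otherwise be the trivial `1`, too
weak for the second half of the theorem. -/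
theorem exists_generate_le {k : ℕ → ℕ} {δ : ℕ → ℕ → ℕ} (hδ : EfficientThreshold Model δ)
    (hcomplete : M.Complete δ) (hsound : M.Sound k) (hotr : M.OffTheRecordAnySubset)
    (W : M.Watermark) {i : ℕ → ℕ} {S : ℕ → Finset ℕ} {p : ℕ → Text V}
    (hfam : EfficientFamily Model i S p) :
    ∃ ε : ℕ → ℝ, Negligible ε ∧ ∀ κ,
      Pr (W.generate κ (i κ) (S κ) (p κ)) (fun r =>
        δ κ (S κ).card ≤ r.1.length ∧ 2 * r.2.length < (S κ).card) ≤
      (1 / 2 : ℝ) ^ ((S κ).card / 2) - (1 / 2) ^ (S κ).card + ε κ := by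
  obtain ⟨Q, hQ⟩ := hfam.exists_bound
  obtain ⟨ε, hε, hcompl⟩ := hcomplete.exists_sum_le hQ
  obtain ⟨thr, hthr⟩ := hδ
  obtain ⟨fam, hfam⟩ := hfam
  obtain ⟨F, hF⟩ := hotr
  obtain ⟨A, q, hA⟩ := feasible_distinguisher (K := M.otrSetting F) fam thr W.alg M.detect
    (M.tame_secKey_otr F) (M.tame_watPub_otr F) (M.tame_detPub_otr F) (M.tame_challenge_otr F)
  obtain ⟨B, q', hB⟩ := feasible_forger (K := M.soundSetting) fam F
    M.tame_secKey_sound M.tame_watPub_sound M.tame_detPub_sound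
  have hF := hF A (M.gameTime q) fun κ r hr => M.otrGame_steps hA r hr
  have hB' := hsound B (M.gameTime q') fun κ r hr => M.soundGame_steps hB r hr
  -- Twice the distinguishing advantage, plus all completeness errors, plus the forger's success
  -- probability. The factor 2 undoes the halving in `expect_otrGame`.
  refine ⟨_, ((hF.const_mul 2).add hε).add hB', fun κ => ?_⟩
  classical
  have h1 := expect_generate_le (κ := κ) (S := S κ) W δ F (i κ) (p κ)
  have h2 := M.expect_otrGame hthr W (hfam κ) hA
  have h3 := alarm_true_le (k := k κ) hB (hfam κ) W δ
  have hRf : alarm W δ κ F false (S κ) (p κ) ≤ 1 := alarm_le_one W δ F false (p κ)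
  have hRt : alarm W δ κ F true (S κ) (p κ) ≤ 1 := alarm_le_one W δ F true (p κ)
  simp only [← ofReal_Pr] at h1 h2 h3
  set n := (S κ).card
  set Rf := alarm W δ κ F false (S κ) (p κ)
  set Rt := alarm W δ κ F true (S κ) (p κ)
  have htf : Rf ≠ ⊤ := ne_top_of_le_ne_top ENNReal.one_ne_top hRf
  have htt : Rt ≠ ⊤ := ne_top_of_le_ne_top ENNReal.one_ne_top hRt
  rw [← ENNReal.ofReal_sum_of_nonneg fun _ _ => Pr_nonneg _ _, ← ENNReal.ofReal_toReal htf,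
    ← ENNReal.ofReal_add ENNReal.toReal_nonneg (Finset.sum_nonneg fun _ _ => Pr_nonneg _ _),
    ENNReal.ofReal_le_ofReal_iff (add_nonneg ENNReal.toReal_nonneg
      (Finset.sum_nonneg fun _ _ => Pr_nonneg _ _))] at h1
  have h2 := congrArg ENNReal.toReal h2
  rw [ENNReal.toReal_ofReal (Pr_nonneg _ _), ENNReal.toReal_mul, ENNReal.toReal_add htt (by simp),
    ENNReal.toReal_sub_of_le hRf ENNReal.one_ne_top, ENNReal.toReal_inv, ENNReal.toReal_ofNat,
    ENNReal.toReal_one] at h2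
  have h3 := ENNReal.toReal_mono (by finiteness) h3
  rw [ENNReal.toReal_add (by finiteness) ENNReal.ofReal_ne_top,
    ENNReal.toReal_ofReal (Pr_nonneg _ _), ENNReal.toReal_mul, ENNReal.toReal_pow,
    ENNReal.toReal_inv, ENNReal.toReal_ofNat, ENNReal.toReal_natCast,
    Nat.cast_sub Nat.one_le_two_pow] at h3
  have h4 := hcompl κ
  have h5 := neg_abs_le (Pr (M.otrGame κ F A ((M.gameTime q).eval κ + 1)) (fun r => r.1 = true)
    - 1 / 2)
  -- Uses `n = ⌊n/2⌋ + ⌈n/2⌉`.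
  have h6 : (2⁻¹ : ℝ) ^ n * (((2 ^ ((n + 1) / 2) : ℕ) : ℝ) - (1 : ℕ)) =
      (1 / 2) ^ (n / 2) - (1 / 2) ^ n := by
    have hsplit : n = n / 2 + (n + 1) / 2 := by omega
    have h : (2⁻¹ : ℝ) ^ n = (1 / 2) ^ (n / 2) * (1 / 2) ^ ((n + 1) / 2) := by
      rw [← pow_add, ← hsplit, one_div]
    have h' : ((1 / 2 : ℝ)) ^ ((n + 1) / 2) * 2 ^ ((n + 1) / 2) = 1 := by
      rw [← mul_pow]; norm_num
    have hh : (1 / 2 : ℝ) ^ n = (2⁻¹ : ℝ) ^ n := by rw [one_div]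
    rw [hh, mul_sub, Nat.cast_one, mul_one, h]
    push_cast
    rw [mul_assoc, h', mul_one]
  rw [h6] at h3
  simp only [Pi.add_apply]
  linarith

end Scheme

end Watermarking

theorem mainTheorem5 {V : ℕ} (Model : Watermarking.LanguageModel V)
    (M : Watermarking.Scheme Model) (k : ℕ → ℕ) (δ : ℕ → ℕ → ℕ)
    (hδ : Watermarking.EfficientThreshold Model δ)
    (hcomplete : M.Complete δ) (hsound : M.Sound k) (hotr : M.OffTheRecordAnySubset)
    (W : M.Watermark) (i : ℕ → ℕ) (S : ℕ → Finset ℕ) (p : ℕ → Watermarking.Text V)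
    (hfam : Watermarking.EfficientFamily Model i S p) :
    (∃ ε : ℕ → ℝ, Watermarking.Negligible ε ∧ ∀ κ : ℕ,
      Watermarking.Pr (W.generate κ (i κ) (S κ) (p κ)) (fun r =>
        δ κ (S κ).card ≤ r.1.length ∧ 2 * r.2.length < (S κ).card)
        ≤ (1 / 2 : ℝ) ^ ((S κ).card / 2) + ε κ) ∧
    (∀ ℓ : ℕ → ℕ,
      (∀ κ : ℕ, ∀ r ∈ (W.generate κ (i κ) (S κ) (p κ)).support, r.2.length ≤ ℓ κ) →
      Watermarking.Negligible (fun κ : ℕ =>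
        Watermarking.Pr (W.generate κ (i κ) (S κ) (p κ)) (fun r =>
          r.1.length < δ κ (S κ).card)) →
      ∀ᶠ κ : ℕ in Filter.atTop, (S κ).card ≤ 2 * ℓ κ) := by
  obtain ⟨ε, hε, hle⟩ :=
    Watermarking.Scheme.exists_generate_le hδ hcomplete hsound hotr W hfam
  refine ⟨⟨ε, hε, fun κ => (hle κ).trans ?_⟩, fun ℓ hℓ hlong => ?_⟩
  · have : (0 : ℝ) ≤ (1 / 2) ^ (S κ).card := by positivity
    linarith
  -- The main term never exceeds `1/2` for `n ≥ 1`, so the two errors need only fall below the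
  -- remaining `1/2`.
  · have hlim := (hε.tendsto_zero.add hlong.tendsto_zero).eventually_lt_const
      (show (0 : ℝ) + 0 < 1 / 2 by norm_num)
    filter_upwards [hlim] with κ hκ
    by_contra! hlt
    -- If `2 ℓ < n`, every generated watermark is short, so each text either is below the threshold
    -- or belongs to the event just bounded.
    have hcover : (1 : ℝ) ≤ Watermarking.Pr (W.generate κ (i κ) (S κ) (p κ)) (fun r =>
        δ κ (S κ).card ≤ r.1.length ∧ 2 * r.2.length < (S κ).card) +
        Watermarking.Pr (W.generate κ (i κ) (S κ) (p κ)) (fun r =>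
          r.1.length < δ κ (S κ).card) := by
      classical
      rw [← ENNReal.ofReal_le_ofReal_iff (add_nonneg (Watermarking.Pr_nonneg _ _)
        (Watermarking.Pr_nonneg _ _)), ENNReal.ofReal_add (Watermarking.Pr_nonneg _ _)
        (Watermarking.Pr_nonneg _ _), Watermarking.ofReal_Pr, Watermarking.ofReal_Pr,
        ← Watermarking.expect_add, ENNReal.ofReal_one]
      refine (Watermarking.expect_const (W.generate κ (i κ) (S κ) (p κ)) 1).ge.trans
        (Watermarking.expect_mono fun r hr => ?_)
      have hr : 2 * r.2.length < (S κ).card := by have := hℓ κ r hr; omega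
      by_cases h : r.1.length < δ κ (S κ).card
      · simp [h]
      · simp [hr, not_lt.1 h]
    -- For `n = 1` this is `1 - 1/2`, the case that needs the subtracted term; for `n ≥ 2` the first
    -- power alone is at most `1/2`.
    have hhalf : (1 / 2 : ℝ) ^ ((S κ).card / 2) - (1 / 2) ^ (S κ).card ≤ 1 / 2 := by
      rcases Nat.lt_or_ge (S κ).card 2 with h | h
      · have : (S κ).card = 1 := by omega
        rw [this]; norm_num
      · have h1 : (1 / 2 : ℝ) ^ ((S κ).card / 2) ≤ (1 / 2) ^ 1 :=
          pow_le_pow_of_le_one (by norm_num) (by norm_num) (by omega)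
        have h2 : (0 : ℝ) ≤ (1 / 2) ^ (S κ).card := by positivity
        linarith
    have := hle κ
    linarith
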